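/- A graded Frobenius algebra of degree $d\ge 0$ is a finite-dimensional graded $\mathbb Q$-vector space $A=\bigoplus_{i=-d}^{d}A^i$ with an associative, graded commutative multiplication of degree $d$ (so $A^iA^j\subseteq A^{i+j+d}$ and $ab=(-1)^{|a||b|}ba$), a unit $1\in A^{-d}$, and a linear form $\int:A\to\mathbb Q$ of degree $-d$ (so $\int$ vanishes on $A^i$ for $i\neq d$) such that the bilinear form $\langle a,b\rangle=\int ab$ is non-degenerate. For a finite set $I$ let $A^{\otimes I}$ be the tensor power of $A$ over $I$, with the total grading $|\otimes_i a_i|=\sum_i|a_i|$, the componentwise product (with the sign of reordering the factors), and the integral $\int\otimes_i a_i=\prod_i\int a_i$; the form $\int xy$ on it is non-degenerate. For a surjection $\varphi:I\to J$ of finite sets let $\varphi^*:A^{\otimes I}\to A^{\otimes J}$ be the map multiplying together the factors in each fibre of $\varphi$ (with the sign of reordering), and let $\varphi_*:A^{\otimes J}\to A^{\otimes I}$ be its adjoint with respect to these forms. Let $e\in A$ be the Euler class, i.e. the image of $1$ under $A\to A\otimes A\to A$, where the second map is the multiplication and the first is its adjoint, and put $e^\nu=\otimes_i e^{\nu(i)}$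 for $\nu:I\to\mathbb N_0$. For $n\ge 0$ and a subgroup $H\subseteq S_n$ write $H\backslash[n]$ for the set of $H$-orbits in $[n]=\{1,\dots,n\}$. For $\pi,\rho\in S_n$ and $B\in\langle\pi,\rho\rangle\backslash[n]$ let $$g(\pi,\rho)(B)=\tfrac12\bigl(|B|+2-|\langle\pi\rangle\backslash B|-|\langle\rho\rangle\backslash B|-|\langle\pi\rho\rangle\backslash B|\bigr)\in\mathbb N_0 .$$ Let $A\{S_n\}=\bigoplus_{\pi\in S_n}A^{\otimes\langle\pi\rangle\backslash[n]}\cdot\pi$, graded by $|a\pi|=|a|$, with the product $$a\pi\cdot b\rho=f_*\bigl(p^*(a)\cdot q^*(b)\cdot e^{g(\pi,\rho)}\bigr)\,\pi\rho,$$ where $p,q,f$ are the canonical surjections onto $\langle\pi,\rho\rangle\backslash[n]$ from $\langle\pi\rangle\backslash[n]$, $\langle\rho\rangle\backslash[n]$, $\langle\pi\rho\rangle\backslash[n]$ respectively. Let $\sigma\in S_n$ act on $A\{S_n\}$ by $\tilde\sigma(a\pi)=\sigma^*(a)\,\sigma\pi\sigma^{-1}$, where $\sigma^*$ is induced by the bijection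 $\langle\pi\rangle\backslash[n]\to\langle\sigma\pi\sigma^{-1}\rangle\backslash[n]$, $x\mapsto\sigma x$, and let $A^{[n]}=(A\{S_n\})^{S_n}$ be the graded subspace of invariants. Define a linear form $\int:A\{S_n\}\to\mathbb Q$ by $\int(a\pi)=\int a$ if $\pi=\mathrm{id}$ and $\int(a\pi)=0$ otherwise. Proposition. Let $A$ be a graded Frobenius algebra of degree $d$ and $n\ge 0$. Then the pairing $(x,y)\mapsto\int(x\cdot y)$ on $A\{S_n\}$ is non-degenerate and $S_n$-invariant, i.e. $\int(\tilde\sigma x\cdot\tilde\sigma y)=\int(x\cdot y)$ for all $\sigma\in S_n$ and $x,y\in A\{S_n\}$. Moreover, $A^{[n]}$, with the grading and the product of $A\{S_n\}$ and the restriction of $\int$, is a graded Frobenius algebra of degree $nd$; in particular $A^{[n]}$ is closed under the product and contains a unit for it. -/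

import Mathlib

open scoped TensorProduct DirectSum

noncomputable section

/-- A graded Frobenius algebra of degree `d` on the rational vector space `A`: a finite-dimensional
grading `A = ⨁ A^i`, concentrated in degrees `-d ≤ i ≤ d`, an associative, graded commutative
multiplication of degree `d` with a unit (of degree `-d`), and a linear form of degree `-d`
(so it vanishes on `A^i` for `i ≠ d`) such that `⟨a, b⟩ = ∫ a b` is non-degenerate. -/
structure GradedFrobeniusAlgebra (A : Type*) [AddCommGroup A] [Module ℚ A] (d : ℕ) where
  /-- the homogeneous components `A^i` -/
  grading : ℤ → Submodule ℚ A
  /-- the multiplication -/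
  mul : A →ₗ[ℚ] A →ₗ[ℚ] A
  /-- the unit element -/
  one : A
  /-- the linear form `∫` -/
  integral : A →ₗ[ℚ] ℚ
  finiteDimensional : FiniteDimensional ℚ A
  isInternal : DirectSum.IsInternal grading
  grading_eq_bot : ∀ i : ℤ, i < -(d : ℤ) ∨ (d : ℤ) < i → grading i = ⊥
  mul_mem : ∀ (i j : ℤ) (a b : A), a ∈ grading i → b ∈ grading j → mul a b ∈ grading (i + j + d)
  mul_assoc : ∀ a b c : A, mul (mul a b) c = mul a (mul b c)
  one_mul : ∀ a : A, mul one a = a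
  mul_one : ∀ a : A, mul a one = a
  one_mem : one ∈ grading (-(d : ℤ))
  mul_comm : ∀ (i j : ℤ) (a b : A), a ∈ grading i → b ∈ grading j →
    mul a b = (i * j).negOnePow • mul b a
  integral_eq_zero : ∀ (i : ℤ) (a : A), a ∈ grading i → i ≠ d → integral a = 0
  nondegenerate : (mul.compr₂ integral).Nondegenerate

/-- The tensor power `A^{⊗ I}` of `A` over a finite index set `I`. The index sets below carry a
linear order, i.e. an enumeration, which fixes an isomorphism with `A^{⊗ n}`, `n = |I|`; the order
enters only through the signs produced by interchanging elements of odd degree. -/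
abbrev TensorPow (A : Type*) [AddCommGroup A] [Module ℚ A] (I : Type*) : Type _ :=
  ⨂[ℚ] _ : I, A

namespace GradedFrobeniusAlgebra

variable {A : Type*} [AddCommGroup A] [Module ℚ A] {d : ℕ} (F : GradedFrobeniusAlgebra A d)

/-- The isomorphism `⨁ A^i ≅ A`. -/
def decomposition : (⨁ i, F.grading i) ≃ₗ[ℚ] A :=
  LinearEquiv.ofBijective (DirectSum.coeLinearMap F.grading)
    (show Function.Bijective (DirectSum.coeLinearMap F.grading) from F.isInternal)

lemma decomposition_apply (x : ⨁ i, F.grading i) :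
    F.decomposition x = DirectSum.coeLinearMap F.grading x := rfl

/-- The projection `A → A^i ⊆ A` onto the homogeneous component of degree `i`. -/
def component (i : ℤ) : A →ₗ[ℚ] A :=
  (F.grading i).subtype ∘ₗ DirectSum.component ℚ ℤ (fun i => F.grading i) i ∘ₗ
    F.decomposition.symm.toLinearMap

lemma component_apply (i : ℤ) (a : A) :
    F.component i a = ((F.decomposition.symm a i : F.grading i) : A) := rfl

lemma component_mem (i : ℤ) (a : A) : F.component i a ∈ F.grading i :=
  (F.decomposition.symm a i).2

lemma component_component (i j : ℤ) (a : A) :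
    F.component i (F.component j a) = if i = j then F.component j a else 0 := by
  have h : F.decomposition.symm (F.component j a) = DirectSum.lof ℚ ℤ (fun i => F.grading i) j
        ⟨F.component j a, F.component_mem j a⟩ := by
    rw [LinearEquiv.symm_apply_eq, decomposition_apply, DirectSum.coeLinearMap_lof]
  rw [F.component_apply i, h, DirectSum.lof_eq_of]
  split_ifs with hij
  · subst hij
    rw [DirectSum.of_eq_same]
  · rw [DirectSum.of_eq_of_ne _ _ _ hij, Submodule.coe_zero]

lemma sum_component (a : A) :
    ∑ i ∈ Finset.Icc (-(d : ℤ)) d, F.component i a = a := by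
  classical
  have h0 : ∀ i, i ∉ Finset.Icc (-(d : ℤ)) d → F.decomposition.symm a i = 0 := by
    intro i hi
    have hb := F.grading_eq_bot i (by simp only [Finset.mem_Icc] at hi; omega)
    exact Subtype.ext ((Submodule.mem_bot ℚ).1 (hb.le (F.decomposition.symm a i).2))
  have h1 : a = ∑ i ∈ (F.decomposition.symm a).support, F.component i a := by
    conv_lhs => rw [← F.decomposition.apply_symm_apply a]
    exact DirectSum.coeLinearMap_eq_dfinsuppSum F.grading (F.decomposition.symm a)
  conv_rhs => rw [h1]
  symm
  refine Finset.sum_subset (fun i hi => ?_) (fun i _ hi => ?_)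
  · by_contra hc
    simp [h0 i hc] at hi
  · rw [component_apply, DFinsupp.notMem_support_iff.1 hi, Submodule.coe_zero]

section TensorPower

variable (I : Type*) [Fintype I]

/-- The integral of `A^{⊗ I}`: `∫ (⊗ a_i) = ∏ ∫ a_i`. -/
def tensorIntegral : TensorPow A I →ₗ[ℚ] ℚ :=
  PiTensorProduct.lift ((MultilinearMap.mkPiAlgebra ℚ I ℚ).compLinearMap fun _ => F.integral)

/-- The degree `k` part of `A^{⊗ I}`, spanned by the `⊗ a_i` with `a_i` homogeneous and
`∑ |a_i| = k`. -/
def tensorGrading (k : ℤ) : Submodule ℚ (TensorPow A I) :=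
  Submodule.span ℚ {x | ∃ (p : I → ℤ) (a : I → A), (∀ i, a i ∈ F.grading (p i)) ∧
    ∑ i, p i = k ∧ x = PiTensorProduct.tprod ℚ a}

/-- The form `∏ ⟨a_i, b_i⟩` without signs. Auxiliary. -/
def unsignedForm : LinearMap.BilinForm ℚ (TensorPow A I) :=
  (PiTensorProduct.map₂ fun _ : I => F.mul).compr₂ (F.tensorIntegral I)

lemma unsignedForm_tprod (a b : I → A) :
    F.unsignedForm I (PiTensorProduct.tprod ℚ a) (PiTensorProduct.tprod ℚ b) =
      ∏ i, F.integral (F.mul (a i) (b i)) := by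
  simp [unsignedForm, tensorIntegral, PiTensorProduct.map₂_tprod_tprod]

lemma unsignedForm_nondegenerate : (F.unsignedForm I).Nondegenerate := by
  classical
  have := F.finiteDimensional
  let B : LinearMap.BilinForm ℚ A := F.mul.compr₂ F.integral
  have hB : B.Nondegenerate := F.nondegenerate
  let b := Module.finBasis ℚ A
  let bl := B.dualBasis hB b
  let br := B.flip.dualBasis hB.flip b
  let e := Basis.piTensorProduct (fun _ : I => b)
  have hl : ∀ i j, F.integral (F.mul (bl i) (b j)) = if j = i then 1 else 0 :=
    fun i j => B.apply_dualBasis_left hB b i j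
  have hr : ∀ i j, F.integral (F.mul (b j) (br i)) = if j = i then 1 else 0 :=
    fun i j => B.flip.apply_dualBasis_left hB.flip b i j
  have key : ∀ k l : I → Fin (Module.finrank ℚ A),
      (∏ i, if k i = l i then (1 : ℚ) else 0) = if k = l then 1 else 0 := by
    intro k l
    rw [Finset.prod_ite_zero]
    simp [funext_iff]
  have h1 : ∀ l, (F.unsignedForm I).flip (PiTensorProduct.tprod ℚ fun i => br (l i)) =
      e.coord l := by
    intro l
    refine e.ext fun k => ?_
    simp only [e, LinearMap.BilinForm.flip_apply, Basis.piTensorProduct_apply, unsignedForm_tprod,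
      hr, key, Module.Basis.coord_apply, Basis.piTensorProduct_repr_tprod_apply, Module.Basis.repr_self,
      Finsupp.single_apply]
  have h2 : ∀ l, F.unsignedForm I (PiTensorProduct.tprod ℚ fun i => bl (l i)) = e.coord l := by
    intro l
    refine e.ext fun k => ?_
    simp only [e, Basis.piTensorProduct_apply, unsignedForm_tprod, hl, key,
      Module.Basis.coord_apply, Basis.piTensorProduct_repr_tprod_apply, Module.Basis.repr_self,
      Finsupp.single_apply]
  refine ⟨fun x hx => ?_, fun y hy => ?_⟩
  · refine e.ext_elem fun l => ?_
    rw [← e.coord_apply, ← h1, LinearMap.BilinForm.flip_apply, hx]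
    simp
  · refine e.ext_elem fun l => ?_
    rw [← e.coord_apply, ← h2, hy]
    simp

lemma map_component_map_component (p q : I → ℤ) (x : TensorPow A I) :
    PiTensorProduct.map (fun i => F.component (p i))
      (PiTensorProduct.map (fun i => F.component (q i)) x) =
      if p = q then PiTensorProduct.map (fun i => F.component (q i)) x else 0 := by
  classical
  induction x using PiTensorProduct.induction_on with
  | smul_tprod r a =>
    simp only [map_smul, PiTensorProduct.map_tprod, component_component]
    split_ifs with h
    · subst h; simp
    · obtain ⟨i, hi⟩ := Function.ne_iff.1 h
      rw [(PiTensorProduct.tprod ℚ).map_coord_zero i (by simp [hi]), smul_zero]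
  | add x y hx hy =>
    simp only [map_add, hx, hy]
    split_ifs <;> simp

/-- The possible degrees `(|a_i|)_{i ∈ I}` of a tensor `⊗ a_i` with homogeneous factors. -/
def multidegrees (d : ℕ) (I : Type*) [Fintype I] [LinearOrder I] : Finset (I → ℤ) :=
  Fintype.piFinset fun _ => Finset.Icc (-(d : ℤ)) d

variable [LinearOrder I]

lemma sum_map_component (x : TensorPow A I) :
    ∑ q ∈ multidegrees d I, PiTensorProduct.map (fun i => F.component (q i)) x = x := by
  classical
  suffices h : ∑ q ∈ multidegrees d I, PiTensorProduct.map (fun i => F.component (q i)) =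
      (LinearMap.id : TensorPow A I →ₗ[ℚ] TensorPow A I) by
    simpa using LinearMap.congr_fun h x
  refine PiTensorProduct.ext (MultilinearMap.ext fun a => ?_)
  simp only [LinearMap.compMultilinearMap_apply, LinearMap.sum_apply, PiTensorProduct.map_tprod,
    LinearMap.id_apply]
  rw [multidegrees, ← MultilinearMap.map_sum_finset (PiTensorProduct.tprod ℚ)
    (fun i j => F.component j (a i))]
  simp [sum_component]

variable {I} in
/-- The sign that results from reordering `a_1 ⋯ a_n b_1 ⋯ b_n` into `a_1 b_1 ⋯ a_n b_n`, where
`|a_i| = p i` and `|b_i| = q i`. -/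
def mulSign (p q : I → ℤ) : ℚ :=
  ((∑ x : I × I with x.2 < x.1, p x.1 * q x.2).negOnePow : ℤ)

/-- The multiplication of `A^{⊗ I}`: for homogeneous factors,
`(⊗ a_i) (⊗ b_i) = ε(a, b) ⊗ (a_i b_i)`. -/
def tensorMul : TensorPow A I →ₗ[ℚ] TensorPow A I →ₗ[ℚ] TensorPow A I :=
  ∑ p ∈ multidegrees d I, ∑ q ∈ multidegrees d I, mulSign p q •
    PiTensorProduct.map₂ fun i => F.mul.compl₁₂ (F.component (p i)) (F.component (q i))

/-- The bilinear form `⟨x, y⟩ = ∫ x y` on `A^{⊗ I}`. -/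
def tensorForm : LinearMap.BilinForm ℚ (TensorPow A I) :=
  (F.tensorMul I).compr₂ (F.tensorIntegral I)

/-- The involution relating the two forms. Auxiliary. -/
def signTwist : TensorPow A I →ₗ[ℚ] TensorPow A I :=
  ∑ q ∈ multidegrees d I, mulSign (-q) q •
    PiTensorProduct.map fun i => F.component (q i)

variable {I} in
lemma mulSign_mul_self (p q : I → ℤ) : mulSign p q * mulSign p q = 1 := by
  unfold mulSign
  rcases Int.even_or_odd (∑ x : I × I with x.2 < x.1, p x.1 * q x.2) with h | h
  · simp [Int.negOnePow_even _ h]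
  · simp [Int.negOnePow_odd _ h]

lemma signTwist_signTwist (x : TensorPow A I) : F.signTwist I (F.signTwist I x) = x := by
  classical
  conv_rhs => rw [← F.sum_map_component I x]
  simp only [signTwist, LinearMap.sum_apply, LinearMap.smul_apply, map_sum, map_smul,
    map_component_map_component]
  refine Finset.sum_congr rfl fun p hp => ?_
  rw [Finset.sum_eq_single p]
  · simp [smul_smul, mulSign_mul_self]
  · intro q _ hq
    simp [hq]
  · exact fun h => absurd hp h

lemma tensorForm_eq (x y : TensorPow A I) :
    F.tensorForm I x y = F.unsignedForm I x (F.signTwist I y) := by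
  classical
  have h0 : ∀ (p q : I → ℤ) (x y : TensorPow A I),
      F.tensorIntegral I (PiTensorProduct.map₂ (fun i => F.mul.compl₁₂ (F.component (p i))
        (F.component (q i))) x y) =
      F.unsignedForm I (PiTensorProduct.map (fun i => F.component (p i)) x)
        (PiTensorProduct.map (fun i => F.component (q i)) y) := by
    intro p q x y
    induction x using PiTensorProduct.induction_on with
    | smul_tprod r a =>
      induction y using PiTensorProduct.induction_on with
      | smul_tprod s b =>
        simp [unsignedForm_tprod, PiTensorProduct.map₂_tprod_tprod, PiTensorProduct.map_tprod,
          tensorIntegral]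
      | add y z hy hz => simp only [map_add, hy, hz]
    | add x z hx hz => simp only [map_add, LinearMap.add_apply, hx, hz]
  have h1 : ∀ (p q : I → ℤ) (x y : TensorPow A I), p ≠ -q →
      F.unsignedForm I (PiTensorProduct.map (fun i => F.component (p i)) x)
        (PiTensorProduct.map (fun i => F.component (q i)) y) = 0 := by
    intro p q x y hpq
    obtain ⟨i, hi⟩ := Function.ne_iff.1 hpq
    induction x using PiTensorProduct.induction_on with
    | smul_tprod r a =>
      induction y using PiTensorProduct.induction_on with
      | smul_tprod s b =>
        simp only [map_smul, LinearMap.smul_apply, PiTensorProduct.map_tprod, unsignedForm_tprod]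
        rw [Finset.prod_eq_zero (Finset.mem_univ i)]
        · simp
        · refine F.integral_eq_zero _ _ (F.mul_mem _ _ _ _ (F.component_mem _ _)
            (F.component_mem _ _)) ?_
          simp only [Pi.neg_apply] at hi
          omega
      | add y z hy hz => simp only [map_add, hy, hz, add_zero]
    | add x z hx hz => simp only [map_add, LinearMap.add_apply, hx, hz, add_zero]
  simp only [tensorForm, tensorMul, LinearMap.compr₂_apply, LinearMap.sum_apply,
    LinearMap.smul_apply, map_sum, map_smul, h0, signTwist]
  rw [Finset.sum_comm]
  refine Finset.sum_congr rfl fun q hq => ?_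
  conv_rhs => rw [← F.sum_map_component I x]
  simp only [map_sum, LinearMap.sum_apply, Finset.smul_sum]
  refine Finset.sum_congr rfl fun p _ => ?_
  by_cases h : p = -q
  · rw [h]
  · rw [h1 p q x y h, smul_zero, smul_zero]

/-- The bilinear form of `A^{⊗ I}` is non-degenerate, so that adjoints exist and are unique. -/
lemma tensorForm_nondegenerate : (F.tensorForm I).Nondegenerate := by
  refine ⟨fun x hx => (F.unsignedForm_nondegenerate I).1 x fun y => ?_, fun y hy => ?_⟩
  · rw [← F.signTwist_signTwist I y, ← tensorForm_eq, hx]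
  · have h : F.signTwist I y = 0 := (F.unsignedForm_nondegenerate I).2 _ fun x => by
      rw [← tensorForm_eq, hy]
    rw [← F.signTwist_signTwist I y, h, map_zero]

/-- The ordered product `a_{i_1} ⋯ a_{i_r}` along a list `i_1, …, i_r` of indices. -/
def listProd {I : Type*} (a : I → A) (l : List I) : A :=
  l.foldr (fun i x => F.mul (a i) x) F.one

lemma listProd_update_of_notMem {I : Type*} [DecidableEq I] (a : I → A) (i : I) (x : A)
    (l : List I) (hi : i ∉ l) : F.listProd (Function.update a i x) l = F.listProd a l := by
  induction l with
  | nil => rfl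
  | cons j l ih =>
    simp only [List.mem_cons, not_or] at hi
    have h1 := ih hi.2
    simp only [listProd, List.foldr_cons] at h1 ⊢
    rw [h1, Function.update_of_ne (Ne.symm hi.1)]

lemma exists_listProd_update {I : Type*} [DecidableEq I] (a : I → A) (i : I)
    (l : List I) (hl : l.Nodup) (hi : i ∈ l) :
    ∃ f : A →ₗ[ℚ] A, ∀ x, F.listProd (Function.update a i x) l = f x := by
  induction l with
  | nil => simp at hi
  | cons j l ih =>
    rw [List.nodup_cons] at hl
    by_cases hij : i = j
    · subst hij
      refine ⟨F.mul.flip (F.listProd a l), fun x => ?_⟩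
      have h1 := F.listProd_update_of_notMem a i x l hl.1
      simp only [listProd, List.foldr_cons, LinearMap.flip_apply] at h1 ⊢
      rw [h1, Function.update_self]
    · obtain ⟨f, hf⟩ := ih hl.2 (by simpa [hij] using hi)
      refine ⟨F.mul (a j) ∘ₗ f, fun x => ?_⟩
      have h1 := hf x
      simp only [listProd, List.foldr_cons, LinearMap.comp_apply] at h1 ⊢
      rw [h1, Function.update_of_ne (Ne.symm hij)]

variable {I} {J : Type*} [LinearOrder J]

/-- The fibre `φ⁻¹(j)`, listed in increasing order. -/
def fiber (φ : I → J) (j : J) : List I := (Finset.univ.filter fun i => φ i = j).sort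

lemma listProd_fiber_update [DecidableEq I] (φ : I → J) (a : I → A) (i : I) (x : A) :
    (fun j => F.listProd (Function.update a i x) (fiber φ j)) =
      Function.update (fun j => F.listProd a (fiber φ j)) (φ i)
        (F.listProd (Function.update a i x) (fiber φ (φ i))) := by
  funext j
  by_cases h : j = φ i
  · subst h; rw [Function.update_self]
  · rw [Function.update_of_ne h, listProd_update_of_notMem]
    simpa [fiber] using Ne.symm h

/-- The multilinear map `(a_i) ↦ ⊗_j ∏_{i ∈ φ⁻¹(j)} a_i`, the products in increasing order. -/
def fiberProd (φ : I → J) : MultilinearMap ℚ (fun _ : I => A) (TensorPow A J) where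
  toFun a := PiTensorProduct.tprod ℚ fun j => F.listProd a (fiber φ j)
  map_update_add' := by
    intro _ a i x y
    obtain ⟨f, hf⟩ := F.exists_listProd_update a i (fiber φ (φ i))
      (Finset.sort_nodup _ _) (by simp [fiber])
    simp only [listProd_fiber_update, hf, map_add, MultilinearMap.map_update_add]
  map_update_smul' := by
    intro _ a i c x
    obtain ⟨f, hf⟩ := F.exists_listProd_update a i (fiber φ (φ i))
      (Finset.sort_nodup _ _) (by simp [fiber])
    simp only [listProd_fiber_update, hf, map_smul, MultilinearMap.map_update_smul]

/-- The sign that results from reordering the factors of `⊗ a_i`, `|a_i| = p i`, from the order of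
`I` into blocks, one for each fibre of `φ : I → J`, the blocks being in the order of `J` and each
block keeping the order of `I`. -/
def blockSign (φ : I → J) (p : I → ℤ) : ℚ :=
  ((∑ x : I × I with x.1 < x.2 ∧ φ x.2 < φ x.1, p x.1 * p x.2).negOnePow : ℤ)

/-- The map `φ^* : A^{⊗ I} → A^{⊗ J}` that multiplies the factors in each fibre of `φ : I → J`:
for homogeneous factors, `φ^*(⊗ a_i) = ± ⊗_j ∏_{i ∈ φ⁻¹(j)} a_i`. If `φ` is bijective, this is the
relabelling of tensors by `φ`. -/
def pull (φ : I → J) : TensorPow A I →ₗ[ℚ] TensorPow A J :=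
  ∑ p ∈ multidegrees d I, blockSign φ p •
    PiTensorProduct.lift ((F.fiberProd φ).compLinearMap fun i => F.component (p i))

variable [Fintype J]

/-- The map `φ_* : A^{⊗ J} → A^{⊗ I}` adjoint to `φ^*` with respect to the bilinear forms on
`A^{⊗ I}` and `A^{⊗ J}`; see `tensorForm_push`. -/
def push (φ : I → J) : TensorPow A J →ₗ[ℚ] TensorPow A I :=
  haveI := F.finiteDimensional
  (((F.tensorForm I).toDual (F.tensorForm_nondegenerate I)).symm : _ →ₗ[ℚ] _) ∘ₗ
    (F.pull φ).dualMap ∘ₗ F.tensorForm J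

lemma tensorForm_push (φ : I → J) (x : TensorPow A J) (y : TensorPow A I) :
    F.tensorForm I (F.push φ x) y = F.tensorForm J x (F.pull φ y) := by
  have := F.finiteDimensional
  simp [push]

end TensorPower

/-- The Euler class `e ∈ A`: the image of `1` under `A → A ⊗ A → A`, where the first map is
adjoint to the multiplication and the second is the multiplication. -/
def euler : A :=
  PiTensorProduct.subsingletonEquiv (0 : Fin 1)
    (F.pull (fun _ : Fin 2 => (0 : Fin 1)) (F.push (fun _ : Fin 2 => (0 : Fin 1))
      (PiTensorProduct.tprod ℚ fun _ => F.one)))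

/-- `e^ν = ⊗_i e^{ν(i)} ∈ A^{⊗ I}`. -/
def eulerPow {I : Type*} (ν : I → ℕ) : TensorPow A I :=
  PiTensorProduct.tprod ℚ fun i => (F.mul F.euler)^[ν i] F.one

end GradedFrobeniusAlgebra

/-- The orbit space `H \ [n]` of a subgroup `H ⊆ S_n`, where `[n]` is modelled by `Fin n`. -/
def Orb {n : ℕ} (H : Subgroup (Equiv.Perm (Fin n))) : Type :=
  MulAction.orbitRel.Quotient H (Fin n)

namespace Orb

open Equiv

variable {n : ℕ}

/-- The orbit of `i`. -/
def mk (H : Subgroup (Perm (Fin n))) (i : Fin n) : Orb H :=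
  Quotient.mk (MulAction.orbitRel H (Fin n)) i

lemma mk_surjective (H : Subgroup (Perm (Fin n))) : Function.Surjective (mk H) :=
  Quotient.mk_surjective

lemma mk_eq_mk {H : Subgroup (Perm (Fin n))} {i j : Fin n} :
    mk H i = mk H j ↔ ∃ σ ∈ H, σ j = i := by
  have h : mk H i = mk H j ↔ i ∈ MulAction.orbit H j :=
    Quotient.eq (r := MulAction.orbitRel H (Fin n))
  rw [h]
  simp [MulAction.mem_orbit_iff, Subgroup.smul_def]

instance (H : Subgroup (Perm (Fin n))) : Finite (Orb H) :=
  Finite.of_surjective _ (mk_surjective H)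

instance (H : Subgroup (Perm (Fin n))) : Fintype (Orb H) := Fintype.ofFinite _

open Classical in
/-- The smallest element of an orbit. -/
def min {H : Subgroup (Perm (Fin n))} (B : Orb H) : Fin n :=
  (Finset.univ.filter fun i => mk H i = B).min'
    (by obtain ⟨i, hi⟩ := mk_surjective H B; exact ⟨i, by simp [hi]⟩)

lemma mk_min {H : Subgroup (Perm (Fin n))} (B : Orb H) : mk H B.min = B := by
  classical
  change mk H (Finset.min' _ _) = B
  exact (Finset.mem_filter.1 (Finset.min'_mem (Finset.univ.filter fun i => mk H i = B) _)).2

/-- The orbits are ordered by their smallest elements. -/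
instance (H : Subgroup (Perm (Fin n))) : LinearOrder (Orb H) :=
  LinearOrder.lift' Orb.min fun B C h => by rw [← mk_min B, ← mk_min C, h]

/-- The surjection `H \ [n] → K \ [n]` for `H ⊆ K`. -/
def map {H K : Subgroup (Perm (Fin n))} (h : H ≤ K) : Orb H → Orb K :=
  Quotient.lift (mk K) fun i j hij => by
    obtain ⟨σ, hσ, e⟩ := mk_eq_mk.1 (show mk H i = mk H j from Quotient.sound hij)
    exact mk_eq_mk.2 ⟨σ, h hσ, e⟩

/-- The bijection `⟨π⟩ \ [n] → ⟨σ π σ⁻¹⟩ \ [n]`, `x ↦ σ x`. -/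
def conj (σ π : Perm (Fin n)) :
    Orb (Subgroup.zpowers π) → Orb (Subgroup.zpowers (σ * π * σ⁻¹)) :=
  Quotient.lift (fun i => mk _ (σ i)) fun i j hij => by
    obtain ⟨τ, hτ, e⟩ :=
      mk_eq_mk.1 (show mk (Subgroup.zpowers π) i = mk _ j from Quotient.sound hij)
    obtain ⟨k, rfl⟩ := Subgroup.mem_zpowers_iff.1 hτ
    exact mk_eq_mk.2 ⟨σ * π ^ k * σ⁻¹, Subgroup.mem_zpowers_iff.2 ⟨k, conj_zpow⟩, by simp [e]⟩

open Classical in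
/-- `|H \ B|`, the number of `H`-orbits contained in the `K`-orbit `B`, for `H ⊆ K`. -/
def count {H K : Subgroup (Perm (Fin n))} (h : H ≤ K) (B : Orb K) : ℕ :=
  (Finset.univ.filter fun C : Orb H => map h C = B).card

open Classical in
/-- `|B|`, the number of elements of the orbit `B`. -/
def size {K : Subgroup (Perm (Fin n))} (B : Orb K) : ℕ :=
  (Finset.univ.filter fun i => mk K i = B).card

end Orb

section Permutations

open Equiv

variable {n : ℕ}

lemma zpowers_left_le (π ρ : Perm (Fin n)) :
    Subgroup.zpowers π ≤ Subgroup.closure {π, ρ} :=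
  Subgroup.zpowers_le.2 (Subgroup.subset_closure (by simp))

lemma zpowers_right_le (π ρ : Perm (Fin n)) :
    Subgroup.zpowers ρ ≤ Subgroup.closure {π, ρ} :=
  Subgroup.zpowers_le.2 (Subgroup.subset_closure (by simp))

lemma zpowers_mul_le (π ρ : Perm (Fin n)) :
    Subgroup.zpowers (π * ρ) ≤ Subgroup.closure {π, ρ} :=
  Subgroup.zpowers_le.2 (mul_mem (Subgroup.subset_closure (by simp))
    (Subgroup.subset_closure (by simp)))

/-- The graph defect `g(π, ρ)(B) = (|B| + 2 - |π \ B| - |ρ \ B| - |πρ \ B|) / 2` for an orbit `B`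
of the group `⟨π, ρ⟩`. -/
def graphDefect (π ρ : Perm (Fin n)) (B : Orb (Subgroup.closure {π, ρ})) : ℚ :=
  ((B.size : ℚ) + 2 - Orb.count (zpowers_left_le π ρ) B - Orb.count (zpowers_right_le π ρ) B
    - Orb.count (zpowers_mul_le π ρ) B) / 2

end Permutations

/-- `A{S_n} = ⨁_{π ∈ S_n} A^{⊗ ⟨π⟩\[n]} · π`. -/
abbrev SymTensor (A : Type*) [AddCommGroup A] [Module ℚ A] (n : ℕ) : Type _ :=
  ⨁ π : Equiv.Perm (Fin n), TensorPow A (Orb (Subgroup.zpowers π))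

namespace GradedFrobeniusAlgebra

open Equiv

variable {A : Type*} [AddCommGroup A] [Module ℚ A] {d : ℕ} (F : GradedFrobeniusAlgebra A d)
  (n : ℕ)

/-- The map `m_{π,ρ}(a ⊗ b) = f_{⟨π,ρ⟩,πρ} (f^{π,⟨π,ρ⟩}(a) · f^{ρ,⟨π,ρ⟩}(b) · e^{g(π,ρ)})`. The graph
defect always is a non-negative integer, so the floor only changes its type to `ℕ`. -/
def symMulAux {n : ℕ} (π ρ : Perm (Fin n)) :
    TensorPow A (Orb (Subgroup.zpowers π)) →ₗ[ℚ] TensorPow A (Orb (Subgroup.zpowers ρ)) →ₗ[ℚ]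
      TensorPow A (Orb (Subgroup.zpowers (π * ρ))) :=
  (((F.tensorMul (Orb (Subgroup.closure {π, ρ}))).compl₁₂
      (F.pull (Orb.map (zpowers_left_le π ρ))) (F.pull (Orb.map (zpowers_right_le π ρ)))).compr₂
    ((F.tensorMul _).flip (F.eulerPow fun B => ⌊graphDefect π ρ B⌋₊))).compr₂
    (F.push (Orb.map (zpowers_mul_le π ρ)))

/-- The product `aπ · bρ = m_{π,ρ}(a ⊗ b) πρ` of `A{S_n}`. -/
def symMul : SymTensor A n →ₗ[ℚ] SymTensor A n →ₗ[ℚ] SymTensor A n :=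
  DirectSum.toModule ℚ _ _ fun π => LinearMap.flip <| DirectSum.toModule ℚ _ _ fun ρ =>
    LinearMap.flip <| (F.symMulAux π ρ).compr₂
      (DirectSum.lof ℚ (Perm (Fin n)) (fun π => TensorPow A (Orb (Subgroup.zpowers π))) (π * ρ))

/-- The action of `σ ∈ S_n` on `A{S_n}`: `aπ ↦ σ^*(a) σπσ⁻¹`. -/
def symAct (σ : Perm (Fin n)) : SymTensor A n →ₗ[ℚ] SymTensor A n :=
  DirectSum.toModule ℚ _ _ fun π =>
    DirectSum.lof ℚ (Perm (Fin n)) (fun π => TensorPow A (Orb (Subgroup.zpowers π)))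
      (σ * π * σ⁻¹) ∘ₗ F.pull (Orb.conj σ π)

/-- The integral `∫ : A{S_n} → ℚ`: `∫ (aπ) = ∫ a` if `π = id`, and `0` otherwise. -/
def symIntegral : SymTensor A n →ₗ[ℚ] ℚ :=
  DirectSum.toModule ℚ _ _ fun π => if π = 1 then F.tensorIntegral _ else 0

/-- The pairing `⟨x, y⟩ = ∫ x · y` on `A{S_n}`. -/
def symForm : LinearMap.BilinForm ℚ (SymTensor A n) :=
  (F.symMul n).compr₂ (F.symIntegral n)

/-- The degree `k` part of `A{S_n}`, where `|aπ| = |a|`. -/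
def symGrading (k : ℤ) : Submodule ℚ (SymTensor A n) :=
  ⨅ π, (F.tensorGrading (Orb (Subgroup.zpowers π)) k).comap (DirectSum.component ℚ _ _ π)

/-- `A^{[n]} = (A{S_n})^{S_n}`, the subspace of invariants. -/
def symInvariants : Submodule ℚ (SymTensor A n) :=
  ⨅ σ, LinearMap.eqLocus (F.symAct n σ) LinearMap.id

end GradedFrobeniusAlgebra

end

/-!
The degree `d` may be assumed to be even: for odd `d` the unit is of odd degree, so that `1 = 1 · 1`
equals `-1 · 1 = -1`, hence `A = 0`. Then everything is zero except for `n = 0`, where all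
constructions agree with those for the zero algebra of degree `0`. The assumption `Fact (Even d)`
makes the signs attached to degrees insensitive to shifts by multiples of `d`.

For even `d` the tensor powers `A^{⊗ I}` are graded commutative algebras, in which a pure tensor is
the ordered product of its factors (`pure_eq_list_prod`). As a consequence `φ^*` is a homomorphism
of algebras that relabels the factors without any further sign (`pullHom`, `pullHom_incl`), and the
sign rule never has to be unfolded again. Its adjoint `φ_*` satisfies the projection formula
(`push_mul`, `mul_push`) and, for every pushout square of surjections, the base change formula
`q^* p_* (a) = s_* (r^* (a) e^ν)` (`base_change`), where `ν` counts the independent cycles of the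
bipartite graph that the square defines over each point of the pushout. Base change is reduced by
induction to the identification of two points, where it expresses that the Euler class is the
self-intersection of the diagonal (`pullHom_push_merge`).

All sets of orbits are only used up to bijection (`IsOrbitMap`, `el`), so that the product
`aπ · bρ` can be computed with any convenient models of the sets of orbits (`el_mul`). The graph
defect is a non-negative integer because it is `0` if `ρ` is a transposition and, by
`fiberCard_add_le`, factoring a transposition out of `ρ` leaves a non-negative remainder
(`exists_isDefect`). Both bracketings of a product of three elements are by base change of the
form `f_* (p^*(a) q^*(b) r^*(c) e^G)` over the orbits of `⟨π, ρ, σ⟩`; the exponent `G` is in both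
cases determined by the numbers of orbits of `π`, `ρ`, `σ` and `πρσ`, so that the product is
associative (`symMul_assoc`). It is commutative up to the action of `S_n`,
`aπ · bρ = ± π̃(bρ) · aπ` (`el_mul_comm`), hence graded commutative on invariants. The form pairs
the summands of `π` and `π⁻¹` by the form of `A^{⊗ ⟨π⟩\[n]}` and all others trivially
(`symForm_nondegenerate`), and averaging over `S_n` transfers non-degeneracy to the invariants
(`invForm_nondegenerate`).
-/

noncomputable section

set_option linter.unusedSectionVars false

/-! ### Signs and ordered products in graded commutative rings -/

/-- The sign `(-1)^k` as a rational number. -/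
def sgn (k : ℤ) : ℚ := ((k.negOnePow : ℤ) : ℚ)

lemma sgn_add (k l : ℤ) : sgn (k + l) = sgn k * sgn l := by
  simp [sgn, Int.negOnePow_add]

@[simp] lemma sgn_zero : sgn 0 = 1 := by simp [sgn]

lemma sgn_even {k : ℤ} (h : Even k) : sgn k = 1 := by simp [sgn, Int.negOnePow_even _ h]

lemma sgn_odd {k : ℤ} (h : Odd k) : sgn k = -1 := by simp [sgn, Int.negOnePow_odd _ h]

lemma sgn_congr {k l : ℤ} (h : Even (k - l)) : sgn k = sgn l := by
  rw [show k = (k - l) + l by ring, sgn_add, sgn_even h, one_mul]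

@[simp] lemma sgn_mul_self (k : ℤ) : sgn k * sgn k = 1 := by
  rw [← sgn_add]
  exact sgn_even ⟨k, rfl⟩

lemma negOnePow_smul_eq {M : Type*} [AddCommGroup M] [Module ℚ M] (k : ℤ) (x : M) :
    k.negOnePow • x = sgn k • x := by
  rcases Int.even_or_odd k with h | h
  · simp [sgn_even h, Int.negOnePow_even _ h]
  · simp [sgn_odd h, Int.negOnePow_odd _ h]

/-- The sum of `c i j` over all pairs of entries of a list in which `i` stands before `j`. -/
def pairSum {I : Type*} (c : I → I → ℤ) : List I → ℤ
  | [] => 0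
  | i :: L => (L.map (c i)).sum + pairSum c L

lemma pairSum_eq_of_pairwise {I : Type*} (c : I → I → ℤ) (r : I → I → Prop)
    [DecidableRel r] (hr : ∀ i j, r i j → ¬ r j i) (L : List I) (hL : L.Pairwise r) :
    pairSum c L = (L.map fun i => (L.map fun j => if r i j then c i j else 0).sum).sum := by
  induction L with
  | nil => rfl
  | cons i L ih =>
    rw [List.pairwise_cons] at hL
    have h1 : (L.map fun j => if r i j then c i j else 0) = L.map (c i) :=
      List.map_congr_left fun j hj => if_pos (hL.1 j hj)
    have h2 : (L.map fun j => (if r j i then c j i else 0) +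
        (L.map fun k => if r j k then c j k else 0).sum) =
        L.map fun j => (L.map fun k => if r j k then c j k else 0).sum :=
      List.map_congr_left fun j hj => by rw [if_neg (hr _ _ (hL.1 j hj)), zero_add]
    simp only [pairSum, List.map_cons, List.sum_cons, h1, h2, ih hL.2]
    rw [if_neg fun h => hr _ _ h h, zero_add]

lemma pairSum_eq_sum_univ {I : Type*} [Fintype I] (c : I → I → ℤ) (r : I → I → Prop)
    [DecidableRel r] (hr : ∀ i j, r i j → ¬ r j i) (L : List I) (hL : L.Pairwise r)
    (hn : L.Nodup) (hu : ∀ i, i ∈ L) :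
    pairSum c L = ∑ x : I × I, if r x.1 x.2 then c x.1 x.2 else 0 := by
  classical
  rw [pairSum_eq_of_pairwise c r hr L hL, ← List.sum_toFinset _ hn]
  have : L.toFinset = Finset.univ := by ext; simp [hu]
  simp only [← List.sum_toFinset _ hn, this, Fintype.sum_prod_type]

section SuperProducts

variable {R : Type*} [Ring R] [Algebra ℚ R] {I : Type*}

lemma mul_list_prod_of_superCommute {S : Type*} (y : R) (q : ℤ) (x : S → R) (p : S → ℤ)
    (h : ∀ j, x j * y = sgn (p j * q) • (y * x j)) (L : List S) :
    (L.map x).prod * y = sgn ((L.map fun j => p j * q).sum) • (y * (L.map x).prod) := by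
  induction L with
  | nil => simp
  | cons i L ih =>
    simp only [List.map_cons, List.prod_cons, List.sum_cons, sgn_add]
    rw [mul_assoc, ih, mul_smul_comm, ← mul_assoc, h, smul_mul_assoc, smul_smul, mul_assoc,
      mul_comm (sgn _)]

/-- Interleaving two ordered products in a graded commutative ring. -/
lemma list_prod_mul_list_prod (x y : I → R) (p q : I → ℤ)
    (h : ∀ i j, x j * y i = sgn (p j * q i) • (y i * x j)) (L : List I) :
    (L.map x).prod * (L.map y).prod =
      sgn (pairSum (fun i j => p j * q i) L) • (L.map fun i => x i * y i).prod := by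
  induction L with
  | nil => simp [pairSum]
  | cons i L ih =>
    simp only [List.map_cons, List.prod_cons, pairSum, sgn_add]
    rw [mul_assoc, ← mul_assoc _ (y i), mul_list_prod_of_superCommute (y i) (q i) x p (h i) L,
      smul_mul_assoc, mul_smul_comm, mul_assoc (y i), ih]
    simp only [mul_smul_comm, smul_smul, mul_assoc]

variable [LinearOrder I]

lemma mul_list_prod_orderedInsert (x : I → R) (p : I → ℤ)
    (h : ∀ i j, x i * x j = sgn (p i * p j) • (x j * x i)) (i : I) (M : List I)
    (hM : M.Pairwise (· ≤ ·)) :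
    x i * (M.map x).prod = sgn ((M.map fun j => if j < i then p i * p j else 0).sum) •
      ((M.orderedInsert (· ≤ ·) i).map x).prod := by
  induction M with
  | nil => simp
  | cons j M ih =>
    rw [List.pairwise_cons] at hM
    rw [List.orderedInsert_cons]
    split_ifs with hij
    · have : (fun k => if k < i then p i * p k else 0) j = 0 := if_neg (not_lt.2 hij)
      have h0 : ((j :: M).map fun k => if k < i then p i * p k else 0).sum = 0 := by
        refine List.sum_eq_zero fun z hz => ?_
        obtain ⟨k, hk, rfl⟩ := List.mem_map.1 hz
        rcases List.mem_cons.1 hk with rfl | hk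
        · exact this
        · exact if_neg (not_lt.2 (hij.trans (hM.1 k hk)))
      rw [h0, sgn_zero, one_smul, List.map_cons, List.map_cons, List.prod_cons, List.prod_cons,
        List.map_cons, List.prod_cons]
    · simp only [List.map_cons, List.prod_cons, List.sum_cons, if_pos (not_le.1 hij), sgn_add]
      rw [← mul_assoc, h i j, smul_mul_assoc, mul_assoc, ih hM.2, mul_smul_comm, smul_smul]

/-- Sorting an ordered product in a graded commutative ring produces the sign of the
inversions. -/
lemma list_prod_eq_sgn_smul_insertionSort (x : I → R) (p : I → ℤ)
    (h : ∀ i j, x i * x j = sgn (p i * p j) • (x j * x i)) (L : List I) :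
    (L.map x).prod = sgn (pairSum (fun i j => if j < i then p i * p j else 0) L) •
      ((L.insertionSort (· ≤ ·)).map x).prod := by
  induction L with
  | nil => simp [pairSum]
  | cons i L ih =>
    have hp : (L.map fun j => if j < i then p i * p j else 0).sum =
        ((L.insertionSort (· ≤ ·)).map fun j => if j < i then p i * p j else 0).sum :=
      ((List.perm_insertionSort (· ≤ ·) L).map _).sum_eq.symm
    simp only [List.map_cons, List.prod_cons, pairSum, sgn_add, List.insertionSort_cons]
    rw [ih, mul_smul_comm, mul_list_prod_orderedInsert x p h i _
      (List.pairwise_insertionSort (· ≤ ·) L), smul_smul, hp, mul_comm (sgn _)]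

lemma insertionSort_eq_sort_univ [Fintype I] (L : List I) (hn : L.Nodup) (hu : ∀ i, i ∈ L) :
    L.insertionSort (· ≤ ·) = (Finset.univ : Finset I).sort := by
  have hp : (L.insertionSort (· ≤ ·)).Perm ((Finset.univ : Finset I).sort) := by
    rw [List.perm_ext_iff_of_nodup ((List.perm_insertionSort _ L).nodup_iff.2 hn)
      (Finset.sort_nodup _ _)]
    simp [hu]
  exact hp.eq_of_pairwise (fun _ _ _ _ h h' => le_antisymm h h')
    (List.pairwise_insertionSort (· ≤ ·) L) (Finset.pairwise_sort _ _)

end SuperProducts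

namespace GradedFrobeniusAlgebra

variable {A : Type*} [AddCommGroup A] [Module ℚ A] {d : ℕ} (F : GradedFrobeniusAlgebra A d)

/-! ### Tensor powers on homogeneous tensors -/

lemma component_of_mem {i : ℤ} {a : A} (ha : a ∈ F.grading i) (j : ℤ) :
    F.component j a = if j = i then a else 0 := by
  have h : F.decomposition.symm a = DirectSum.lof ℚ ℤ (fun i => F.grading i) i ⟨a, ha⟩ := by
    rw [LinearEquiv.symm_apply_eq, decomposition_apply, DirectSum.coeLinearMap_lof]
  rw [component_apply, h, DirectSum.lof_eq_of]
  split_ifs with hij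
  · subst hij
    rw [DirectSum.of_eq_same]
  · rw [DirectSum.of_eq_of_ne _ _ _ hij, Submodule.coe_zero]

variable {I : Type*} [Fintype I] [LinearOrder I]

lemma tprod_eq_zero_of_notMem {p : I → ℤ} {a : I → A} (ha : ∀ i, a i ∈ F.grading (p i))
    (hp : p ∉ multidegrees d I) : PiTensorProduct.tprod ℚ a = 0 := by
  simp only [multidegrees, Fintype.mem_piFinset, not_forall] at hp
  obtain ⟨i, hi⟩ := hp
  have h := ha i
  rw [F.grading_eq_bot (p i) (by simp only [Finset.mem_Icc] at hi; omega), Submodule.mem_bot] at h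
  exact (PiTensorProduct.tprod ℚ).map_coord_zero i h

/-- Linear maps on `A^{⊗ I}` agree if they agree on tensors with homogeneous factors. -/
lemma linearMap_ext_homogeneous {M : Type*} [AddCommGroup M] [Module ℚ M]
    {f g : TensorPow A I →ₗ[ℚ] M}
    (h : ∀ (p : I → ℤ) (a : I → A), (∀ i, a i ∈ F.grading (p i)) →
      f (PiTensorProduct.tprod ℚ a) = g (PiTensorProduct.tprod ℚ a)) : f = g := by
  refine PiTensorProduct.ext (MultilinearMap.ext fun a => ?_)
  simp only [LinearMap.compMultilinearMap_apply]
  rw [← F.sum_map_component I (PiTensorProduct.tprod ℚ a)]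
  simp only [map_sum, PiTensorProduct.map_tprod]
  exact Finset.sum_congr rfl fun p _ => h p _ fun i => F.component_mem _ _

lemma mulSign_eq (p q : I → ℤ) :
    mulSign p q = sgn (∑ x : I × I, if x.2 < x.1 then p x.1 * q x.2 else 0) := by
  rw [mulSign, Finset.sum_filter, sgn]

lemma tensorMul_tprod {p q : I → ℤ} {a b : I → A} (ha : ∀ i, a i ∈ F.grading (p i))
    (hb : ∀ i, b i ∈ F.grading (q i)) :
    F.tensorMul I (PiTensorProduct.tprod ℚ a) (PiTensorProduct.tprod ℚ b) =
      mulSign p q • PiTensorProduct.tprod ℚ fun i => F.mul (a i) (b i) := by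
  have key : ∀ p' q' : I → ℤ, PiTensorProduct.map₂ (fun i => F.mul.compl₁₂ (F.component (p' i))
      (F.component (q' i))) (PiTensorProduct.tprod ℚ a) (PiTensorProduct.tprod ℚ b) =
      if p' = p ∧ q' = q then PiTensorProduct.tprod ℚ fun i => F.mul (a i) (b i) else 0 := by
    intro p' q'
    rw [PiTensorProduct.map₂_tprod_tprod]
    simp only [LinearMap.compl₁₂_apply, F.component_of_mem (ha _), F.component_of_mem (hb _)]
    split_ifs with h
    · obtain ⟨rfl, rfl⟩ := h
      simp
    · rw [not_and_or] at h
      rcases h with h | h <;> obtain ⟨i, hi⟩ := Function.ne_iff.1 h <;>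
      exact (PiTensorProduct.tprod ℚ).map_coord_zero i (by simp [hi])
  by_cases hp : p ∈ multidegrees d I
  swap
  · have hz := F.tprod_eq_zero_of_notMem ha hp
    have hz' : (PiTensorProduct.tprod ℚ fun i => F.mul (a i) (b i)) = 0 := by
      have := PiTensorProduct.map₂_tprod_tprod (R := ℚ) (fun _ : I => F.mul) a b
      rw [hz, map_zero, LinearMap.zero_apply] at this
      exact this.symm
    rw [hz, hz', map_zero, LinearMap.zero_apply, smul_zero]
  by_cases hq : q ∈ multidegrees d I
  swap
  · have hz := F.tprod_eq_zero_of_notMem hb hq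
    have hz' : (PiTensorProduct.tprod ℚ fun i => F.mul (a i) (b i)) = 0 := by
      have := PiTensorProduct.map₂_tprod_tprod (R := ℚ) (fun _ : I => F.mul) a b
      rw [hz, map_zero] at this
      exact this.symm
    rw [hz, hz', map_zero, smul_zero]
  simp only [tensorMul, LinearMap.sum_apply, LinearMap.smul_apply, key]
  rw [Finset.sum_eq_single_of_mem p hp, Finset.sum_eq_single_of_mem q hq]
  · simp
  · intro q' _ h
    simp [h]
  · intro p' _ h
    simp [h]

variable {J : Type*} [LinearOrder J]

lemma pull_tprod {p : I → ℤ} {a : I → A} (ha : ∀ i, a i ∈ F.grading (p i)) (φ : I → J) :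
    F.pull φ (PiTensorProduct.tprod ℚ a) =
      blockSign φ p • PiTensorProduct.tprod ℚ fun j => F.listProd a (fiber φ j) := by
  have key : ∀ q : I → ℤ, PiTensorProduct.lift ((F.fiberProd φ).compLinearMap fun i =>
      F.component (q i)) (PiTensorProduct.tprod ℚ a) = if q = p then F.fiberProd φ a else 0 := by
    intro q
    rw [PiTensorProduct.lift.tprod, MultilinearMap.compLinearMap_apply]
    simp only [F.component_of_mem (ha _)]
    split_ifs with h
    · subst h
      simp
    · obtain ⟨i, hi⟩ := Function.ne_iff.1 h
      exact (F.fiberProd φ).map_coord_zero i (by simp [hi])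
  change _ = blockSign φ p • F.fiberProd φ a
  by_cases hp : p ∈ multidegrees d I
  · simp only [pull, LinearMap.sum_apply, LinearMap.smul_apply, key]
    rw [Finset.sum_eq_single_of_mem p hp]
    · simp
    · intro q _ h
      simp [h]
  · have hz := F.tprod_eq_zero_of_notMem ha hp
    have h2 : F.fiberProd φ a =
        PiTensorProduct.lift (F.fiberProd φ) (PiTensorProduct.tprod ℚ a) := by
      simp
    rw [h2, hz, map_zero, map_zero, smul_zero]

end GradedFrobeniusAlgebra

namespace GradedFrobeniusAlgebra

variable {A : Type*} [AddCommGroup A] [Module ℚ A] {d : ℕ} (F : GradedFrobeniusAlgebra A d)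

/-! ### The graded commutative algebra `A^{⊗ I}` -/

section Induction

variable {I : Type*} [Fintype I] [LinearOrder I]

/-- The tensor power `A^{⊗ I}` is spanned by the tensors with homogeneous factors. -/
@[elab_as_elim]
lemma tensor_induction {motive : TensorPow A I → Prop} (x : TensorPow A I)
    (zero : motive 0) (add : ∀ x y, motive x → motive y → motive (x + y))
    (smul : ∀ (c : ℚ) x, motive x → motive (c • x))
    (tprod : ∀ (p : I → ℤ) (a : I → A), (∀ i, a i ∈ F.grading (p i)) →
      motive (PiTensorProduct.tprod ℚ a)) : motive x := by
  let S : Submodule ℚ (TensorPow A I) := Submodule.span ℚ {x | ∃ (p : I → ℤ) (a : I → A),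
    (∀ i, a i ∈ F.grading (p i)) ∧ x = PiTensorProduct.tprod ℚ a}
  have hS : S.mkQ = 0 := F.linearMap_ext_homogeneous fun p a ha => by
    rw [LinearMap.zero_apply, Submodule.mkQ_apply, Submodule.Quotient.mk_eq_zero]
    exact Submodule.subset_span ⟨p, a, ha, rfl⟩
  have hx : x ∈ S := by
    rw [← Submodule.Quotient.mk_eq_zero S, ← Submodule.mkQ_apply, hS, LinearMap.zero_apply]
  induction hx using Submodule.span_induction with
  | mem x h =>
    obtain ⟨p, a, ha, rfl⟩ := h
    exact tprod p a ha
  | zero => exact zero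
  | add x y _ _ hx hy => exact add x y hx hy
  | smul c x _ hx => exact smul c x hx

end Induction

/-- The tensor power `A^{⊗ I}` regarded as an algebra with the multiplication `tensorMul`. -/
def Pow (_F : GradedFrobeniusAlgebra A d) (I : Type*) : Type _ := TensorPow A I

instance instAddCommGroupPow (I : Type*) : AddCommGroup (F.Pow I) :=
  inferInstanceAs (AddCommGroup (TensorPow A I))

instance (I : Type*) : Module ℚ (F.Pow I) := inferInstanceAs (Module ℚ (TensorPow A I))

/-- A pure tensor as an element of the algebra `A^{⊗ I}`. -/
def pure {I : Type*} (a : I → A) : F.Pow I := PiTensorProduct.tprod ℚ a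

section Ring

variable {I : Type*} [Fintype I] [LinearOrder I]

@[elab_as_elim]
lemma pow_induction {motive : F.Pow I → Prop} (x : F.Pow I)
    (zero : motive 0) (add : ∀ x y, motive x → motive y → motive (x + y))
    (smul : ∀ (c : ℚ) x, motive x → motive (c • x))
    (pure : ∀ (p : I → ℤ) (a : I → A), (∀ i, a i ∈ F.grading (p i)) →
      motive (F.pure a)) : motive x :=
  F.tensor_induction (motive := motive) x zero add smul pure

lemma even_degree_mul [hd : Fact (Even d)] (k : ℤ) : Even ((d : ℤ) * k) :=
  ((Int.even_coe_nat d).2 hd.out).mul_right k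

lemma smul_tensorMul (c : ℚ) (x y : TensorPow A I) :
    F.tensorMul I (c • x) y = c • F.tensorMul I x y := by
  rw [map_smul, LinearMap.smul_apply]

lemma tensorMul_smul (c : ℚ) (x y : TensorPow A I) :
    F.tensorMul I x (c • y) = c • F.tensorMul I x y := map_smul _ _ _

lemma tprod_mem_tensorGrading {p : I → ℤ} {a : I → A} (ha : ∀ i, a i ∈ F.grading (p i)) :
    PiTensorProduct.tprod ℚ a ∈ F.tensorGrading I (∑ i, p i) :=
  Submodule.subset_span ⟨p, a, ha, rfl, rfl⟩

variable [Fact (Even d)]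

lemma mulSign_assoc (p q r : I → ℤ) :
    mulSign p q * mulSign (fun i => p i + q i + d) r =
      mulSign q r * mulSign p (fun i => q i + r i + d) := by
  simp only [mulSign_eq, ← sgn_add, ← Finset.sum_add_distrib]
  apply sgn_congr
  rw [← Finset.sum_sub_distrib]
  refine Finset.even_sum _ fun x _ => ?_
  split_ifs
  · rw [show p x.1 * q x.2 + (p x.1 + q x.1 + d) * r x.2 -
      (q x.1 * r x.2 + p x.1 * (q x.2 + r x.2 + d)) = d * (r x.2 - p x.1) by ring]
    exact even_degree_mul _
  · simp

lemma mulSign_eq_one_left (p q : I → ℤ) (hp : ∀ i, Even (p i)) : mulSign p q = 1 := by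
  rw [mulSign_eq]
  refine sgn_even (Finset.even_sum _ fun x _ => ?_)
  split_ifs
  · exact (hp _).mul_right _
  · simp

lemma mulSign_eq_one_right (p q : I → ℤ) (hq : ∀ i, Even (q i)) : mulSign p q = 1 := by
  rw [mulSign_eq]
  refine sgn_even (Finset.even_sum _ fun x _ => ?_)
  split_ifs
  · exact (hq _).mul_left _
  · simp

lemma even_neg_degree : Even (-(d : ℤ)) := by
  simpa using even_degree_mul (d := d) (-1)

lemma tensorMul_assoc (x y z : TensorPow A I) :
    F.tensorMul I (F.tensorMul I x y) z = F.tensorMul I x (F.tensorMul I y z) := by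
  induction x using F.tensor_induction (I := I) with
  | zero => simp
  | add x x' h h' => simp only [map_add, LinearMap.add_apply, h, h']
  | smul c x h => simp only [map_smul, LinearMap.smul_apply, h]
  | tprod p a ha =>
    induction y using F.tensor_induction (I := I) with
    | zero => simp
    | add x x' h h' => simp only [map_add, LinearMap.add_apply, h, h']
    | smul c x h => simp only [map_smul, LinearMap.smul_apply, h]
    | tprod q b hb =>
      induction z using F.tensor_induction (I := I) with
      | zero => simp
      | add x x' h h' => simp only [map_add, h, h']
      | smul c x h => simp only [map_smul, h]
      | tprod r c hc =>
        rw [F.tensorMul_tprod ha hb, F.tensorMul_tprod hb hc, map_smul, map_smul,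
          LinearMap.smul_apply,
          F.tensorMul_tprod (fun i => F.mul_mem _ _ _ _ (ha i) (hb i)) hc,
          F.tensorMul_tprod ha (fun i => F.mul_mem _ _ _ _ (hb i) (hc i)), smul_smul, smul_smul,
          mulSign_assoc]
        simp only [F.mul_assoc]

lemma one_tensorMul (x : TensorPow A I) :
    F.tensorMul I (PiTensorProduct.tprod ℚ fun _ => F.one) x = x := by
  induction x using F.tensor_induction (I := I) with
  | zero => simp
  | add x x' h h' => simp only [map_add, h, h']
  | smul c x h => simp only [map_smul, h]
  | tprod p a ha =>
    rw [F.tensorMul_tprod (fun _ => F.one_mem) ha, mulSign_eq_one_left _ _ fun _ => even_neg_degree]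
    simp only [F.one_mul, one_smul]

lemma tensorMul_one (x : TensorPow A I) :
    F.tensorMul I x (PiTensorProduct.tprod ℚ fun _ => F.one) = x := by
  induction x using F.tensor_induction (I := I) with
  | zero => simp
  | add x x' h h' => simp only [map_add, LinearMap.add_apply, h, h']
  | smul c x h => simp only [map_smul, LinearMap.smul_apply, h]
  | tprod p a ha =>
    rw [F.tensorMul_tprod ha (fun _ => F.one_mem), mulSign_eq_one_right _ _ fun _ => even_neg_degree]
    simp only [F.mul_one, one_smul]

instance : Ring (F.Pow I) :=
  { F.instAddCommGroupPow I with
    mul := fun x y => F.tensorMul I x y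
    one := F.pure fun _ => F.one
    mul_assoc := F.tensorMul_assoc
    one_mul := F.one_tensorMul
    mul_one := F.tensorMul_one
    zero_mul := fun x => LinearMap.map_zero₂ (F.tensorMul I) x
    mul_zero := fun x => map_zero (F.tensorMul I x)
    left_distrib := fun x y z => map_add (F.tensorMul I x) y z
    right_distrib := fun x y z => LinearMap.map_add₂ (F.tensorMul I) x y z }

instance : Algebra ℚ (F.Pow I) :=
  @Algebra.ofModule ℚ (F.Pow I) _ _ (F.instModuleRatPow I) F.smul_tensorMul F.tensorMul_smul

lemma one_def : (1 : F.Pow I) = F.pure fun _ => F.one := rfl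

lemma pure_mul_pure {p q : I → ℤ} {a b : I → A} (ha : ∀ i, a i ∈ F.grading (p i))
    (hb : ∀ i, b i ∈ F.grading (q i)) :
    F.pure a * F.pure b = mulSign p q • F.pure fun i => F.mul (a i) (b i) :=
  F.tensorMul_tprod ha hb

/-! ### Degrees -/

variable (I) in
/-- The degree `k` part of the algebra `A^{⊗ I}`. -/
def deg (k : ℤ) : Submodule ℚ (F.Pow I) := F.tensorGrading I k

lemma pure_mem_deg {p : I → ℤ} {a : I → A} (ha : ∀ i, a i ∈ F.grading (p i)) :
    F.pure a ∈ F.deg I (∑ i, p i) :=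
  F.tprod_mem_tensorGrading ha

@[elab_as_elim]
lemma deg_induction {k : ℤ} {motive : ∀ x : F.Pow I, x ∈ F.deg I k → Prop}
    (zero : motive 0 (zero_mem _))
    (add : ∀ x y hx hy, motive x hx → motive y hy → motive (x + y) (add_mem hx hy))
    (smul : ∀ (c : ℚ) x hx, motive x hx → motive (c • x) (Submodule.smul_mem _ c hx))
    (pure : ∀ (p : I → ℤ) (a : I → A) (ha : ∀ i, a i ∈ F.grading (p i)) (hk : ∑ i, p i = k),
      motive (F.pure a) (hk ▸ F.pure_mem_deg ha)) {x : F.Pow I} (hx : x ∈ F.deg I k) :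
    motive x hx := by
  induction hx using Submodule.span_induction with
  | mem x h =>
    obtain ⟨p, a, ha, hk, rfl⟩ := h
    exact pure p a ha hk
  | zero => exact zero
  | add x y hx hy h h' => exact add x y hx hy h h'
  | smul c x hx h => exact smul c x hx h

lemma mul_mem_deg {k l : ℤ} {x y : F.Pow I} (hx : x ∈ F.deg I k) (hy : y ∈ F.deg I l) :
    x * y ∈ F.deg I (k + l + d * Fintype.card I) := by
  induction hx using F.deg_induction (I := I) with
  | zero => simp
  | add x x' _ _ h h' => rw [add_mul]; exact add_mem h h'
  | smul c x _ h => rw [smul_mul_assoc]; exact Submodule.smul_mem _ _ h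
  | pure p a ha hk =>
    induction hy using F.deg_induction (I := I) with
    | zero => simp
    | add x x' _ _ h h' => rw [mul_add]; exact add_mem h h'
    | smul c x _ h => rw [mul_smul_comm]; exact Submodule.smul_mem _ _ h
    | pure q b hb hl =>
      rw [F.pure_mul_pure ha hb]
      refine Submodule.smul_mem _ _ ?_
      convert F.pure_mem_deg (fun i => F.mul_mem _ _ _ _ (ha i) (hb i)) using 2
      rw [Finset.sum_add_distrib, Finset.sum_add_distrib, hk, hl]
      simp [_root_.mul_comm]

lemma pure_smul (c : I → ℚ) (a : I → A) :
    F.pure (fun i => c i • a i) = (∏ i, c i) • F.pure a :=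
  (PiTensorProduct.tprod ℚ).map_smul_univ c a

lemma prod_sgn {ι : Type*} (s : Finset ι) (f : ι → ℤ) :
    ∏ i ∈ s, sgn (f i) = sgn (∑ i ∈ s, f i) := by
  classical
  induction s using Finset.induction_on with
  | empty => simp
  | insert i s hi ih => rw [Finset.prod_insert hi, Finset.sum_insert hi, sgn_add, ih]

/-- The algebra `A^{⊗ I}` is graded commutative. -/
lemma mul_comm_of_mem_deg {k l : ℤ} {x y : F.Pow I} (hx : x ∈ F.deg I k) (hy : y ∈ F.deg I l) :
    x * y = sgn (k * l) • (y * x) := by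
  induction hx using F.deg_induction (I := I) with
  | zero => simp
  | add x x' _ _ h h' => rw [add_mul, mul_add, smul_add, h, h']
  | smul c x _ h => rw [smul_mul_assoc, mul_smul_comm, h, smul_comm]
  | pure p a ha hk =>
    induction hy using F.deg_induction (I := I) with
    | zero => simp
    | add x x' _ _ h h' => rw [add_mul, mul_add, smul_add, h, h']
    | smul c x _ h => rw [smul_mul_assoc, mul_smul_comm, h, smul_comm]
    | pure q b hb hl =>
      have h1 : (fun i => F.mul (a i) (b i)) = fun i => sgn (p i * q i) • F.mul (b i) (a i) := by
        funext i
        rw [F.mul_comm _ _ _ _ (ha i) (hb i), negOnePow_smul_eq]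
      rw [F.pure_mul_pure ha hb, F.pure_mul_pure hb ha, h1, F.pure_smul, smul_smul,
        smul_smul, prod_sgn]
      congr 1
      simp only [mulSign_eq, ← sgn_add]
      apply sgn_congr
      have h2 : ∑ x : I × I, (if x.2 < x.1 then q x.1 * p x.2 else 0) =
          ∑ x : I × I, if x.1 < x.2 then p x.1 * q x.2 else 0 :=
        Fintype.sum_equiv (Equiv.prodComm I I) _ _ fun x =>
          if_congr Iff.rfl (_root_.mul_comm _ _) rfl
      have h3 : ∑ i, p i * q i = ∑ x : I × I, if x.1 = x.2 then p x.1 * q x.2 else 0 := by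
        simp [Fintype.sum_prod_type]
      have h4 : ∑ x : I × I, (if x.2 < x.1 then p x.1 * q x.2 else 0) +
          ∑ x : I × I, (if x.1 < x.2 then p x.1 * q x.2 else 0) +
          ∑ x : I × I, (if x.1 = x.2 then p x.1 * q x.2 else 0) = k * l := by
        rw [← hk, ← hl, Finset.sum_mul_sum, ← Finset.sum_product', Finset.univ_product_univ,
          ← Finset.sum_add_distrib, ← Finset.sum_add_distrib]
        refine Finset.sum_congr rfl fun x _ => ?_
        rcases lt_trichotomy x.1 x.2 with h | h | h
        · simp [h, h.ne, h.not_gt]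
        · simp [h]
        · simp [h, h.ne', h.not_gt]
      rw [h2, h3]
      exact ⟨-∑ x : I × I, (if x.1 < x.2 then p x.1 * q x.2 else 0), by rw [← h4]; ring⟩

end Ring

end GradedFrobeniusAlgebra

namespace GradedFrobeniusAlgebra

variable {A : Type*} [AddCommGroup A] [Module ℚ A] {d : ℕ} (F : GradedFrobeniusAlgebra A d)

/-! ### The universal property of `A^{⊗ I}` -/

@[elab_as_elim]
lemma homogeneous_induction {motive : A → Prop} (a : A)
    (zero : motive 0) (add : ∀ a b, motive a → motive b → motive (a + b))
    (mem : ∀ (i : ℤ) (a : A), a ∈ F.grading i → motive a) : motive a := by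
  rw [← F.sum_component a]
  exact Finset.sum_induction _ motive add zero fun i _ => mem i _ (F.component_mem i a)

variable {I : Type*} [Fintype I] [LinearOrder I]
variable {J : Type*} [Fintype J] [LinearOrder J]
variable {K : Type*} [Fintype K] [LinearOrder K]

/-- The embedding `A → A^{⊗ I}` of the factor with index `i`. -/
def incl (i : I) : A →ₗ[ℚ] F.Pow I :=
  (PiTensorProduct.tprod ℚ : MultilinearMap ℚ (fun _ : I => A) (TensorPow A I)).toLinearMap
    (fun _ => F.one) i

lemma incl_apply (i : I) (a : A) : F.incl i a = F.pure (Function.update (fun _ => F.one) i a) :=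
  rfl

lemma update_mem_grading {i : I} {k : ℤ} {a : A} (ha : a ∈ F.grading k) (j : I) :
    Function.update (fun _ => F.one) i a j ∈
      F.grading (Function.update (fun _ => -(d : ℤ)) i k j) := by
  by_cases h : j = i
  · subst h
    simpa using ha
  · simpa [h] using F.one_mem

variable [Fact (Even d)]

lemma incl_one (i : I) : F.incl i F.one = 1 := by
  rw [incl_apply, one_def]
  congr 1
  exact Function.update_eq_self i _

lemma incl_mem_deg (i : I) {k : ℤ} {a : A} (ha : a ∈ F.grading k) :
    F.incl i a ∈ F.deg I (k + d - d * Fintype.card I) := by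
  have h := F.pure_mem_deg (F.update_mem_grading (i := i) ha)
  rw [incl_apply]
  convert h using 2
  rw [Finset.sum_update_of_mem (Finset.mem_univ i), Finset.sum_const, Finset.card_sdiff,
    Finset.inter_univ, Finset.card_singleton, Finset.card_univ, nsmul_eq_mul,
    Nat.cast_sub (Fintype.card_pos_iff.2 ⟨i⟩)]
  push_cast
  ring

lemma incl_mul_incl_comm (i j : I) {k l : ℤ} {a b : A} (ha : a ∈ F.grading k)
    (hb : b ∈ F.grading l) :
    F.incl i a * F.incl j b = sgn (k * l) • (F.incl j b * F.incl i a) := by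
  rw [F.mul_comm_of_mem_deg (F.incl_mem_deg i ha) (F.incl_mem_deg j hb)]
  congr 1
  apply sgn_congr
  have := even_degree_mul (d := d) (((1 : ℤ) - Fintype.card I) * (k + l + d - d * Fintype.card I))
  convert this using 1
  ring

lemma incl_mul (i : I) (a b : A) : F.incl i (F.mul a b) = F.incl i a * F.incl i b := by
  induction a using F.homogeneous_induction with
  | zero => simp
  | add a a' h h' => simp only [map_add, LinearMap.add_apply, h, h', add_mul]
  | mem k a ha =>
    induction b using F.homogeneous_induction with
    | zero => simp
    | add b b' h h' => simp only [map_add, h, h', mul_add]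
    | mem l b hb =>
      simp only [incl_apply]
      rw [F.pure_mul_pure (F.update_mem_grading ha) (F.update_mem_grading hb)]
      have hs : mulSign (Function.update (fun _ => -(d : ℤ)) i k)
          (Function.update (fun _ => -(d : ℤ)) i l) = 1 := by
        rw [mulSign_eq]
        refine sgn_even (Finset.even_sum _ fun x _ => ?_)
        split_ifs with hx
        · by_cases h1 : x.1 = i
          · rw [Function.update_of_ne (a := x.2) (by rw [← h1]; exact hx.ne)]
            exact even_neg_degree.mul_left _
          · rw [Function.update_of_ne h1]
            exact even_neg_degree.mul_right _
        · simp
      rw [hs, one_smul]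
      congr 1
      funext j
      by_cases h : j = i
      · subst h
        simp
      · simp [h, F.one_mul]

lemma incl_listProd (j : J) (a : I → A) (l : List I) :
    F.incl j (F.listProd a l) = (l.map fun i => F.incl j (a i)).prod := by
  induction l with
  | nil => exact F.incl_one j
  | cons i l ih =>
    rw [List.map_cons, List.prod_cons, ← ih, ← incl_mul]
    rfl

/-- An increasing product of factors needs no signs, as the units in the other places are of even
degree. -/
lemma list_prod_incl {p : I → ℤ} {a : I → A} (ha : ∀ i, a i ∈ F.grading (p i)) (L : List I)
    (hL : L.Pairwise (· < ·)) :
    (L.map fun i => F.incl i (a i)).prod = F.pure fun i => if i ∈ L then a i else F.one := by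
  induction L with
  | nil => simp [one_def]
  | cons i L ih =>
    rw [List.pairwise_cons] at hL
    have hb : ∀ j, (if j ∈ L then a j else F.one) ∈
        F.grading (if j ∈ L then p j else -(d : ℤ)) := by
      intro j
      split_ifs
      · exact ha j
      · exact F.one_mem
    rw [List.map_cons, List.prod_cons, ih hL.2, incl_apply,
      F.pure_mul_pure (F.update_mem_grading (ha i)) hb]
    have hs : mulSign (Function.update (fun _ => -(d : ℤ)) i (p i))
        (fun j => if j ∈ L then p j else -(d : ℤ)) = 1 := by
      rw [mulSign_eq]
      refine sgn_even (Finset.even_sum _ fun x _ => ?_)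
      split_ifs with hx hx2
      · have h1 : x.1 ≠ i := fun h => lt_asymm hx (h ▸ hL.1 _ hx2)
        rw [Function.update_of_ne h1]
        exact even_neg_degree.mul_right _
      · exact even_neg_degree.mul_left _
      · simp
    rw [hs, one_smul]
    congr 1
    funext j
    by_cases h : j = i
    · subst h
      have : j ∉ L := fun h => lt_irrefl _ (hL.1 _ h)
      simp [this, F.mul_one]
    · simp [h, F.one_mul]

/-- A pure tensor is the ordered product of its factors. -/
lemma pure_eq_list_prod {p : I → ℤ} {a : I → A} (ha : ∀ i, a i ∈ F.grading (p i)) :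
    F.pure a = ((Finset.univ.sort).map fun i => F.incl i (a i)).prod := by
  rw [F.list_prod_incl ha _ (Finset.sortedLT_sort _).pairwise]
  simp

lemma listProd_mem {p : I → ℤ} {a : I → A} (ha : ∀ i, a i ∈ F.grading (p i)) (l : List I) :
    F.listProd a l ∈ F.grading ((l.map p).sum + (l.length - 1) * d) := by
  induction l with
  | nil => simpa [listProd] using F.one_mem
  | cons i l ih =>
    have h := F.mul_mem _ _ _ _ (ha i) ih
    simp only [listProd, List.foldr_cons, List.map_cons, List.sum_cons, List.length_cons] at h ⊢
    convert h using 2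
    push_cast
    ring

/-- `φ^*` maps an ordered product to the ordered product of the relabelled factors, without
signs. -/
lemma pull_pure {p : I → ℤ} {a : I → A} (ha : ∀ i, a i ∈ F.grading (p i)) (φ : I → J) :
    (F.pull φ (F.pure a) : F.Pow J) =
      ((Finset.univ.sort).map fun i => F.incl (φ i) (a i)).prod := by
  let L : List I := (Finset.univ.sort : List J).flatMap (fiber φ)
  let r : I → I → Prop := fun i j => φ i < φ j ∨ (φ i = φ j ∧ i < j)
  have hmem : ∀ i j, i ∈ fiber φ j ↔ φ i = j := by simp [fiber]
  have hr : ∀ i j, r i j → ¬ r j i := by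
    rintro i j (h | ⟨h, h'⟩) (h2 | ⟨h2, h2'⟩)
    · exact lt_asymm h h2
    · exact h.ne h2.symm
    · exact h2.ne h.symm
    · exact lt_asymm h' h2'
  have hLr : L.Pairwise r := by
    rw [List.pairwise_flatMap]
    refine ⟨fun j _ => ?_, ?_⟩
    · refine (List.pairwise_iff_forall_sublist.2 fun {x y} h => ?_)
      have hlt := List.pairwise_iff_forall_sublist.1
        (Finset.sortedLT_sort (Finset.univ.filter fun i => φ i = j)).pairwise h
      have hx := (hmem x j).1 (h.subset (by simp))
      have hy := (hmem y j).1 (h.subset (by simp))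
      exact Or.inr ⟨hx.trans hy.symm, hlt⟩
    · refine (Finset.sortedLT_sort (Finset.univ : Finset J)).pairwise.imp
        fun {j k} hjk x hx y hy => ?_
      rw [hmem] at hx hy
      exact Or.inl (by rw [hx, hy]; exact hjk)
  have hLn : L.Nodup := hLr.imp fun {i j} h => by
    rintro rfl
    exact hr _ _ h h
  have hLu : ∀ i, i ∈ L := fun i => List.mem_flatMap.2 ⟨φ i, by simp, (hmem _ _).2 rfl⟩
  have h1 : (F.pull φ (F.pure a) : F.Pow J) =
      blockSign φ p • (L.map fun i => F.incl (φ i) (a i)).prod := by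
    refine (F.pull_tprod ha φ).trans ?_
    congr 1
    refine (F.pure_eq_list_prod fun j => F.listProd_mem ha (fiber φ j)).trans ?_
    rw [List.map_flatMap, List.flatMap_def, List.prod_flatten, List.map_map]
    congr 1
    refine List.map_congr_left fun j _ => ?_
    rw [F.incl_listProd]
    congr 1
    exact List.map_congr_left fun i hi => by rw [(hmem _ _).1 hi]
  rw [h1, list_prod_eq_sgn_smul_insertionSort (fun i => F.incl (φ i) (a i)) p
    (fun i j => F.incl_mul_incl_comm _ _ (ha i) (ha j)) L, insertionSort_eq_sort_univ L hLn hLu,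
    smul_smul]
  have h2 : blockSign φ p = sgn (pairSum (fun i j => if j < i then p i * p j else 0) L) := by
    classical
    rw [pairSum_eq_sum_univ _ r hr L hLr hLn hLu, blockSign, ← sgn, Finset.sum_filter]
    congr 1
    refine Fintype.sum_equiv (Equiv.prodComm I I) _ _ fun x => ?_
    simp only [Equiv.prodComm_apply, Prod.fst_swap, Prod.snd_swap, r]
    by_cases h : x.1 < x.2
    · simp [h, h.not_gt, _root_.mul_comm]
    · simp [h]
  rw [h2, sgn_mul_self, one_smul]

/-- The map `φ^*` as a linear map between the algebras `A^{⊗ I}` and `A^{⊗ J}`. -/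
def pullLin (φ : I → J) : F.Pow I →ₗ[ℚ] F.Pow J := F.pull φ

lemma pullLin_pure {p : I → ℤ} {a : I → A} (ha : ∀ i, a i ∈ F.grading (p i)) (φ : I → J) :
    F.pullLin φ (F.pure a) = ((Finset.univ.sort).map fun i => F.incl (φ i) (a i)).prod :=
  F.pull_pure ha φ

lemma pullLin_mul (φ : I → J) (x y : F.Pow I) :
    F.pullLin φ (x * y) = F.pullLin φ x * F.pullLin φ y := by
  induction x using F.pow_induction (I := I) with
  | zero => simp
  | add x x' h h' => simp only [map_add, add_mul, h, h']
  | smul c x h => simp only [map_smul, smul_mul_assoc, h]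
  | pure p a ha =>
    induction y using F.pow_induction (I := I) with
    | zero => simp
    | add x x' h h' => simp only [map_add, mul_add, h, h']
    | smul c x h => simp only [map_smul, mul_smul_comm, h]
    | pure q b hb =>
      rw [F.pure_mul_pure ha hb, map_smul, F.pullLin_pure ha, F.pullLin_pure hb,
        F.pullLin_pure (fun i => F.mul_mem _ _ _ _ (ha i) (hb i)),
        list_prod_mul_list_prod (fun i => F.incl (φ i) (a i)) (fun i => F.incl (φ i) (b i)) p q
          (fun i j => F.incl_mul_incl_comm _ _ (ha j) (hb i))]
      simp only [incl_mul]
      congr 1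
      rw [pairSum_eq_sum_univ _ (· < ·) (fun _ _ => lt_asymm) _
        (Finset.sortedLT_sort _).pairwise (Finset.sort_nodup _ _) (by simp), mulSign_eq]
      congr 1
      exact Fintype.sum_equiv (Equiv.prodComm I I) _ _ fun x => rfl

lemma pullLin_one (φ : I → J) : F.pullLin φ 1 = 1 := by
  rw [one_def, F.pullLin_pure (fun _ => F.one_mem)]
  simp [incl_one]

/-- The map `φ^*` as a homomorphism of algebras. -/
def pullHom (φ : I → J) : F.Pow I →ₐ[ℚ] F.Pow J :=
  AlgHom.ofLinearMap (F.pullLin φ) (F.pullLin_one φ) (F.pullLin_mul φ)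

lemma pullHom_apply (φ : I → J) (x : F.Pow I) : F.pullHom φ x = F.pull φ x := rfl

lemma pullHom_incl (φ : I → J) (i : I) (a : A) :
    F.pullHom φ (F.incl i a) = F.incl (φ i) a := by
  induction a using F.homogeneous_induction with
  | zero => simp
  | add a b h h' => simp only [map_add, h, h']
  | mem k a ha =>
    refine (F.pull_pure (F.update_mem_grading ha) φ).trans ?_
    have key : ∀ L : List I, L.Nodup →
        (L.map fun j => F.incl (φ j) (Function.update (fun _ => F.one) i a j)).prod =
          if i ∈ L then F.incl (φ i) a else 1 := by
      intro L hL
      induction L with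
      | nil => simp
      | cons j L ih =>
        rw [List.nodup_cons] at hL
        rw [List.map_cons, List.prod_cons, ih hL.2]
        by_cases h : i = j
        · subst h
          simp [hL.1]
        · rw [Function.update_of_ne (Ne.symm h), incl_one, _root_.one_mul]
          simp [h]
    rw [key _ (Finset.sort_nodup _ _), if_pos (by simp)]

/-- An algebra homomorphism out of `A^{⊗ I}` is determined by its restrictions to the factors. -/
lemma algHom_ext {R : Type*} [Ring R] [Algebra ℚ R] {f g : F.Pow I →ₐ[ℚ] R}
    (h : ∀ i a, f (F.incl i a) = g (F.incl i a)) : f = g := by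
  ext x
  induction x using F.pow_induction (I := I) with
  | zero => simp
  | add x x' h h' => simp only [map_add, h, h']
  | smul c x h => simp only [map_smul, h]
  | pure p a ha =>
    rw [F.pure_eq_list_prod ha, map_list_prod, map_list_prod, List.map_map, List.map_map]
    simp only [Function.comp_def, h]

lemma pullHom_comp (ψ : J → K) (φ : I → J) (x : F.Pow I) :
    F.pullHom ψ (F.pullHom φ x) = F.pullHom (ψ ∘ φ) x := by
  have : (F.pullHom ψ).comp (F.pullHom φ) = F.pullHom (ψ ∘ φ) :=
    F.algHom_ext fun i a => by simp [pullHom_incl]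
  exact AlgHom.congr_fun this x

lemma pullHom_id (x : F.Pow I) : F.pullHom id x = x := by
  have : F.pullHom id = AlgHom.id ℚ (F.Pow I) :=
    F.algHom_ext fun i a => by simp [pullHom_incl]
  exact AlgHom.congr_fun this x

end GradedFrobeniusAlgebra

namespace GradedFrobeniusAlgebra

variable {A : Type*} [AddCommGroup A] [Module ℚ A] {d : ℕ} (F : GradedFrobeniusAlgebra A d)

variable {I : Type*} [Fintype I] [LinearOrder I]
variable {J : Type*} [Fintype J] [LinearOrder J]
variable {K : Type*} [Fintype K] [LinearOrder K]

/-! ### The decomposition of `A^{⊗ I}` by degree -/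

variable (I) in
/-- The projection of `A^{⊗ I}` onto its degree `k` part. -/
def degProj (k : ℤ) : F.Pow I →ₗ[ℚ] F.Pow I :=
  ∑ q ∈ multidegrees d I with ∑ i, q i = k, PiTensorProduct.map fun i => F.component (q i)

lemma degProj_pure {p : I → ℤ} {a : I → A} (ha : ∀ i, a i ∈ F.grading (p i)) (k : ℤ) :
    F.degProj I k (F.pure a) = if k = ∑ i, p i then F.pure a else 0 := by
  classical
  have key : ∀ q : I → ℤ, PiTensorProduct.map (fun i => F.component (q i))
      (PiTensorProduct.tprod ℚ a) = if q = p then PiTensorProduct.tprod ℚ a else 0 := by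
    intro q
    rw [PiTensorProduct.map_tprod]
    split_ifs with h
    · subst h
      simp only [F.component_of_mem (ha _), if_true]
    · obtain ⟨i, hi⟩ := Function.ne_iff.1 h
      exact (PiTensorProduct.tprod ℚ).map_coord_zero i (by simp [F.component_of_mem (ha i), hi])
  have h1 : (∑ q ∈ multidegrees d I with ∑ i, q i = k, PiTensorProduct.map fun i =>
      F.component (q i)) (PiTensorProduct.tprod ℚ a) =
      if k = ∑ i, p i then PiTensorProduct.tprod ℚ a else 0 := by
    rw [LinearMap.sum_apply, Finset.sum_congr rfl fun q _ => key q, Finset.sum_ite_eq']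
    by_cases hp : p ∈ multidegrees d I
    · simp [hp, eq_comm]
    · simp [F.tprod_eq_zero_of_notMem ha hp]
  exact h1

variable [Fact (Even d)]

lemma degProj_mem (k : ℤ) (x : F.Pow I) : F.degProj I k x ∈ F.deg I k := by
  induction x using F.pow_induction (I := I) with
  | zero => simp
  | add x x' h h' => rw [map_add]; exact add_mem h h'
  | smul c x h => rw [map_smul]; exact Submodule.smul_mem _ _ h
  | pure p a ha =>
    rw [F.degProj_pure ha]
    split_ifs with h
    · rw [h]
      exact F.tprod_mem_tensorGrading ha
    · exact zero_mem _

lemma sum_degProj (x : F.Pow I) :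
    ∑ k ∈ Finset.Icc (-(d * Fintype.card I : ℤ)) (d * Fintype.card I), F.degProj I k x = x := by
  induction x using F.pow_induction (I := I) with
  | zero => simp
  | add x x' h h' => simp only [map_add, Finset.sum_add_distrib, h, h']
  | smul c x h => simp only [map_smul, ← Finset.smul_sum, h]
  | pure p a ha =>
    simp only [F.degProj_pure ha, Finset.sum_ite_eq']
    split_ifs with h
    · rfl
    · by_cases hp : p ∈ multidegrees d I
      · refine absurd ?_ h
        simp only [multidegrees, Fintype.mem_piFinset, Finset.mem_Icc] at hp
        rw [Finset.mem_Icc]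
        have h1 := Finset.sum_le_sum fun i (_ : i ∈ Finset.univ) => (hp i).1
        have h2 := Finset.sum_le_sum fun i (_ : i ∈ Finset.univ) => (hp i).2
        simp only [Finset.sum_const, Finset.card_univ, nsmul_eq_mul] at h1 h2
        constructor <;> linarith
      · exact (F.tprod_eq_zero_of_notMem ha hp).symm

lemma degProj_of_mem {j : ℤ} {x : F.Pow I} (hx : x ∈ F.deg I j) (k : ℤ) :
    F.degProj I k x = if k = j then x else 0 := by
  induction hx using F.deg_induction (I := I) with
  | zero => simp
  | add x y _ _ h h' => rw [map_add, h, h']; split_ifs <;> simp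
  | smul c x _ h => rw [map_smul, h]; split_ifs <;> simp
  | pure p a ha hj => rw [F.degProj_pure ha, hj]

/-! ### The integral -/

variable (I) in
/-- The integral as a linear form on the algebra `A^{⊗ I}`. -/
def int : F.Pow I →ₗ[ℚ] ℚ := F.tensorIntegral I

lemma int_pure (a : I → A) : F.int I (F.pure a) = ∏ i, F.integral (a i) := by
  refine (PiTensorProduct.lift.tprod _).trans ?_
  simp

lemma int_eq_zero {k : ℤ} {x : F.Pow I} (hx : x ∈ F.deg I k) (hk : k ≠ d * Fintype.card I) :
    F.int I x = 0 := by
  induction hx using F.deg_induction (I := I) with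
  | zero => simp
  | add x y _ _ h h' => rw [map_add, h, h', add_zero]
  | smul c x _ h => rw [map_smul, h, smul_zero]
  | pure p a ha hj =>
    rw [int_pure]
    by_contra hne
    replace hne := Finset.prod_ne_zero_iff.1 hne
    refine hk ?_
    have hp : ∀ i, p i = d := fun i => by
      by_contra h
      exact hne i (Finset.mem_univ i) (F.integral_eq_zero _ _ (ha i) h)
    rw [← hj]
    simp [hp, _root_.mul_comm]

/-- The integral of a product of elements of the factors does not depend on their order, as only
factors of even degree contribute. -/
lemma int_list_prod {p : I → ℤ} {a : I → A} (ha : ∀ i, a i ∈ F.grading (p i)) (L : List I)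
    (hn : L.Nodup) (hu : ∀ i, i ∈ L) :
    F.int I (L.map fun i => F.incl i (a i)).prod = ∏ i, F.integral (a i) := by
  rw [list_prod_eq_sgn_smul_insertionSort (fun i => F.incl i (a i)) p
    (fun i j => F.incl_mul_incl_comm _ _ (ha i) (ha j)) L, insertionSort_eq_sort_univ L hn hu,
    ← F.pure_eq_list_prod ha, map_smul, int_pure]
  by_cases h : ∀ i, p i = d
  · rw [sgn_even, one_smul]
    have : ∀ L' : List I, Even (pairSum (fun i j => if j < i then p i * p j else 0) L') := by
      intro L'
      induction L' with
      | nil => simp [pairSum]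
      | cons i L' ih =>
        refine Even.add ?_ ih
        refine List.sum_induction (fun k => Even k) (fun _ _ => Even.add) Even.zero fun k hk => ?_
        obtain ⟨j, _, rfl⟩ := List.mem_map.1 hk
        change Even (if j < i then p i * p j else 0)
        split_ifs
        · rw [h i]
          exact even_degree_mul _
        · exact Even.zero
    exact this L
  · push Not at h
    obtain ⟨i, hi⟩ := h
    rw [Finset.prod_eq_zero (Finset.mem_univ i) (F.integral_eq_zero _ _ (ha i) hi), smul_zero]

/-- If `I` is the disjoint union of the images of `J` and `K`, then the integral over `A^{⊗ I}` is
the product of the integrals over `A^{⊗ J}` and `A^{⊗ K}`. -/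
lemma int_pullHom_mul_pullHom (j : J → I) (k : K → I)
    (h : Function.Bijective (Sum.elim j k)) (x : F.Pow J) (y : F.Pow K) :
    F.int I (F.pullHom j x * F.pullHom k y) = F.int J x * F.int K y := by
  induction x using F.pow_induction (I := J) with
  | zero => simp
  | add x x' h h' => simp only [map_add, add_mul, h, h']
  | smul c x h => simp only [map_smul, smul_mul_assoc, h]
  | pure p a ha =>
    induction y using F.pow_induction (I := K) with
    | zero => simp
    | add x x' h h' => simp only [map_add, mul_add, h, h']
    | smul c x h => simp only [map_smul, mul_smul_comm, h]
    | pure q b hb =>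
      let e := Equiv.ofBijective _ h
      have hj : ∀ i, e.symm (j i) = Sum.inl i := fun i => e.symm_apply_eq.2 rfl
      have hk : ∀ i, e.symm (k i) = Sum.inr i := fun i => e.symm_apply_eq.2 rfl
      have hc : ∀ i, Sum.elim a b (e.symm i) ∈ F.grading (Sum.elim p q (e.symm i)) := by
        intro i
        rcases e.symm i with l | l
        · exact ha l
        · exact hb l
      have hprod : F.pullHom j (F.pure a) * F.pullHom k (F.pure b) =
          (((Finset.univ.sort : List J).map j ++ (Finset.univ.sort : List K).map k).map fun i =>
            F.incl i (Sum.elim a b (e.symm i))).prod := by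
        rw [List.map_append, List.prod_append, List.map_map, List.map_map]
        simp only [Function.comp_def, hj, hk, Sum.elim_inl, Sum.elim_inr]
        exact congrArg₂ _ (F.pullLin_pure ha j) (F.pullLin_pure hb k)
      have hji : Function.Injective j := fun x y hxy =>
        Sum.inl_injective (h.1 (a₁ := Sum.inl x) (a₂ := Sum.inl y) hxy)
      have hki : Function.Injective k := fun x y hxy =>
        Sum.inr_injective (h.1 (a₁ := Sum.inr x) (a₂ := Sum.inr y) hxy)
      rw [hprod, F.int_list_prod hc, int_pure, int_pure,
        ← Fintype.prod_sumElim (fun i => F.integral (a i)) (fun i => F.integral (b i))]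
      · refine Fintype.prod_equiv e.symm _ _ fun i => ?_
        rcases e.symm i with l | l <;> rfl
      · refine List.Nodup.append ((Finset.sort_nodup _ _).map hji)
          ((Finset.sort_nodup _ _).map hki) ?_
        intro i hi hi'
        obtain ⟨x, -, rfl⟩ := List.mem_map.1 hi
        obtain ⟨y, -, hy⟩ := List.mem_map.1 hi'
        have := h.1 (a₁ := Sum.inr y) (a₂ := Sum.inl x) hy
        simp at this
      · intro i
        obtain ⟨l | l, rfl⟩ := h.2 i <;> simp

lemma int_one_of_isEmpty [IsEmpty I] : F.int I 1 = 1 := by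
  rw [one_def, int_pure]
  simp

lemma int_pullHom_of_bijective {φ : I → J} (h : Function.Bijective φ) (x : F.Pow I) :
    F.int J (F.pullHom φ x) = F.int I x := by
  have := F.int_pullHom_mul_pullHom (K := Fin 0) φ Fin.elim0
    ⟨by rintro (a | a) (b | b) h'; exacts [congrArg _ (h.1 h'), b.elim0, a.elim0, a.elim0],
      fun j => ⟨Sum.inl (h.2 j).choose, (h.2 j).choose_spec⟩⟩ x 1
  rwa [map_one, _root_.mul_one, int_one_of_isEmpty, _root_.mul_one] at this

lemma int_mul_comm {k : ℤ} {x : F.Pow I} (hx : x ∈ F.deg I k) (y : F.Pow I) :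
    F.int I (x * y) = sgn k * F.int I (y * x) := by
  induction y using F.pow_induction (I := I) with
  | zero => simp
  | add y y' h h' => simp only [map_add, add_mul, mul_add, h, h']
  | smul c y h =>
    simp only [map_smul, mul_smul_comm, smul_mul_assoc, h, smul_eq_mul]
    ring
  | pure p a ha =>
    have hy := F.pure_mem_deg ha
    by_cases h : k + ∑ i, p i = 0
    · rw [F.mul_comm_of_mem_deg hx hy, map_smul, smul_eq_mul, eq_neg_of_add_eq_zero_right h]
      congr 1
      apply sgn_congr
      rw [show k * -k - k = -(k * (k + 1)) by ring]
      exact (Int.even_mul_succ_self k).neg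
    · rw [F.int_eq_zero (F.mul_mem_deg hx hy) (by simpa using h),
        F.int_eq_zero (F.mul_mem_deg hy hx) (by rw [add_comm (∑ i, p i)]; simpa using h), mul_zero]

lemma int_degProj_mul (k : ℤ) (x y : F.Pow I) :
    F.int I (F.degProj I k x * y) = F.int I (x * F.degProj I (-k) y) := by
  induction x using F.pow_induction (I := I) with
  | zero => simp
  | add x x' h h' => simp only [map_add, add_mul, h, h']
  | smul c x h => simp only [map_smul, smul_mul_assoc, h]
  | pure p a ha =>
    induction y using F.pow_induction (I := I) with
    | zero => simp
    | add x x' h h' => simp only [map_add, mul_add, h, h']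
    | smul c x h => simp only [map_smul, mul_smul_comm, h]
    | pure q b hb =>
      rw [F.degProj_pure ha, F.degProj_pure hb]
      by_cases h : ∑ i, p i + ∑ i, q i = 0
      · by_cases hk : k = ∑ i, p i
        · rw [if_pos hk, if_pos (by linarith)]
        · rw [if_neg hk, if_neg (fun h' => hk (by linarith)), zero_mul, mul_zero]
      · have h0 := F.int_eq_zero (F.mul_mem_deg (F.pure_mem_deg ha) (F.pure_mem_deg hb))
          (by simpa using h)
        split_ifs <;> simp [h0]

lemma eq_of_int_mul_eq {x x' : F.Pow I} (h : ∀ y, F.int I (x * y) = F.int I (x' * y)) :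
    x = x' := by
  rw [← sub_eq_zero]
  refine (F.tensorForm_nondegenerate I).1 (x - x' : F.Pow I) fun (y : F.Pow I) => ?_
  change F.int I ((x - x') * y) = 0
  rw [sub_mul, map_sub, h, sub_self]

/-! ### Multiplication along the fibres and its adjoint -/

lemma pullHom_mem_deg (φ : I → J) {k : ℤ} {x : F.Pow I} (hx : x ∈ F.deg I k) :
    F.pullHom φ x ∈ F.deg J (k + d * (Fintype.card I - Fintype.card J)) := by
  induction hx using F.deg_induction (I := I) with
  | zero => simp
  | add x y _ _ h h' => rw [map_add]; exact add_mem h h'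
  | smul c x _ h => rw [map_smul]; exact Submodule.smul_mem _ _ h
  | pure p a ha hk =>
    rw [pullHom_apply]
    rw [show (F.pull φ (F.pure a) : F.Pow J) = blockSign φ p • F.pure fun j =>
      F.listProd a (fiber φ j) from F.pull_tprod ha φ]
    refine Submodule.smul_mem _ _ ?_
    convert F.pure_mem_deg (fun j => F.listProd_mem ha (fiber φ j)) using 2
    have h1 : ∀ j, ((fiber φ j).map p).sum = ∑ i with φ i = j, p i := by
      intro j
      rw [fiber, ← List.sum_toFinset _ (Finset.sort_nodup _ _)]
      simp
    have h2 : ∀ j, ((fiber φ j).length : ℤ) = ∑ i with φ i = j, 1 := by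
      intro j
      simp [fiber]
    simp only [h1, h2]
    rw [Finset.sum_add_distrib, ← Finset.sum_mul, Finset.sum_sub_distrib,
      Finset.sum_fiberwise, Finset.sum_fiberwise, hk]
    simp [_root_.mul_comm]

lemma sgn_degree_shift (k l : ℤ) : sgn (k + d * l) = sgn k :=
  sgn_congr (by simpa using even_degree_mul l)

lemma pullHom_surjective {φ : I → J} (h : Function.Surjective φ) :
    Function.Surjective (F.pullHom φ) := by
  obtain ⟨s, hs⟩ := h.hasRightInverse
  intro y
  refine ⟨F.pullHom s y, ?_⟩
  rw [pullHom_comp, hs.comp_eq_id, pullHom_id]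

/-- The map `φ_*` as a linear map between the algebras `A^{⊗ J}` and `A^{⊗ I}`. -/
def pushLin (φ : I → J) : F.Pow J →ₗ[ℚ] F.Pow I := F.push φ

lemma int_push_mul (φ : I → J) (x : F.Pow J) (y : F.Pow I) :
    F.int I (F.pushLin φ x * y) = F.int J (x * F.pullHom φ y) :=
  F.tensorForm_push φ x y

lemma int_push (φ : I → J) (x : F.Pow J) : F.int I (F.pushLin φ x) = F.int J x := by
  have := F.int_push_mul φ x 1
  rwa [map_one, _root_.mul_one, _root_.mul_one] at this

lemma push_comp (ψ : J → K) (φ : I → J) (x : F.Pow K) :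
    F.pushLin φ (F.pushLin ψ x) = F.pushLin (ψ ∘ φ) x :=
  F.eq_of_int_mul_eq fun y => by simp only [int_push_mul, pullHom_comp]

/-- The projection formula, with the scalar on the right. -/
lemma push_mul (φ : I → J) (x : F.Pow J) (y : F.Pow I) :
    F.pushLin φ x * y = F.pushLin φ (x * F.pullHom φ y) :=
  F.eq_of_int_mul_eq fun z => by
    rw [_root_.mul_assoc, int_push_mul, int_push_mul, map_mul (F.pullHom φ), _root_.mul_assoc]

/-- The projection formula, with the scalar on the left. -/
lemma mul_push (φ : I → J) (x : F.Pow J) (y : F.Pow I) :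
    y * F.pushLin φ x = F.pushLin φ (F.pullHom φ y * x) := by
  refine F.eq_of_int_mul_eq fun z => ?_
  induction y using F.pow_induction (I := I) with
  | zero => simp
  | add y y' h h' => simp only [map_add, add_mul, h, h']
  | smul c y h => simp only [map_smul, smul_mul_assoc, h]
  | pure p a ha =>
    have hy := F.pure_mem_deg ha
    rw [_root_.mul_assoc, F.int_mul_comm hy, _root_.mul_assoc, int_push_mul, map_mul (F.pullHom φ),
      int_push_mul, _root_.mul_assoc, F.int_mul_comm (F.pullHom_mem_deg φ hy), sgn_degree_shift,
      _root_.mul_assoc]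

lemma push_pullHom_of_bijective {φ : I → J} (h : Function.Bijective φ) (x : F.Pow I) :
    F.pushLin φ (F.pullHom φ x) = x :=
  F.eq_of_int_mul_eq fun y => by
    rw [int_push_mul, ← map_mul, F.int_pullHom_of_bijective h]

lemma pullHom_push_of_bijective {φ : I → J} (h : Function.Bijective φ) (x : F.Pow J) :
    F.pullHom φ (F.pushLin φ x) = x := by
  obtain ⟨y, rfl⟩ := F.pullHom_surjective h.2 x
  rw [F.push_pullHom_of_bijective h]

lemma push_mem_deg (φ : I → J) {k : ℤ} {x : F.Pow J} (hx : x ∈ F.deg J k) :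
    F.pushLin φ x ∈ F.deg I (k + d * (Fintype.card I - Fintype.card J)) := by
  have h : ∀ j, j ≠ k + d * (Fintype.card I - Fintype.card J) →
      F.degProj I j (F.pushLin φ x) = 0 := by
    intro j hj
    refine F.eq_of_int_mul_eq fun y => ?_
    rw [int_degProj_mul, int_push_mul, zero_mul, map_zero]
    refine F.int_eq_zero (F.mul_mem_deg hx (F.pullHom_mem_deg φ (F.degProj_mem _ y))) fun h => hj ?_
    linarith
  rw [← F.sum_degProj (F.pushLin φ x)]
  refine Submodule.sum_mem _ fun j _ => ?_
  by_cases hj : j = k + d * (Fintype.card I - Fintype.card J)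
  · rw [hj]
    exact F.degProj_mem _ _
  · rw [h j hj]
    exact zero_mem _

end GradedFrobeniusAlgebra

/-! ### Pushouts of surjections -/

section Combinatorics

/-- The number of elements of the fibre of `f` over `w`. -/
def fiberCard {X W : Type*} [Fintype X] [DecidableEq W] (f : X → W) (w : W) : ℕ :=
  (Finset.univ.filter fun x => f x = w).card

lemma fiberCard_eq_sum {X W : Type*} [Fintype X] [DecidableEq W] (f : X → W) (w : W) :
    fiberCard f w = ∑ x, if f x = w then 1 else 0 := by
  rw [fiberCard, Finset.card_filter]

lemma fiberCard_comp_of_bijective {X Y W : Type*} [Fintype X] [Fintype Y] [DecidableEq W]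
    {e : X → Y} (he : Function.Bijective e) (f : Y → W) (w : W) :
    fiberCard (f ∘ e) w = fiberCard f w := by
  rw [fiberCard_eq_sum, fiberCard_eq_sum]
  exact Fintype.sum_bijective e he _ _ fun _ => rfl

lemma fiberCard_of_bijective {X W : Type*} [Fintype X] [DecidableEq W]
    {e : X → W} (he : Function.Bijective e) (w : W) : fiberCard e w = 1 := by
  obtain ⟨x, rfl⟩ := he.2 w
  rw [fiberCard, Finset.card_eq_one]
  exact ⟨x, by ext y; simp [he.1.eq_iff]⟩

lemma sum_fiberCard {X Y W : Type*} [Fintype X] [Fintype Y] [DecidableEq Y] [DecidableEq W]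
    (p : X → Y) (r : Y → W) (w : W) :
    ∑ y with r y = w, fiberCard p y = fiberCard (r ∘ p) w := by
  classical
  simp only [fiberCard]
  rw [Finset.card_eq_sum_card_fiberwise (f := p) (t := Finset.univ.filter fun y => r y = w)
    (by intro x; simp)]
  refine Finset.sum_congr rfl fun y hy => ?_
  congr 1
  ext x
  simp only [Finset.mem_filter, Finset.mem_univ, true_and, Function.comp_apply] at hy ⊢
  exact ⟨fun h => ⟨h ▸ hy, h⟩, fun h => h.2⟩

/-- The map `X → X ∖ {x₂}` that identifies `x₂` with `x₁`. -/
def merge {X : Type*} [DecidableEq X] {x₁ x₂ : X} (h : x₁ ≠ x₂) (x : X) : {x // x ≠ x₂} :=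
  if hx : x = x₂ then ⟨x₁, h⟩ else ⟨x, hx⟩

section Merge

variable {X : Type*} [DecidableEq X] {x₁ x₂ : X} (h : x₁ ≠ x₂)

@[simp] lemma merge_right : merge h x₂ = ⟨x₁, h⟩ := by simp [merge]

lemma merge_of_ne {x : X} (hx : x ≠ x₂) : merge h x = ⟨x, hx⟩ := by simp [merge, hx]

@[simp] lemma merge_left : merge h x₁ = ⟨x₁, h⟩ := merge_of_ne h h

@[simp] lemma merge_coe (x : {x // x ≠ x₂}) : merge h x = x := merge_of_ne h x.2

lemma merge_surjective : Function.Surjective (merge h) := fun x => ⟨x, merge_coe h x⟩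

lemma coe_merge_comp {Y : Type*} (f : X → Y) (hf : f x₁ = f x₂) (x : X) :
    f (merge h x) = f x := by
  by_cases hx : x = x₂
  · subst hx
    simpa using hf
  · rw [merge_of_ne h hx]

lemma fiberCard_comp_merge [Fintype X] {W : Type*} [DecidableEq W] (f : {x // x ≠ x₂} → W)
    (w : W) : fiberCard (f ∘ merge h) w = fiberCard f w + if f ⟨x₁, h⟩ = w then 1 else 0 := by
  rw [fiberCard_eq_sum, fiberCard_eq_sum, Fintype.sum_eq_add_sum_subtype_ne _ x₂, add_comm]
  simp

end Merge

/-- The square formed by `p : X → Y`, `q : X → Z`, `r : Y → W` and `s : Z → W` is a pushout of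
surjections: two elements of `X` have the same image in `W` precisely if they are identified by
the equivalence relation that `p` and `q` generate. -/
structure IsSurjPushout {X Y Z W : Type*} (p : X → Y) (q : X → Z) (r : Y → W) (s : Z → W) :
    Prop where
  surj_p : Function.Surjective p
  surj_q : Function.Surjective q
  surj_r : Function.Surjective r
  surj_s : Function.Surjective s
  comm : ∀ x, r (p x) = s (q x)
  rel : ∀ R : Setoid X, (∀ x y, p x = p y → R x y) → (∀ x y, q x = q y → R x y) →
    ∀ x y, r (p x) = r (p y) → R x y

namespace IsSurjPushout

variable {X Y Z W : Type*} {p : X → Y} {q : X → Z} {r : Y → W} {s : Z → W}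

lemma symm (h : IsSurjPushout p q r s) : IsSurjPushout q p s r :=
  ⟨h.surj_q, h.surj_p, h.surj_s, h.surj_r, fun x => (h.comm x).symm, fun R h1 h2 x y hxy =>
    h.rel R h2 h1 x y (by rw [h.comm, h.comm, hxy])⟩

lemma bijective_of_injective (h : IsSurjPushout p q r s) (hp : Function.Injective p) :
    Function.Bijective s := by
  refine ⟨fun z z' hz => ?_, h.surj_s⟩
  obtain ⟨x, rfl⟩ := h.surj_q z
  obtain ⟨y, rfl⟩ := h.surj_q z'
  exact h.rel (Setoid.ker q) (fun x y hxy => congrArg q (hp hxy)) (fun x y hxy => hxy) x y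
    (by rw [h.comm, h.comm, hz])

variable [DecidableEq X] [DecidableEq Z] {x₁ x₂ : X}

/-- Deleting one of two parallel edges of the bipartite graph with vertices `Y ⊔ Z` and edges `X`
preserves its connected components. -/
lemma restrict_of_eq (h : IsSurjPushout p q r s) (hx : x₁ ≠ x₂) (hp : p x₁ = p x₂)
    (hq : q x₁ = q x₂) :
    IsSurjPushout (fun x : {x // x ≠ x₂} => p x) (fun x : {x // x ≠ x₂} => q x) r s where
  surj_p y := by
    obtain ⟨x, rfl⟩ := h.surj_p y
    exact ⟨merge hx x, coe_merge_comp hx p hp x⟩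
  surj_q y := by
    obtain ⟨x, rfl⟩ := h.surj_q y
    exact ⟨merge hx x, coe_merge_comp hx q hq x⟩
  surj_r := h.surj_r
  surj_s := h.surj_s
  comm x := h.comm x
  rel R h1 h2 x y hxy := by
    have := h.rel (R.comap (merge hx))
      (fun x y hxy => h1 _ _ (by rwa [coe_merge_comp hx p hp, coe_merge_comp hx p hp]))
      (fun x y hxy => h2 _ _ (by rwa [coe_merge_comp hx q hq, coe_merge_comp hx q hq])) x y hxy
    simpa [Setoid.comap_rel] using this

/-- Contracting two vertices of `Z` joined to the same vertex of `Y`, and deleting one of the two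
edges, preserves the connected components. -/
lemma restrict_of_ne (h : IsSurjPushout p q r s) (hx : x₁ ≠ x₂) (hp : p x₁ = p x₂)
    (hq : q x₁ ≠ q x₂) :
    IsSurjPushout (fun x : {x // x ≠ x₂} => p x) (fun x : {x // x ≠ x₂} => merge hq (q x)) r
      (fun z : {z // z ≠ q x₂} => s z) := by
  have hs : s (q x₁) = s (q x₂) := by rw [← h.comm, ← h.comm, hp]
  have hq' : merge hq (q x₁) = merge hq (q x₂) := by simp
  exact {
    surj_p := fun y => by
      obtain ⟨x, rfl⟩ := h.surj_p y
      exact ⟨merge hx x, coe_merge_comp hx p hp x⟩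
    surj_q := fun z => by
      obtain ⟨x, hxz⟩ := h.surj_q z
      refine ⟨merge hx x, ?_⟩
      refine (coe_merge_comp hx (fun x => merge hq (q x)) hq' x).trans ?_
      rw [hxz, merge_coe]
    surj_r := h.surj_r
    surj_s := fun w => by
      obtain ⟨z, rfl⟩ := h.surj_s w
      exact ⟨merge hq z, coe_merge_comp hq s hs z⟩
    comm := fun x => by rw [h.comm, coe_merge_comp hq s hs]
    rel := fun R h1 h2 x y hxy => by
      have := h.rel (R.comap (merge hx))
        (fun x y hxy => h1 _ _ (by rwa [coe_merge_comp hx p hp, coe_merge_comp hx p hp]))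
        (fun x y hxy => h2 _ _ (by
          rw [coe_merge_comp hx (fun x => merge hq (q x)) hq',
            coe_merge_comp hx (fun x => merge hq (q x)) hq', hxy])) x y hxy
      simpa [Setoid.comap_rel] using this }

/-- For each point of the pushout, the bipartite graph whose vertices are the points of `Y` and `Z`
and whose edges are the points of `X` is connected, so its first Betti number is not negative. -/
theorem fiberCard_add_le [Fintype X] [Fintype Y] [Fintype Z] [DecidableEq W]
    (h : IsSurjPushout p q r s) (w : W) :
    fiberCard r w + fiberCard s w ≤ fiberCard (r ∘ p) w + 1 := by
  classical
  generalize hN : Fintype.card X = N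
  induction N generalizing X Z with
  | zero =>
    obtain ⟨y, rfl⟩ := h.surj_r w
    obtain ⟨x, rfl⟩ := h.surj_p y
    exact ((Fintype.card_eq_zero_iff.1 hN).false x).elim
  | succ N ih =>
    by_cases hp : Function.Injective p
    · rw [fiberCard_of_bijective (h.bijective_of_injective hp),
        fiberCard_comp_of_bijective ⟨hp, h.surj_p⟩]
    · simp only [Function.Injective, not_forall] at hp
      obtain ⟨x₁, x₂, hp, hx⟩ := hp
      have hN' : Fintype.card {x // x ≠ x₂} = N := by
        rw [Fintype.card_subtype_compl, Fintype.card_subtype_eq, hN, Nat.add_sub_cancel]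
      have h1 : fiberCard (r ∘ p) w = fiberCard (r ∘ fun x : {x // x ≠ x₂} => p x) w +
          if r (p x₁) = w then 1 else 0 := by
        refine Eq.trans ?_ (fiberCard_comp_merge hx (r ∘ fun x : {x // x ≠ x₂} => p x) w)
        congr 1
        funext x
        exact congrArg r (coe_merge_comp hx p hp x).symm
      by_cases hq : q x₁ = q x₂
      · have := ih (h.restrict_of_eq hx hp hq) hN'
        omega
      · have := ih (h.restrict_of_ne hx hp hq) hN'
        have hs : s (q x₁) = s (q x₂) := by rw [← h.comm, ← h.comm, hp]
        have h2 : fiberCard s w = fiberCard (fun z : {z // z ≠ q x₂} => s z) w +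
            if s (q x₁) = w then 1 else 0 := by
          rw [← fiberCard_comp_merge hq (fun z : {z // z ≠ q x₂} => s z) w]
          congr 1
          funext z
          exact (coe_merge_comp hq s hs z).symm
        rw [h.comm] at h1
        omega

end IsSurjPushout

end Combinatorics

namespace GradedFrobeniusAlgebra

variable {A : Type*} [AddCommGroup A] [Module ℚ A] {d : ℕ} (F : GradedFrobeniusAlgebra A d)

variable {I : Type*} [Fintype I] [LinearOrder I]
variable {J : Type*} [Fintype J] [LinearOrder J]
variable {K : Type*} [Fintype K] [LinearOrder K]
variable [Fact (Even d)]

/-! ### The Euler class -/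

lemma one_mem_deg : (1 : F.Pow I) ∈ F.deg I (-(d * Fintype.card I : ℤ)) := by
  rw [one_def]
  convert F.pure_mem_deg (fun _ : I => F.one_mem) using 2
  simp [_root_.mul_comm]

lemma incl_fin_one_eq_symm (a : A) :
    F.incl (0 : Fin 1) a = (PiTensorProduct.subsingletonEquiv (0 : Fin 1)).symm a := by
  rw [PiTensorProduct.subsingletonEquiv_symm_apply']
  change PiTensorProduct.tprod ℚ _ = _
  congr 1
  funext i
  rw [Subsingleton.elim i 0, Function.update_self]

lemma incl_fin_one_euler : F.incl (0 : Fin 1) F.euler =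
    F.pullHom (fun _ : Fin 2 => (0 : Fin 1)) (F.pushLin (fun _ : Fin 2 => (0 : Fin 1)) 1) := by
  rw [incl_fin_one_eq_symm, euler, LinearEquiv.symm_apply_apply]
  rfl

lemma subsingletonEquiv_mem {k : ℤ} {x : F.Pow (Fin 1)} (hx : x ∈ F.deg (Fin 1) k) :
    PiTensorProduct.subsingletonEquiv (0 : Fin 1) (x : TensorPow A (Fin 1)) ∈ F.grading k := by
  induction hx using F.deg_induction (I := Fin 1) with
  | zero =>
    erw [map_zero]
    exact zero_mem _
  | add x y _ _ h h' =>
    erw [map_add]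
    exact add_mem h h'
  | smul c x _ h =>
    erw [map_smul]
    exact Submodule.smul_mem _ _ h
  | pure p a ha hk =>
    erw [PiTensorProduct.subsingletonEquiv_apply_tprod]
    rw [← hk, Fin.sum_univ_one]
    exact ha 0

lemma euler_mem : F.euler ∈ F.grading d := by
  refine F.subsingletonEquiv_mem (x := F.pullHom (fun _ : Fin 2 => (0 : Fin 1))
    (F.pushLin (fun _ : Fin 2 => (0 : Fin 1)) 1)) ?_
  have := F.pullHom_mem_deg (fun _ : Fin 2 => (0 : Fin 1))
    (F.push_mem_deg (fun _ : Fin 2 => (0 : Fin 1)) (F.one_mem_deg (I := Fin 1)))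
  convert this using 2
  simp

/-- The power `e^k` of the Euler class. -/
def eulerIter (k : ℕ) : A := (F.mul F.euler)^[k] F.one

lemma eulerIter_succ (k : ℕ) : F.eulerIter (k + 1) = F.mul F.euler (F.eulerIter k) :=
  Function.iterate_succ_apply' _ _ _

lemma eulerIter_add (k l : ℕ) :
    F.eulerIter (k + l) = F.mul (F.eulerIter k) (F.eulerIter l) := by
  induction k with
  | zero => rw [zero_add]; exact (F.one_mul _).symm
  | succ k ih => rw [add_right_comm, eulerIter_succ, ih, eulerIter_succ, F.mul_assoc]

lemma eulerIter_mem (k : ℕ) : F.eulerIter k ∈ F.grading (-d + 2 * d * k) := by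
  induction k with
  | zero => simpa [eulerIter] using F.one_mem
  | succ k ih =>
    rw [eulerIter_succ]
    convert F.mul_mem _ _ _ _ F.euler_mem ih using 2
    push_cast
    ring

lemma even_eulerIter_degree (k : ℕ) : Even (-(d : ℤ) + 2 * d * k) := by
  rw [show -(d : ℤ) + 2 * d * k = d * (2 * k - 1) by ring]
  exact even_degree_mul _

/-- The element `e^ν` of the algebra `A^{⊗ I}`. -/
def ePow (ν : I → ℕ) : F.Pow I := F.eulerPow ν

lemma ePow_eq_pure (ν : I → ℕ) : F.ePow ν = F.pure fun i => F.eulerIter (ν i) := rfl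

lemma ePow_add (ν μ : I → ℕ) : F.ePow (ν + μ) = F.ePow ν * F.ePow μ := by
  rw [ePow_eq_pure, ePow_eq_pure, ePow_eq_pure,
    F.pure_mul_pure (fun i => F.eulerIter_mem _) (fun i => F.eulerIter_mem _),
    mulSign_eq_one_left _ _ fun i => even_eulerIter_degree _, one_smul]
  simp only [Pi.add_apply, eulerIter_add]

lemma ePow_zero : F.ePow (0 : I → ℕ) = 1 := rfl

lemma ePow_single (i : I) : F.ePow (Pi.single i 1) = F.incl i F.euler := by
  rw [ePow_eq_pure, incl_apply]
  congr 1
  funext j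
  by_cases h : j = i
  · subst h
    simp [eulerIter, F.mul_one]
  · simp [h, eulerIter]

lemma ePow_mem_deg (ν : I → ℕ) :
    F.ePow ν ∈ F.deg I (-(d * Fintype.card I) + 2 * d * ∑ i, (ν i : ℤ)) := by
  rw [ePow_eq_pure]
  convert F.pure_mem_deg (fun i => F.eulerIter_mem (ν i)) using 2
  rw [Finset.sum_add_distrib, Finset.mul_sum]
  simp [_root_.mul_comm]

lemma ePow_mul_comm (ν : I → ℕ) (x : F.Pow I) : F.ePow ν * x = x * F.ePow ν := by
  induction x using F.pow_induction (I := I) with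
  | zero => simp
  | add x x' h h' => rw [mul_add, add_mul, h, h']
  | smul c x h => rw [mul_smul_comm, smul_mul_assoc, h]
  | pure p a ha =>
    rw [F.mul_comm_of_mem_deg (F.ePow_mem_deg ν) (F.pure_mem_deg ha), sgn_even, one_smul]
    rw [show (-(d * Fintype.card I : ℤ) + 2 * d * ∑ i, (ν i : ℤ)) * ∑ i, p i =
      d * ((-Fintype.card I + 2 * ∑ i, (ν i : ℤ)) * ∑ i, p i) by ring]
    exact even_degree_mul _

lemma listProd_eulerIter (ν : I → ℕ) (l : List I) :
    F.listProd (fun i => F.eulerIter (ν i)) l = F.eulerIter (l.map ν).sum := by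
  induction l with
  | nil => rfl
  | cons i l ih =>
    rw [List.map_cons, List.sum_cons, eulerIter_add, ← ih]
    rfl

lemma pullHom_ePow (φ : I → J) (ν : I → ℕ) :
    F.pullHom φ (F.ePow ν) = F.ePow fun j => ∑ i with φ i = j, ν i := by
  have h : F.pullHom φ (F.ePow ν) = blockSign φ (fun i => -(d : ℤ) + 2 * d * ν i) •
      F.pure fun j => F.listProd (fun i => F.eulerIter (ν i)) (fiber φ j) :=
    F.pull_tprod (fun i => F.eulerIter_mem (ν i)) φ
  have hs : blockSign φ (fun i => -(d : ℤ) + 2 * d * ν i) = 1 := by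
    rw [blockSign, ← sgn]
    exact sgn_even (Finset.even_sum _ fun x _ => (even_eulerIter_degree _).mul_right _)
  rw [h, hs, one_smul, ePow_eq_pure]
  congr 1
  funext j
  rw [listProd_eulerIter, fiber, ← List.sum_toFinset _ (Finset.sort_nodup _ _)]
  simp

/-! ### Diagonal classes and base change -/

/-- If `I` is the disjoint union of the images of `J` and `K`, then `A^{⊗ I}` is spanned by the
products of elements of `A^{⊗ J}` and `A^{⊗ K}`. -/
lemma pow_induction_of_bijective (j : J → I) (k : K → I)
    (h : Function.Bijective (Sum.elim j k)) {motive : F.Pow I → Prop} (x : F.Pow I)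
    (zero : motive 0) (add : ∀ x y, motive x → motive y → motive (x + y))
    (smul : ∀ (c : ℚ) x, motive x → motive (c • x))
    (mul : ∀ x y, motive (F.pullHom j x * F.pullHom k y)) : motive x := by
  induction x using F.pow_induction (I := I) with
  | zero => exact zero
  | add x y hx hy => exact add x y hx hy
  | smul c x hx => exact smul c x hx
  | pure p a ha =>
    let L : List I := (Finset.univ.sort : List J).map j ++ (Finset.univ.sort : List K).map k
    have hprod : F.pullHom j (F.pure (a ∘ j)) * F.pullHom k (F.pure (a ∘ k)) =
        (L.map fun i => F.incl i (a i)).prod := by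
      rw [List.map_append, List.prod_append, List.map_map, List.map_map]
      exact congrArg₂ _ (F.pullLin_pure (fun i => ha (j i)) j)
        (F.pullLin_pure (fun i => ha (k i)) k)
    have hji : Function.Injective j := fun x y hxy =>
      Sum.inl_injective (h.1 (a₁ := Sum.inl x) (a₂ := Sum.inl y) hxy)
    have hki : Function.Injective k := fun x y hxy =>
      Sum.inr_injective (h.1 (a₁ := Sum.inr x) (a₂ := Sum.inr y) hxy)
    have hn : L.Nodup := by
      refine List.Nodup.append ((Finset.sort_nodup _ _).map hji)
          ((Finset.sort_nodup _ _).map hki) ?_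
      intro i hi hi'
      obtain ⟨x, -, rfl⟩ := List.mem_map.1 hi
      obtain ⟨y, -, hy⟩ := List.mem_map.1 hi'
      have := h.1 (a₁ := Sum.inr y) (a₂ := Sum.inl x) hy
      simp at this
    have hu : ∀ i, i ∈ L := by
      intro i
      obtain ⟨l | l, rfl⟩ := h.2 i <;> simp [L]
    have h1 := list_prod_eq_sgn_smul_insertionSort (fun i => F.incl i (a i)) p
      (fun i j => F.incl_mul_incl_comm _ _ (ha i) (ha j)) L
    rw [insertionSort_eq_sort_univ L hn hu, ← F.pure_eq_list_prod ha, ← hprod] at h1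
    have h2 :=
      congrArg (fun x => sgn (pairSum (fun i j => if j < i then p i * p j else 0) L) • x) h1
    simp only [smul_smul, sgn_mul_self, one_smul] at h2
    rw [← h2]
    exact smul _ _ (mul _ _)

/-- The class of the diagonal in `A ⊗ A`, the image of `1` under the adjoint of the
multiplication. -/
def diagonal : F.Pow (Fin 2) := F.pushLin (fun _ : Fin 2 => (0 : Fin 1)) 1

/-- The adjoint of the identification of `x₁` and `x₂` maps `1` to the class of the diagonal in the
factors with indices `x₁` and `x₂`. -/
lemma push_merge_one {x₁ x₂ : I} (h : x₁ ≠ x₂) :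
    F.pushLin (merge h) 1 = F.pullHom ![x₁, x₂] F.diagonal := by
  refine F.eq_of_int_mul_eq fun z => ?_
  let k : {x // x ≠ x₁ ∧ x ≠ x₂} → I := Subtype.val
  have hb : Function.Bijective (Sum.elim ![x₁, x₂] k) := by
    refine ⟨?_, fun x => ?_⟩
    · rw [Sum.elim_injective]
      refine ⟨?_, Subtype.val_injective, ?_⟩
      · intro i j
        fin_cases i <;> fin_cases j <;> simp [h, h.symm]
      · intro i b
        fin_cases i
        · exact b.2.1.symm
        · exact b.2.2.symm
    · by_cases h1 : x = x₁
      · exact ⟨Sum.inl 0, h1.symm⟩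
      · by_cases h2 : x = x₂
        · exact ⟨Sum.inl 1, h2.symm⟩
        · exact ⟨Sum.inr ⟨x, h1, h2⟩, rfl⟩
  have hb' : Function.Bijective (Sum.elim (fun _ : Fin 1 => (⟨x₁, h⟩ : {x // x ≠ x₂}))
      (merge h ∘ k)) := by
    have hk : ∀ b, merge h (k b) = ⟨b.1, b.2.2⟩ := fun b => merge_of_ne h b.2.2
    refine ⟨?_, fun x => ?_⟩
    · rw [Sum.elim_injective]
      refine ⟨fun _ _ _ => Subsingleton.elim _ _, fun a b hab => ?_, fun i b hib => ?_⟩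
      · simp only [Function.comp_apply, hk, Subtype.mk.injEq] at hab
        exact Subtype.ext hab
      · simp only [Function.comp_apply, hk, Subtype.mk.injEq] at hib
        exact b.2.1 hib.symm
    · by_cases h1 : x.1 = x₁
      · exact ⟨Sum.inl 0, Subtype.ext h1.symm⟩
      · exact ⟨Sum.inr ⟨x.1, h1, x.2⟩, hk _⟩
  rw [int_push_mul, _root_.one_mul]
  induction z using F.pow_induction_of_bijective ![x₁, x₂] k hb with
  | zero => simp
  | add x y hx hy => simp only [map_add, mul_add, hx, hy]
  | smul c x hx => simp only [map_smul, mul_smul_comm, hx]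
  | mul u v =>
    have hc : merge h ∘ ![x₁, x₂] =
        (fun _ : Fin 1 => (⟨x₁, h⟩ : {x // x ≠ x₂})) ∘ fun _ : Fin 2 => (0 : Fin 1) := by
      funext i
      fin_cases i <;> simp
    rw [map_mul (F.pullHom (merge h)), pullHom_comp, pullHom_comp, hc, ← pullHom_comp,
      F.int_pullHom_mul_pullHom _ _ hb', ← _root_.mul_assoc, ← map_mul (F.pullHom ![x₁, x₂]),
      F.int_pullHom_mul_pullHom _ _ hb, diagonal, int_push_mul, _root_.one_mul]

/-- Self-intersection of the diagonal: base change for the square formed by the identification of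
two points with itself has the Euler class as its excess. -/
lemma pullHom_push_merge {x₁ x₂ : I} (h : x₁ ≠ x₂) (a : F.Pow {x // x ≠ x₂}) :
    F.pullHom (merge h) (F.pushLin (merge h) a) =
      a * F.incl (⟨x₁, h⟩ : {x // x ≠ x₂}) F.euler := by
  obtain ⟨b, rfl⟩ := F.pullHom_surjective (merge_surjective h) a
  have h1 := F.push_mul (merge h) 1 b
  have hc : merge h ∘ ![x₁, x₂] =
      (fun _ : Fin 1 => (⟨x₁, h⟩ : {x // x ≠ x₂})) ∘ fun _ : Fin 2 => (0 : Fin 1) := by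
    funext i
    fin_cases i <;> simp
  rw [_root_.one_mul] at h1
  rw [← h1, map_mul (F.pullHom (merge h)), push_merge_one, pullHom_comp, hc, ← pullHom_comp,
    diagonal, ← incl_fin_one_euler, pullHom_incl, ← ePow_single, ePow_mul_comm]

/-- Base change for the identification of two points that have different images under `q`. -/
lemma pullHom_push_merge_of_ne {x₁ x₂ : I} (h : x₁ ≠ x₂) (q : I → J) (hq : q x₁ ≠ q x₂)
    (a : F.Pow {x // x ≠ x₂}) :
    F.pullHom q (F.pushLin (merge h) a) =
      F.pushLin (merge hq) (F.pullHom (fun x : {x // x ≠ x₂} => merge hq (q x)) a) := by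
  obtain ⟨b, rfl⟩ := F.pullHom_surjective (merge_surjective h) a
  have h1 := F.push_mul (merge h) 1 b
  have hc : q ∘ ![x₁, x₂] = ![q x₁, q x₂] := by
    funext i
    fin_cases i <;> simp
  have hm : (fun x : {x // x ≠ x₂} => merge hq (q x)) ∘ merge h = merge hq ∘ q := by
    funext x
    exact coe_merge_comp h (fun x => merge hq (q x)) (by simp) x
  rw [_root_.one_mul] at h1
  rw [← h1, map_mul (F.pullHom q), push_merge_one, pullHom_comp, hc, ← push_merge_one, push_mul,
    pullHom_comp, pullHom_comp, hm, _root_.one_mul]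

/-- Base change along a pushout square, with the excess given by the Betti numbers of the fibres
over the pushout. The induction removes a point of `X`, which changes the bipartite graph by the
removal of an edge parallel to another one or by the contraction of an edge. -/
theorem base_change {X Y Z W : Type*} [Fintype X] [LinearOrder X] [Fintype Y] [LinearOrder Y]
    [Fintype Z] [LinearOrder Z] [Fintype W] [LinearOrder W]
    {p : X → Y} {q : X → Z} {r : Y → W} {s : Z → W} (h : IsSurjPushout p q r s) (ν : W → ℕ)
    (hν : ∀ w, ν w + fiberCard r w + fiberCard s w = fiberCard (r ∘ p) w + 1) (a : F.Pow Y) :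
    F.pullHom q (F.pushLin p a) = F.pushLin s (F.pullHom r a * F.ePow ν) := by
  generalize hN : Fintype.card X = N
  induction N using Nat.strong_induction_on generalizing X Z ν with
  | _ N ih =>
  by_cases hp : Function.Injective p
  · have hs := h.bijective_of_injective hp
    have hpb : Function.Bijective p := ⟨hp, h.surj_p⟩
    have hν0 : ν = 0 := by
      funext w
      have := hν w
      rw [fiberCard_of_bijective hs, fiberCard_comp_of_bijective hpb] at this
      simp only [Pi.zero_apply]
      omega
    obtain ⟨b, rfl⟩ := F.pullHom_surjective h.surj_p a
    have hc : r ∘ p = s ∘ q := funext h.comm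
    rw [F.push_pullHom_of_bijective hpb, hν0, ePow_zero, _root_.mul_one, pullHom_comp, hc,
      ← pullHom_comp, F.push_pullHom_of_bijective hs]
  · simp only [Function.Injective, not_forall] at hp
    obtain ⟨x₁, x₂, hp, hx⟩ := hp
    have hN' : Fintype.card {x // x ≠ x₂} < N := by
      rw [← hN]
      exact Fintype.card_subtype_lt (x := x₂) (by simp)
    have hpm : (fun x : {x // x ≠ x₂} => p x) ∘ merge hx = p := funext (coe_merge_comp hx p hp)
    have h1 : ∀ w, fiberCard (r ∘ p) w = fiberCard (r ∘ fun x : {x // x ≠ x₂} => p x) w +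
        if r (p x₁) = w then 1 else 0 := by
      intro w
      refine Eq.trans ?_ (fiberCard_comp_merge hx (r ∘ fun x : {x // x ≠ x₂} => p x) w)
      rw [Function.comp_assoc, hpm]
    by_cases hq : q x₁ = q x₂
    · have hqm : (fun x : {x // x ≠ x₂} => q x) ∘ merge hx = q := funext (coe_merge_comp hx q hq)
      have h' := h.restrict_of_eq hx hp hq
      have hle := h'.fiberCard_add_le
      obtain ⟨ν', hν'⟩ : ∃ ν' : W → ℕ, ∀ w, ν' w + fiberCard r w + fiberCard s w =
          fiberCard (r ∘ fun x : {x // x ≠ x₂} => p x) w + 1 :=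
        ⟨fun w => fiberCard (r ∘ fun x : {x // x ≠ x₂} => p x) w + 1 -
          (fiberCard r w + fiberCard s w), fun w => by have := hle w; beta_reduce; omega⟩
      have hνν' : ν = ν' + Pi.single (s (q x₁)) 1 := by
        funext w
        have e1 := hν w
        have e2 := hν' w
        rw [h1 w, h.comm] at e1
        rw [Pi.add_apply, Pi.single_apply]
        simp only [eq_comm (a := w)]
        omega
      have hih := ih _ hN' h' ν' hν' rfl
      have hp2 : F.pushLin p a =
          F.pushLin (merge hx) (F.pushLin (fun x : {x // x ≠ x₂} => p x) a) := by
        rw [push_comp, hpm]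
      have hq2 : ∀ y, F.pullHom q y = F.pullHom (fun x : {x // x ≠ x₂} => q x)
          (F.pullHom (merge hx) y) := by
        intro y
        rw [pullHom_comp, hqm]
      rw [hp2, hq2, pullHom_push_merge, map_mul, hih, pullHom_incl, push_mul,
        pullHom_incl, hνν', ePow_add, ePow_single, _root_.mul_assoc]
    · have hs : s (q x₁) = s (q x₂) := by rw [← h.comm, ← h.comm, hp]
      have hsm : (fun z : {z // z ≠ q x₂} => s z) ∘ merge hq = s := funext (coe_merge_comp hq s hs)
      have h2 : ∀ w, fiberCard s w = fiberCard (fun z : {z // z ≠ q x₂} => s z) w +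
          if s (q x₁) = w then 1 else 0 := by
        intro w
        rw [← fiberCard_comp_merge hq (fun z : {z // z ≠ q x₂} => s z) w, hsm]
      have hih := ih _ hN' (h.restrict_of_ne hx hp hq) ν (fun w => by
        have e1 := hν w
        rw [h1 w, h2 w, h.comm] at e1
        omega) rfl
      have hp2 : F.pushLin p a =
          F.pushLin (merge hx) (F.pushLin (fun x : {x // x ≠ x₂} => p x) a) := by
        rw [push_comp, hpm]
      rw [hp2, F.pullHom_push_merge_of_ne hx q hq, hih, push_comp, hsm]

end GradedFrobeniusAlgebra

open Equiv

/-! ### Orbits of sets of permutations -/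

/-- The map `s : [n] → I` exhibits `I` as the set of orbits of the subgroup generated by `S`: it is
surjective, and its fibres are the classes of the finest equivalence relation that relates `i` to
`σ i` for all `σ ∈ S`. -/
structure IsOrbitMap {n : ℕ} {I : Type*} (S : Set (Perm (Fin n))) (s : Fin n → I) : Prop where
  surj : Function.Surjective s
  apply_perm : ∀ σ ∈ S, ∀ i, s (σ i) = s i
  rel : ∀ R : Setoid (Fin n), (∀ σ ∈ S, ∀ i, R (σ i) i) → ∀ i j, s i = s j → R i j

namespace IsOrbitMap

variable {n : ℕ} {I J T W : Type*} {S S' : Set (Perm (Fin n))} {s : Fin n → I} {t : Fin n → J}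

lemma apply_eq (hs : IsOrbitMap S s) (f : Fin n → T) (hf : ∀ σ ∈ S, ∀ i, f (σ i) = f i)
    {i j : Fin n} (hij : s i = s j) : f i = f j :=
  hs.rel (Setoid.ker f) hf i j hij

/-- The map on the set of orbits induced by an invariant map. -/
def lift (hs : IsOrbitMap S s) (f : Fin n → T) (x : I) : T := f (Function.surjInv hs.surj x)

lemma lift_apply (hs : IsOrbitMap S s) {f : Fin n → T} (hf : ∀ σ ∈ S, ∀ i, f (σ i) = f i)
    (i : Fin n) : hs.lift f (s i) = f i :=
  hs.apply_eq f hf (Function.surjInv_eq hs.surj (s i))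

lemma lift_comp (hs : IsOrbitMap S s) {f : Fin n → T} (hf : ∀ σ ∈ S, ∀ i, f (σ i) = f i) :
    hs.lift f ∘ s = f := funext (hs.lift_apply hf)

lemma lift_bijective (hs : IsOrbitMap S s) (ht : IsOrbitMap S t) :
    Function.Bijective (hs.lift t) := by
  refine ⟨fun x y hxy => ?_, fun z => ?_⟩
  · obtain ⟨i, rfl⟩ := hs.surj x
    obtain ⟨j, rfl⟩ := hs.surj y
    rw [hs.lift_apply ht.apply_perm, hs.lift_apply ht.apply_perm] at hxy
    exact ht.apply_eq s hs.apply_perm hxy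
  · obtain ⟨i, rfl⟩ := ht.surj z
    exact ⟨s i, hs.lift_apply ht.apply_perm i⟩

/-- A criterion for two sets of permutations to have the same orbits. -/
lemma congr (hs : IsOrbitMap S s)
    (h : ∀ R : Setoid (Fin n), (∀ σ ∈ S, ∀ i, R (σ i) i) ↔ ∀ σ ∈ S', ∀ i, R (σ i) i) :
    IsOrbitMap S' s :=
  ⟨hs.surj, (h (Setoid.ker s)).1 hs.apply_perm, fun R hR => hs.rel R ((h R).2 hR)⟩

lemma conj (hs : IsOrbitMap S s) (σ : Perm (Fin n)) :
    IsOrbitMap ((fun π => σ * π * σ⁻¹) '' S) (s ∘ ⇑σ⁻¹) where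
  surj := hs.surj.comp σ⁻¹.surjective
  apply_perm := by
    rintro _ ⟨π, hπ, rfl⟩ i
    simp [hs.apply_perm π hπ]
  rel R hR i j hij := by
    have := hs.rel (R.comap σ) (fun π hπ k => by
      simpa [Setoid.comap_rel] using hR _ ⟨π, hπ, rfl⟩ (σ k)) _ _ hij
    simpa [Setoid.comap_rel] using this

lemma conj_singleton {π : Perm (Fin n)} (hs : IsOrbitMap {π} s) (σ : Perm (Fin n)) :
    IsOrbitMap {σ * π * σ⁻¹} (s ∘ ⇑σ⁻¹) := by
  simpa using hs.conj σ

lemma conj_pair {π ρ : Perm (Fin n)} (hs : IsOrbitMap {π, ρ} s) (σ : Perm (Fin n)) :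
    IsOrbitMap {σ * π * σ⁻¹, σ * ρ * σ⁻¹} (s ∘ ⇑σ⁻¹) := by
  simpa [Set.image_pair] using hs.conj σ

lemma id_one : IsOrbitMap {1} (id : Fin n → Fin n) :=
  ⟨Function.surjective_id, by simp, fun R _ i j h => by rw [id, id] at h; rw [h]⟩

/-- Adjoining the transposition of two elements of different orbits merges these orbits. -/
lemma insert_swap [DecidableEq I] (hs : IsOrbitMap S s) {a b : Fin n} (h : s a ≠ s b) :
    IsOrbitMap (insert (swap a b) S) (merge h ∘ s) where
  surj := (merge_surjective h).comp hs.surj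
  apply_perm := by
    rintro σ (rfl | hσ) i
    · rcases eq_or_ne i a with rfl | hia
      · simp
      · rcases eq_or_ne i b with rfl | hib
        · simp
        · rw [swap_apply_of_ne_of_ne hia hib]
    · exact congrArg (merge h) (hs.apply_perm σ hσ i)
  rel R hR i j hij := by
    have hab : R b a := by simpa using hR (swap a b) (by simp) a
    have hs' := hs.rel R fun σ hσ => hR σ (Set.mem_insert_of_mem _ hσ)
    have hm : ∀ k, s k = s b → R k a := fun k hk => R.trans (hs' _ _ hk) hab
    simp only [Function.comp_apply] at hij
    by_cases hi : s i = s b <;> by_cases hj : s j = s b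
    · exact hs' _ _ (hi.trans hj.symm)
    · rw [hi, merge_right, merge_of_ne h hj, Subtype.mk.injEq] at hij
      exact R.trans (hm i hi) (hs' _ _ hij)
    · rw [hj, merge_right, merge_of_ne h hi, Subtype.mk.injEq] at hij
      exact R.trans (hs' _ _ hij) (R.symm (hm j hj))
    · rw [merge_of_ne h hi, merge_of_ne h hj, Subtype.mk.injEq] at hij
      exact hs' _ _ hij

lemma swap {a b : Fin n} (h : a ≠ b) : IsOrbitMap {swap a b} (merge h) := by
  have h0 : IsOrbitMap (∅ : Set (Perm (Fin n))) (id : Fin n → Fin n) :=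
    ⟨Function.surjective_id, by simp, fun R _ i j h => by rw [id, id] at h; rw [h]⟩
  have := h0.insert_swap (a := a) (b := b) h
  simpa using this

/-- Sets of orbits form a pushout if the orbits of the last set of permutations are generated by
those of the second and the third. -/
lemma isSurjPushout {X Y Z : Type*} {SX SY SZ SW : Set (Perm (Fin n))} {x : Fin n → X}
    {y : Fin n → Y} {z : Fin n → Z} {w : Fin n → W} (hx : IsOrbitMap SX x) (hy : IsOrbitMap SY y)
    (hz : IsOrbitMap SZ z) (hw : IsOrbitMap SW w) {p : X → Y} {q : X → Z} {r : Y → W} {s : Z → W}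
    (hp : p ∘ x = y) (hq : q ∘ x = z) (hr : r ∘ y = w) (hs : s ∘ z = w)
    (h : ∀ R : Setoid (Fin n), (∀ σ ∈ SY, ∀ i, R (σ i) i) → (∀ σ ∈ SZ, ∀ i, R (σ i) i) →
      ∀ σ ∈ SW, ∀ i, R (σ i) i) : IsSurjPushout p q r s where
  surj_p := Function.Surjective.of_comp (g := x) (by rw [hp]; exact hy.surj)
  surj_q := Function.Surjective.of_comp (g := x) (by rw [hq]; exact hz.surj)
  surj_r := Function.Surjective.of_comp (g := y) (by rw [hr]; exact hw.surj)
  surj_s := Function.Surjective.of_comp (g := z) (by rw [hs]; exact hw.surj)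
  comm a := by
    obtain ⟨i, rfl⟩ := hx.surj a
    have h1 := congrFun hp i
    have h2 := congrFun hq i
    have h3 := congrFun hr i
    have h4 := congrFun hs i
    simp only [Function.comp_apply] at h1 h2 h3 h4
    rw [h1, h2, h3, h4]
  rel R h1 h2 a b hab := by
    obtain ⟨i, rfl⟩ := hx.surj a
    obtain ⟨j, rfl⟩ := hx.surj b
    have hp' : ∀ i, p (x i) = y i := congrFun hp
    have hq' : ∀ i, q (x i) = z i := congrFun hq
    have hr' : ∀ i, r (y i) = w i := congrFun hr
    refine hw.rel (R.comap x) (h _ (fun σ hσ i => h1 _ _ ?_) (fun σ hσ i => h2 _ _ ?_)) i j ?_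
    · rw [hp', hp', hy.apply_perm σ hσ]
    · rw [hq', hq', hz.apply_perm σ hσ]
    · rw [← hr', ← hr', ← hp', ← hp', hab]

end IsOrbitMap

/-! ### The graph defect -/

section Transpositions

variable {n : ℕ}

/-- Multiplication with the transposition of two elements of different cycles merges these
cycles. -/
lemma rel_of_not_sameCycle {π : Perm (Fin n)} {a b : Fin n} (hab : ¬ π.SameCycle a b)
    {R : Setoid (Fin n)} (hR : ∀ i, R ((π * swap a b) i) i) : R a b := by
  by_contra ha
  -- The set of all elements of the cycle of `a` that are related to `b` is closed under `π`.
  have hclosed : ∀ k : ℕ, R ((π ^ (k + 1)) a) b := by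
    intro k
    induction k with
    | zero => simpa using hR b
    | succ k ih =>
      have h1 : (π ^ (k + 1)) a ≠ a := fun h => ha (h ▸ ih)
      have h2 : (π ^ (k + 1)) a ≠ b := fun h =>
        hab (h ▸ Perm.sameCycle_pow_right.2 (Perm.SameCycle.refl _ _))
      have h3 := hR ((π ^ (k + 1)) a)
      rw [Perm.mul_apply, swap_apply_of_ne_of_ne h1 h2, ← Perm.mul_apply, ← pow_succ'] at h3
      exact R.trans h3 ih
  have := hclosed (orderOf π - 1)
  rw [Nat.sub_add_cancel (orderOf_pos π), pow_orderOf_eq_one] at this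
  exact ha this

/-- Multiplication with the transposition of two elements of the same cycle separates them. -/
lemma not_sameCycle_mul_swap {π : Perm (Fin n)} {a b : Fin n} (hne : a ≠ b)
    (hab : π.SameCycle a b) : ¬ (π * swap a b).SameCycle b a := by
  classical
  have hex : ∃ k : ℕ, (π ^ k) a = b := hab.exists_nat_pow_eq
  let k := Nat.find hex
  have hk : (π ^ k) a = b := Nat.find_spec hex
  have hmin : ∀ j < k, (π ^ j) a ≠ b := fun j hj => Nat.find_min hex hj
  have hk0 : 0 < k := by
    rcases Nat.eq_zero_or_pos k with h | h
    · rw [h] at hk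
      exact (hne (by simpa using hk)).elim
    · exact h
  have hne' : ∀ j, 0 < j → j ≤ k → (π ^ j) a ≠ a := by
    intro j hj hjk h
    refine hmin (k - j) (by omega) ?_
    rw [← hk, ← Nat.sub_add_cancel hjk, pow_add, Perm.mul_apply, h, Nat.sub_add_cancel hjk]
  -- The segment of the cycle from `π a` to `b` is closed under `π * swap a b`.
  have hclosed : ∀ m : ℕ, ∃ j, 0 < j ∧ j ≤ k ∧ ((π * swap a b) ^ m) b = (π ^ j) a := by
    intro m
    induction m with
    | zero => exact ⟨k, hk0, le_rfl, by simp [hk]⟩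
    | succ m ih =>
      obtain ⟨j, hj, hjk, h⟩ := ih
      rw [pow_succ', Perm.mul_apply, h, Perm.mul_apply]
      rcases hjk.eq_or_lt with rfl | hlt
      · exact ⟨1, one_pos, hk0, by rw [hk]; simp⟩
      · exact ⟨j + 1, by omega, by omega, by
          rw [swap_apply_of_ne_of_ne (hne' j hj hjk) (hmin j hlt), pow_succ', Perm.mul_apply]⟩
  intro h
  obtain ⟨m, hm⟩ := h.exists_nat_pow_eq
  obtain ⟨j, hj, hjk, h⟩ := hclosed m
  exact hne' j hj hjk (h ▸ hm)

end Transpositions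

section GraphDefect

variable {n : ℕ}

lemma isOrbitMap_mk {S : Set (Perm (Fin n))} {H : Subgroup (Perm (Fin n))}
    (hH : H = Subgroup.closure S) : IsOrbitMap S (Orb.mk H) where
  surj := Orb.mk_surjective H
  apply_perm σ hσ i := Orb.mk_eq_mk.2 ⟨σ, hH ▸ Subgroup.subset_closure hσ, rfl⟩
  rel R hR i j hij := by
    obtain ⟨σ, hσ, rfl⟩ := Orb.mk_eq_mk.1 hij
    rw [hH] at hσ
    induction hσ using Subgroup.closure_induction generalizing j with
    | mem σ hσ => exact hR σ hσ j
    | one => exact R.refl _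
    | mul σ τ hσ hτ ih1 ih2 =>
      rw [← hH] at hσ hτ
      exact R.trans (ih1 _ (Orb.mk_eq_mk.2 ⟨σ, hσ, rfl⟩)) (ih2 _ (Orb.mk_eq_mk.2 ⟨τ, hτ, rfl⟩))
    | inv σ hσ ih =>
      rw [← hH] at hσ
      have := ih (σ⁻¹ j) (Orb.mk_eq_mk.2 ⟨σ, hσ, rfl⟩)
      rw [← Perm.mul_apply, mul_inv_cancel, Perm.one_apply] at this
      exact R.symm this

/-- The number of orbits of the group generated by `S` that a map `v`, invariant under this group,
sends to `w`. -/
def orbitCount {W : Type*} [DecidableEq W] (S : Set (Perm (Fin n))) (v : Fin n → W) (w : W) : ℕ :=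
  fiberCard ((isOrbitMap_mk (rfl : Subgroup.closure S = _)).lift v) w

variable {I W : Type*} [Fintype I] [DecidableEq W] {S S' : Set (Perm (Fin n))}

lemma fiberCard_eq_orbitCount {s : Fin n → I} (hs : IsOrbitMap S s) {p : I → W} {v : Fin n → W}
    (hp : p ∘ s = v) (w : W) : fiberCard p w = orbitCount S v w := by
  have hm := isOrbitMap_mk (rfl : Subgroup.closure S = _)
  have hv : ∀ σ ∈ S, ∀ i, v (σ i) = v i := fun σ hσ i => by
    rw [← hp, Function.comp_apply, hs.apply_perm σ hσ, Function.comp_apply]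
  have h : p ∘ hm.lift s = hm.lift v := by
    funext x
    obtain ⟨i, rfl⟩ := hm.surj x
    rw [Function.comp_apply, hm.lift_apply hs.apply_perm, hm.lift_apply hv, ← hp,
      Function.comp_apply]
  rw [orbitCount, ← h, fiberCard_comp_of_bijective (hm.lift_bijective hs)]

lemma orbitCount_congr {v : Fin n → W} (hv : ∀ σ ∈ S, ∀ i, v (σ i) = v i)
    (h : ∀ R : Setoid (Fin n), (∀ σ ∈ S, ∀ i, R (σ i) i) ↔ ∀ σ ∈ S', ∀ i, R (σ i) i) (w : W) :
    orbitCount S v w = orbitCount S' v w := by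
  have hm := isOrbitMap_mk (rfl : Subgroup.closure S = _)
  rw [← fiberCard_eq_orbitCount hm (hm.lift_comp hv), ← fiberCard_eq_orbitCount (hm.congr h)
    (hm.lift_comp hv)]

lemma orbitCount_self [Fintype W] {v : Fin n → W} (hv : IsOrbitMap S v) (w : W) :
    orbitCount S v w = 1 := by
  rw [← fiberCard_eq_orbitCount hv (p := id) (v := v) rfl,
    fiberCard_of_bijective Function.bijective_id]

lemma orbitCount_one (v : Fin n → W) (w : W) : orbitCount {1} v w = fiberCard v w := by
  rw [← fiberCard_eq_orbitCount IsOrbitMap.id_one (p := v) (v := v) rfl]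

lemma orbitCount_insert_swap {s : Fin n → I} (hs : IsOrbitMap S s) {a b : Fin n} (h : s a ≠ s b)
    {v : Fin n → W} (hv : ∀ σ ∈ insert (swap a b) S, ∀ i, v (σ i) = v i) (w : W) :
    orbitCount S v w = orbitCount (insert (swap a b) S) v w + if v a = w then 1 else 0 := by
  classical
  have hm := hs.insert_swap h
  rw [← fiberCard_eq_orbitCount hm (hm.lift_comp hv), ← fiberCard_eq_orbitCount hs
    (p := hm.lift v ∘ merge h) (hm.lift_comp hv), fiberCard_comp_merge]
  congr 2
  rw [← hm.lift_apply hv a, Function.comp_apply, merge_left]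

lemma orbitCount_swap {a b : Fin n} (h : a ≠ b) {v : Fin n → W} (hv : v a = v b) (w : W) :
    fiberCard v w = orbitCount {swap a b} v w + if v a = w then 1 else 0 := by
  have hm := IsOrbitMap.swap h
  have hv' : (fun x : {x // x ≠ b} => v x) ∘ merge h = v := funext (coe_merge_comp h v hv)
  rw [← fiberCard_eq_orbitCount hm hv', ← fiberCard_comp_merge h (fun x : {x // x ≠ b} => v x), hv']

lemma sum_orbitCount {Y : Type*} [Fintype Y] [DecidableEq Y] {y : Fin n → Y}
    (hy : ∀ σ ∈ S, ∀ i, y (σ i) = y i) {r : Y → W} {v : Fin n → W} (hr : r ∘ y = v) (w : W) :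
    ∑ b with r b = w, orbitCount S y b = orbitCount S v w := by
  have hm := isOrbitMap_mk (rfl : Subgroup.closure S = _)
  have h : (r ∘ hm.lift y) ∘ Orb.mk (Subgroup.closure S) = v := by
    rw [Function.comp_assoc, hm.lift_comp hy, hr]
  rw [← fiberCard_eq_orbitCount hm h, ← sum_fiberCard]
  rfl

lemma orbitCount_conj (π σ : Perm (Fin n)) (v : Fin n → W) (hv : ∀ i, v (π i) = v i) (w : W) :
    orbitCount {σ * π * σ⁻¹} (v ∘ ⇑σ⁻¹) w = orbitCount {π} v w := by
  have hm := isOrbitMap_mk (rfl : Subgroup.closure {π} = _)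
  have hp := hm.lift_comp (f := v) (by simpa using hv)
  rw [← fiberCard_eq_orbitCount hm hp, ← fiberCard_eq_orbitCount (hm.conj_singleton σ)
    (p := hm.lift v)]
  rw [← Function.comp_assoc, hp]

/-- `g` is the graph defect of `π` and `ρ`, as a function on the set `W` of orbits of `⟨π, ρ⟩`. The
defining equation is written without subtraction and division. -/
def IsDefect (π ρ : Perm (Fin n)) (v : Fin n → W) (g : W → ℕ) : Prop :=
  ∀ w, 2 * g w + orbitCount {π} v w + orbitCount {ρ} v w + orbitCount {π * ρ} v w =
    fiberCard v w + 2

lemma isDefect_swap_of_not_sameCycle [Fintype W] {π : Perm (Fin n)} {a b : Fin n}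
    (hab : ¬ π.SameCycle a b) {v : Fin n → W} (hv : IsOrbitMap {swap a b, π} v) :
    IsDefect π (swap a b) v 0 := by
  intro w
  have hne : a ≠ b := fun h => hab (h ▸ Perm.SameCycle.refl _ _)
  have hm := isOrbitMap_mk (rfl : Subgroup.closure {π} = _)
  have hs : Orb.mk (Subgroup.closure {π}) a ≠ Orb.mk (Subgroup.closure {π}) b := fun h =>
    hab (hm.rel (Perm.SameCycle.setoid π)
      (fun σ hσ i => by
        rw [Set.mem_singleton_iff.1 hσ]
        exact Perm.sameCycle_apply_left.2 (Perm.SameCycle.refl π i)) a b h)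
  have h1 := orbitCount_insert_swap hm hs hv.apply_perm w
  have h2 := orbitCount_swap hne (v := v)
    (by simpa using hv.apply_perm (swap a b) (by simp) b) w
  have hv' : IsOrbitMap {π * swap a b} v := by
    refine hv.congr fun R => ⟨fun h => ?_, fun h => ?_⟩
    · simp only [Set.mem_insert_iff, Set.mem_singleton_iff, forall_eq_or_imp, forall_eq] at h ⊢
      exact fun i => R.trans (h.2 _) (h.1 i)
    · simp only [Set.mem_insert_iff, Set.mem_singleton_iff, forall_eq_or_imp, forall_eq] at h ⊢
      have hR := rel_of_not_sameCycle hab h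
      have hτ : ∀ i, R (swap a b i) i := by
        intro i
        rcases eq_or_ne i a with rfl | hia
        · simpa using R.symm hR
        · rcases eq_or_ne i b with rfl | hib
          · simpa using hR
          · rw [swap_apply_of_ne_of_ne hia hib]
      refine ⟨hτ, fun i => ?_⟩
      have h3 := h (swap a b i)
      rw [Perm.mul_apply, swap_apply_self] at h3
      exact R.trans h3 (hτ i)
  rw [orbitCount_self hv] at h1
  rw [orbitCount_self hv', Pi.zero_apply]
  omega

/-- Multiplication with a transposition splits a cycle or joins two cycles; in both cases the graph
defect vanishes. -/
lemma isDefect_swap [Fintype W] {π : Perm (Fin n)} {a b : Fin n} (hne : a ≠ b) {v : Fin n → W}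
    (hv : IsOrbitMap {swap a b, π} v) : IsDefect π (swap a b) v 0 := by
  by_cases hab : π.SameCycle a b
  · have h := not_sameCycle_mul_swap hne hab
    have hv' : IsOrbitMap {swap a b, π * swap a b} v := by
      refine hv.congr fun R => ?_
      simp only [Set.mem_insert_iff, Set.mem_singleton_iff, forall_eq_or_imp, forall_eq]
      refine and_congr_right fun hτ => ⟨fun h i => R.trans (h _) (hτ i), fun h i => ?_⟩
      have h3 := h (swap a b i)
      rw [Perm.mul_apply, swap_apply_self] at h3
      exact R.trans h3 (hτ i)
    have h' := isDefect_swap_of_not_sameCycle (fun h' => h h'.symm) hv'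
    intro w
    have := h' w
    rw [mul_assoc, swap_mul_self, mul_one] at this
    omega
  · exact isDefect_swap_of_not_sameCycle hab hv

/-- The sum of the graph defects of the orbits of `⟨π, ρ⟩` over a point `w` of a quotient of the set
of these orbits. -/
lemma sum_defect {Y : Type*} [Fintype Y] [DecidableEq Y] {π ρ : Perm (Fin n)} {y : Fin n → Y}
    (hy : IsOrbitMap {π, ρ} y) {g : Y → ℕ} (hg : IsDefect π ρ y g) {r : Y → W} {v : Fin n → W}
    (hr : r ∘ y = v) (w : W) :
    2 * ∑ b with r b = w, g b + orbitCount {π} v w + orbitCount {ρ} v w + orbitCount {π * ρ} v w =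
      fiberCard v w + 2 * fiberCard r w := by
  have h1 : ∀ i, y (π i) = y i := hy.apply_perm π (by simp)
  have h2 : ∀ i, y (ρ i) = y i := hy.apply_perm ρ (by simp)
  rw [← sum_orbitCount (S := {π}) (by simpa using h1) hr,
    ← sum_orbitCount (S := {ρ}) (by simpa using h2) hr,
    ← sum_orbitCount (S := {π * ρ}) (by simp [h1, h2]) hr, Finset.mul_sum,
    ← Finset.sum_add_distrib, ← Finset.sum_add_distrib, ← Finset.sum_add_distrib,
    Finset.sum_congr rfl fun b _ => hg b, Finset.sum_add_distrib, ← hr, ← sum_fiberCard]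
  simp [fiberCard, mul_comm]

/-- The graph defect is a non-negative integer. The proof is by induction on the support of `ρ`: with
`ρ = τ ρ'` for a transposition `τ`, the defects of the pairs `(π, τ)` and `(πτ, ρ')` add up to that
of `(π, ρ)`, corrected by the Betti number of a pushout square of sets of orbits. -/
theorem exists_isDefect (π ρ : Perm (Fin n)) {W : Type} [Fintype W] [DecidableEq W] {v : Fin n → W}
    (hv : IsOrbitMap {π, ρ} v) : ∃ g, IsDefect π ρ v g := by
  suffices h : ∀ w, ∃ k, 2 * k + orbitCount {π} v w + orbitCount {ρ} v w +
      orbitCount {π * ρ} v w = fiberCard v w + 2 from ⟨fun w => (h w).choose,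
        fun w => (h w).choose_spec⟩
  intro w
  generalize hN : ρ.support.card = N
  induction N using Nat.strong_induction_on generalizing π ρ W with
  | _ N ih =>
  by_cases hρ : ρ = 1
  · subst hρ
    have hv' : IsOrbitMap {π} v := hv.congr fun R => by
      simp
    refine ⟨0, ?_⟩
    rw [mul_one, orbitCount_one, orbitCount_self hv']
    omega
  obtain ⟨a, ha⟩ : ∃ a, ρ a ≠ a := by
    by_contra h
    push Not at h
    exact hρ (Perm.ext h)
  -- Write `ρ = τ ρ'`, where `τ` joins the fixed point `a` of `ρ'` to another cycle.
  let τ := swap a (ρ a)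
  let ρ' := τ * ρ
  have hτρ : τ * ρ' = ρ := by simp [ρ', τ, ← mul_assoc]
  have hρ'a : ρ' a = a := by simp [ρ', τ]
  have hcard : ρ'.support.card < N := hN ▸ Perm.card_support_swap_mul ha
  have hsame : ∀ R : Setoid (Fin n), (∀ σ ∈ ({ρ} : Set (Perm (Fin n))), ∀ i, R (σ i) i) ↔
      ∀ σ ∈ ({τ, ρ'} : Set (Perm (Fin n))), ∀ i, R (σ i) i := by
    intro R
    simp only [Set.mem_insert_iff, Set.mem_singleton_iff, forall_eq_or_imp, forall_eq]
    refine ⟨fun h => ?_, fun h i => ?_⟩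
    · have hτ : ∀ i, R (τ i) i := by
        intro i
        rcases eq_or_ne i a with rfl | hia
        · simpa [τ] using h i
        · rcases eq_or_ne i (ρ a) with rfl | hib
          · simpa [τ] using R.symm (h a)
          · simp only [τ]
            rw [swap_apply_of_ne_of_ne hia hib]
      exact ⟨hτ, fun i => R.trans (hτ _) (h i)⟩
    · rw [← hτρ]
      exact R.trans (h.1 _) (h.2 i)
  have hvπ : ∀ i, v (π i) = v i := hv.apply_perm π (by simp)
  have hvρ : ∀ i, v (ρ i) = v i := hv.apply_perm ρ (by simp)
  have hvτρ' := (hsame (Setoid.ker v)).1 (by simpa using hvρ)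
  have hvτ : ∀ i, v (τ i) = v i := hvτρ' τ (by simp)
  have hvρ' : ∀ i, v (ρ' i) = v i := hvτρ' ρ' (by simp)
  have hm' := isOrbitMap_mk (rfl : Subgroup.closure {ρ'} = _)
  have hs : Orb.mk (Subgroup.closure {ρ'}) a ≠ Orb.mk (Subgroup.closure {ρ'}) (ρ a) := by
    intro h
    have := hm'.apply_eq (fun i => i = a) (by
      simp only [Set.mem_singleton_iff, forall_eq, eq_iff_iff]
      intro i
      conv_lhs => rw [← hρ'a]
      exact ρ'.injective.eq_iff) h
    exact ha (this.mp rfl)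
  have e1 : orbitCount {ρ'} v w = orbitCount {ρ} v w + if v a = w then 1 else 0 := by
    rw [orbitCount_congr (by simpa using hvρ) hsame]
    exact orbitCount_insert_swap hm' hs (by simpa using ⟨hvτ, hvρ'⟩) w
  have e2 := orbitCount_swap (Ne.symm ha) (v := v) (hvρ a).symm w
  have hx := isOrbitMap_mk (rfl : Subgroup.closure {π * τ} = _)
  have hy := isOrbitMap_mk (rfl : Subgroup.closure {τ, π} = _)
  have hz := isOrbitMap_mk (rfl : Subgroup.closure {π * τ, ρ'} = _)
  have hyx : ∀ σ ∈ ({π * τ} : Set (Perm (Fin n))), ∀ i, Orb.mk (Subgroup.closure {τ, π}) (σ i) =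
      Orb.mk (Subgroup.closure {τ, π}) i := by
    simp only [Set.mem_singleton_iff, forall_eq]
    intro i
    rw [Perm.mul_apply, hy.apply_perm π (by simp), hy.apply_perm τ (by simp)]
  have hzx : ∀ σ ∈ ({π * τ} : Set (Perm (Fin n))), ∀ i,
      Orb.mk (Subgroup.closure {π * τ, ρ'}) (σ i) = Orb.mk (Subgroup.closure {π * τ, ρ'}) i :=
    fun σ hσ => hz.apply_perm σ (by simp_all)
  have hvy : ∀ σ ∈ ({τ, π} : Set (Perm (Fin n))), ∀ i, v (σ i) = v i := by simp [hvτ, hvπ]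
  have hvz : ∀ σ ∈ ({π * τ, ρ'} : Set (Perm (Fin n))), ∀ i, v (σ i) = v i := by
    simp [hvτ, hvπ, hvρ']
  have hpo := IsOrbitMap.isSurjPushout hx hy hz hv (hx.lift_comp hyx) (hx.lift_comp hzx)
    (hy.lift_comp hvy) (hz.lift_comp hvz) (by
      intro R h1 h2
      have h3 := (hsame R).2
      simp only [Set.mem_insert_iff, Set.mem_singleton_iff, forall_eq_or_imp, forall_eq]
        at h1 h2 h3 ⊢
      exact ⟨h1.2, h3 ⟨h1.1, h2.2⟩⟩)
  have e3 := hpo.fiberCard_add_le w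
  have hxv : (hy.lift v ∘ hx.lift (Orb.mk (Subgroup.closure {τ, π}))) ∘
      Orb.mk (Subgroup.closure {π * τ}) = v := by
    rw [Function.comp_assoc, hx.lift_comp hyx, hy.lift_comp hvy]
  rw [fiberCard_eq_orbitCount hx hxv] at e3
  have e4 := sum_defect (π := π) (ρ := τ) (Set.pair_comm τ π ▸ hy)
    (isDefect_swap (Ne.symm ha) hy) (hy.lift_comp hvy) w
  have hzg : ∃ g, IsDefect (π * τ) ρ' (Orb.mk (Subgroup.closure {π * τ, ρ'})) g :=
    ⟨_, fun z => (ih _ hcard (π * τ) ρ' hz z rfl).choose_spec⟩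
  obtain ⟨g, hg⟩ := hzg
  have e5 := sum_defect hz hg (hz.lift_comp hvz) w
  rw [mul_assoc, hτρ] at e5
  simp only [Pi.zero_apply, Finset.sum_const_zero, mul_zero, zero_add] at e4
  refine ⟨∑ b with hz.lift v b = w, g b + (orbitCount {π * τ} v w + 1 -
    (fiberCard (hy.lift v) w + fiberCard (hz.lift v) w)), ?_⟩
  simp only [τ] at *
  omega

end GraphDefect

namespace GradedFrobeniusAlgebra

variable {A : Type*} [AddCommGroup A] [Module ℚ A] {d : ℕ} (F : GradedFrobeniusAlgebra A d)
variable {n : ℕ}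

/-! ### The elements `aπ` -/

/-- The inclusion of the summand of `A{S_n}` with index `π`. -/
def single (π : Perm (Fin n)) : F.Pow (Orb (Subgroup.zpowers π)) →ₗ[ℚ] SymTensor A n :=
  DirectSum.lof ℚ (Perm (Fin n)) (fun π => TensorPow A (Orb (Subgroup.zpowers π))) π

lemma isOrbitMap_mk_zpowers (π : Perm (Fin n)) :
    IsOrbitMap {π} (Orb.mk (Subgroup.zpowers π)) :=
  isOrbitMap_mk (Subgroup.zpowers_eq_closure π)

@[elab_as_elim]
lemma sym_induction {motive : SymTensor A n → Prop} (x : SymTensor A n) (zero : motive 0)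
    (add : ∀ x y, motive x → motive y → motive (x + y))
    (single : ∀ π a, motive (F.single π a)) : motive x :=
  DirectSum.induction_on x zero single add

lemma symMul_single (π ρ : Perm (Fin n)) (a : F.Pow (Orb (Subgroup.zpowers π)))
    (b : F.Pow (Orb (Subgroup.zpowers ρ))) :
    F.symMul n (F.single π a) (F.single ρ b) = F.single (π * ρ) (F.symMulAux π ρ a b) := by
  have h : ∀ (a : TensorPow A (Orb (Subgroup.zpowers π)))
      (b : TensorPow A (Orb (Subgroup.zpowers ρ))),
      F.symMul n (DirectSum.lof ℚ (Perm (Fin n))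
        (fun π => TensorPow A (Orb (Subgroup.zpowers π))) π a)
        (DirectSum.lof ℚ (Perm (Fin n)) (fun π => TensorPow A (Orb (Subgroup.zpowers π))) ρ b) =
      DirectSum.lof ℚ (Perm (Fin n)) (fun π => TensorPow A (Orb (Subgroup.zpowers π))) (π * ρ)
        (F.symMulAux π ρ a b) := by
    intro a b
    rw [symMul, DirectSum.toModule_lof, LinearMap.flip_apply, DirectSum.toModule_lof]
    rfl
  exact h a b

lemma symAct_single (σ π : Perm (Fin n)) (a : F.Pow (Orb (Subgroup.zpowers π))) :
    F.symAct n σ (F.single π a) = F.single (σ * π * σ⁻¹) (F.pull (Orb.conj σ π) a) := by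
  have h : ∀ a : TensorPow A (Orb (Subgroup.zpowers π)),
      F.symAct n σ (DirectSum.lof ℚ (Perm (Fin n))
        (fun π => TensorPow A (Orb (Subgroup.zpowers π))) π a) =
      DirectSum.lof ℚ (Perm (Fin n)) (fun π => TensorPow A (Orb (Subgroup.zpowers π)))
        (σ * π * σ⁻¹) (F.pull (Orb.conj σ π) a) := by
    intro a
    rw [symAct, DirectSum.toModule_lof]
    rfl
  exact h a

lemma symIntegral_single (π : Perm (Fin n)) (a : F.Pow (Orb (Subgroup.zpowers π))) :
    F.symIntegral n (F.single π a) = if π = 1 then F.tensorIntegral _ a else 0 := by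
  have h : ∀ a : TensorPow A (Orb (Subgroup.zpowers π)),
      F.symIntegral n (DirectSum.lof ℚ (Perm (Fin n))
        (fun π => TensorPow A (Orb (Subgroup.zpowers π))) π a) =
      if π = 1 then F.tensorIntegral _ a else 0 := by
    intro a
    rw [symIntegral, DirectSum.toModule_lof]
    split_ifs <;> rfl
  exact h a

variable [Fact (Even d)]

lemma symMulAux_eq (π ρ : Perm (Fin n)) (a : F.Pow (Orb (Subgroup.zpowers π)))
    (b : F.Pow (Orb (Subgroup.zpowers ρ))) :
    (F.symMulAux π ρ a b : F.Pow (Orb (Subgroup.zpowers (π * ρ)))) =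
      F.pushLin (Orb.map (zpowers_mul_le π ρ)) (F.pullHom (Orb.map (zpowers_left_le π ρ)) a *
        F.pullHom (Orb.map (zpowers_right_le π ρ)) b * F.ePow fun B => ⌊graphDefect π ρ B⌋₊) := rfl

lemma graphDefect_eq {π ρ : Perm (Fin n)} {g : Orb (Subgroup.closure {π, ρ}) → ℕ}
    (hg : IsDefect π ρ (Orb.mk (Subgroup.closure {π, ρ})) g) (B : Orb (Subgroup.closure {π, ρ})) :
    ⌊graphDefect π ρ B⌋₊ = g B := by
  have h1 : B.size = fiberCard (Orb.mk (Subgroup.closure {π, ρ})) B := by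
    simp only [Orb.size, fiberCard]
  have h2 : ∀ {τ : Perm (Fin n)} (h : Subgroup.zpowers τ ≤ Subgroup.closure {π, ρ}),
      Orb.count h B = orbitCount {τ} (Orb.mk (Subgroup.closure {π, ρ})) B := by
    intro τ h
    rw [← fiberCard_eq_orbitCount (isOrbitMap_mk_zpowers τ) (p := Orb.map h)
      (v := Orb.mk (Subgroup.closure {π, ρ})) rfl]
    simp only [Orb.count, fiberCard]
  have h3 := hg B
  have h4 : graphDefect π ρ B = g B := by
    rw [graphDefect, h1, h2, h2, h2, div_eq_iff two_ne_zero]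
    have : (2 * g B + orbitCount {π} (Orb.mk (Subgroup.closure {π, ρ})) B +
      orbitCount {ρ} (Orb.mk (Subgroup.closure {π, ρ})) B +
      orbitCount {π * ρ} (Orb.mk (Subgroup.closure {π, ρ})) B : ℚ) =
      fiberCard (Orb.mk (Subgroup.closure {π, ρ})) B + 2 := by exact_mod_cast h3
    linarith
  rw [h4, Nat.floor_natCast]

section El

variable {I J K W : Type*} [Fintype I] [LinearOrder I] [Fintype J] [LinearOrder J]
  [Fintype K] [LinearOrder K] [Fintype W] [LinearOrder W]

/-- The element `aπ` of `A{S_n}`, where `a ∈ A^{⊗ I}` for a set `I` that is identified with the set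
of orbits of `π` by a map `s : [n] → I`. -/
def el {π : Perm (Fin n)} {s : Fin n → I} (hs : IsOrbitMap {π} s) :
    F.Pow I →ₗ[ℚ] SymTensor A n :=
  F.single π ∘ₗ (F.pullHom (hs.lift (Orb.mk (Subgroup.zpowers π)))).toLinearMap

lemma el_apply {π : Perm (Fin n)} {s : Fin n → I} (hs : IsOrbitMap {π} s) (a : F.Pow I) :
    F.el hs a = F.single π (F.pullHom (hs.lift (Orb.mk (Subgroup.zpowers π))) a) := rfl

lemma el_mk (π : Perm (Fin n)) (a : F.Pow (Orb (Subgroup.zpowers π))) :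
    F.el (isOrbitMap_mk_zpowers π) a = F.single π a := by
  have h := isOrbitMap_mk_zpowers π
  have : h.lift (Orb.mk (Subgroup.zpowers π)) = id := by
    funext x
    obtain ⟨i, rfl⟩ := h.surj x
    exact h.lift_apply h.apply_perm i
  rw [el_apply, this, pullHom_id]

/-- The element `aπ` does not depend on the choice of a set identified with the orbits of `π`. -/
lemma el_congr {π π' : Perm (Fin n)} (h : π = π') {s : Fin n → I} {t : Fin n → J}
    (hs : IsOrbitMap {π} s) (ht : IsOrbitMap {π'} t) {φ : I → J} (hφ : φ ∘ s = t) (a : F.Pow I) :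
    F.el hs a = F.el ht (F.pullHom φ a) := by
  subst h
  rw [el_apply, el_apply, pullHom_comp]
  congr 3
  funext x
  obtain ⟨i, rfl⟩ := hs.surj x
  have hm := isOrbitMap_mk_zpowers π
  have : φ (s i) = t i := congrFun hφ i
  rw [hs.lift_apply hm.apply_perm, Function.comp_apply, this, ht.lift_apply hm.apply_perm]

lemma el_congr_id {π π' : Perm (Fin n)} (h : π = π') {s : Fin n → I}
    (hs : IsOrbitMap {π} s) (ht : IsOrbitMap {π'} s) (a : F.Pow I) :
    F.el hs a = F.el ht a := by
  rw [F.el_congr h hs ht (φ := id) rfl, pullHom_id]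

lemma el_act {π : Perm (Fin n)} {s : Fin n → I} (hs : IsOrbitMap {π} s) (σ : Perm (Fin n))
    (a : F.Pow I) : F.symAct n σ (F.el hs a) = F.el (hs.conj_singleton σ) a := by
  rw [el_apply, symAct_single]
  change F.single _ (F.pullHom (Orb.conj σ π) _) = _
  rw [pullHom_comp, el_apply]
  congr 3
  funext x
  obtain ⟨i, rfl⟩ := hs.surj x
  have hm := isOrbitMap_mk_zpowers π
  have hm' := isOrbitMap_mk_zpowers (σ * π * σ⁻¹)
  have := (hs.conj_singleton σ).lift_apply hm'.apply_perm (σ i)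
  rw [Function.comp_apply, ← Perm.mul_apply, inv_mul_cancel, Perm.one_apply] at this
  rw [this, Function.comp_apply, hs.lift_apply hm.apply_perm]
  rfl

/-- The product of `A{S_n}`, computed with arbitrary sets identified with the sets of orbits. -/
lemma el_mul {π ρ : Perm (Fin n)} {s : Fin n → I} {t : Fin n → J} {u : Fin n → K} {v : Fin n → W}
    (hs : IsOrbitMap {π} s) (ht : IsOrbitMap {ρ} t) (hu : IsOrbitMap {π * ρ} u)
    (hv : IsOrbitMap {π, ρ} v) {p : I → W} {q : J → W} {f : K → W} (hp : p ∘ s = v)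
    (hq : q ∘ t = v) (hf : f ∘ u = v) {g : W → ℕ} (hg : IsDefect π ρ v g)
    (a : F.Pow I) (b : F.Pow J) :
    F.symMul n (F.el hs a) (F.el ht b) =
      F.el hu (F.pushLin f (F.pullHom p a * F.pullHom q b * F.ePow g)) := by
  have hm := isOrbitMap_mk (rfl : Subgroup.closure {π, ρ} = _)
  have hmπ := isOrbitMap_mk_zpowers π
  have hmρ := isOrbitMap_mk_zpowers ρ
  have hmπρ := isOrbitMap_mk_zpowers (π * ρ)
  let e := hv.lift (Orb.mk (Subgroup.closure {π, ρ}))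
  have he : Function.Bijective e := hv.lift_bijective hm
  have hev : ∀ i, e (v i) = Orb.mk (Subgroup.closure {π, ρ}) i := hv.lift_apply hm.apply_perm
  have h1 : Orb.map (zpowers_left_le π ρ) ∘ hs.lift (Orb.mk (Subgroup.zpowers π)) = e ∘ p := by
    funext x
    obtain ⟨i, rfl⟩ := hs.surj x
    have : p (s i) = v i := congrFun hp i
    rw [Function.comp_apply, hs.lift_apply hmπ.apply_perm, Function.comp_apply, this, hev]
    rfl
  have h2 : Orb.map (zpowers_right_le π ρ) ∘ ht.lift (Orb.mk (Subgroup.zpowers ρ)) = e ∘ q := by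
    funext x
    obtain ⟨i, rfl⟩ := ht.surj x
    have : q (t i) = v i := congrFun hq i
    rw [Function.comp_apply, ht.lift_apply hmρ.apply_perm, Function.comp_apply, this, hev]
    rfl
  have h3 : Orb.map (zpowers_mul_le π ρ) ∘ hu.lift (Orb.mk (Subgroup.zpowers (π * ρ))) =
      e ∘ f := by
    funext x
    obtain ⟨i, rfl⟩ := hu.surj x
    have : f (u i) = v i := congrFun hf i
    rw [Function.comp_apply, hu.lift_apply hmπρ.apply_perm, Function.comp_apply, this, hev]
    rfl
  have hge : ∀ B, ⌊graphDefect π ρ B⌋₊ = ∑ w with e w = B, g w := by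
    refine graphDefect_eq (g := fun B => ∑ w with e w = B, g w) fun B => ?_
    obtain ⟨w, rfl⟩ := he.2 B
    have hsum : ∑ w' with e w' = e w, g w' = g w := by
      rw [Finset.sum_filter, Finset.sum_eq_single w] <;> simp +contextual [he.1.eq_iff]
    have hve : Orb.mk (Subgroup.closure {π, ρ}) = e ∘ v := (funext hev).symm
    have hc : ∀ τ, (∀ i, v (τ i) = v i) → orbitCount {τ} (e ∘ v) (e w) = orbitCount {τ} v w := by
      intro τ hτ
      have hmτ := isOrbitMap_mk_zpowers τ
      have hl := hmτ.lift_comp (f := v) (by simpa using hτ)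
      rw [← fiberCard_eq_orbitCount hmτ hl, ← fiberCard_eq_orbitCount hmτ
        (p := e ∘ hmτ.lift v) (by rw [Function.comp_assoc, hl])]
      simp [fiberCard, he.1.eq_iff]
    have hvπ := hv.apply_perm π (by simp)
    have hvρ := hv.apply_perm ρ (by simp)
    beta_reduce
    rw [hsum, hve, hc π hvπ, hc ρ hvρ, hc (π * ρ) (by simp [hvπ, hvρ]), hg w]
    simp [fiberCard, he.1.eq_iff]
  rw [el_apply, el_apply, symMul_single, symMulAux_eq, pullHom_comp, pullHom_comp, h1, h2,
    el_apply, ← F.push_pullHom_of_bijective he (_ * _ * F.ePow g), push_comp, ← h3, ← push_comp,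
    F.pullHom_push_of_bijective (hu.lift_bijective hmπρ), map_mul (F.pullHom e),
    map_mul (F.pullHom e), pullHom_comp, pullHom_comp, pullHom_ePow, funext hge]

end El

end GradedFrobeniusAlgebra

namespace GradedFrobeniusAlgebra

variable {A : Type*} [AddCommGroup A] [Module ℚ A] {d : ℕ} (F : GradedFrobeniusAlgebra A d)
variable {n : ℕ}
variable {I J K W : Type*} [Fintype I] [LinearOrder I] [Fintype J] [LinearOrder J]
  [Fintype K] [LinearOrder K] [Fintype W] [LinearOrder W]

/-! ### Associativity of the product of `A{S_n}` -/

lemma lift_comp_lift {S T : Set (Perm (Fin n))} {I J W : Type*} {s : Fin n → I} {y : Fin n → J}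
    {w : Fin n → W} (hs : IsOrbitMap S s) (hy : IsOrbitMap T y) (hw : ∀ σ ∈ T, ∀ i, w (σ i) = w i)
    (h : ∀ σ ∈ S, ∀ i, y (σ i) = y i) : hy.lift w ∘ hs.lift y = hs.lift w := by
  funext x
  obtain ⟨i, rfl⟩ := hs.surj x
  rw [Function.comp_apply, hs.lift_apply h, hy.lift_apply hw, hs.lift_apply]
  intro σ hσ j
  rw [← hy.lift_apply hw, h σ hσ, hy.lift_apply hw]

variable [Fact (Even d)]

/-- The product `(aπ · bρ) · cσ`, computed on the orbits of `⟨π, ρ, σ⟩`. The condition on the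
exponent of the Euler class is symmetric enough to hold for the other bracketing as well. -/
lemma exists_symMul_symMul_left {π ρ σ : Perm (Fin n)} {s : Fin n → I} {t : Fin n → J}
    {u : Fin n → K} (hs : IsOrbitMap {π} s) (ht : IsOrbitMap {ρ} t) (hu : IsOrbitMap {σ} u)
    {M : Type*} [Fintype M] [LinearOrder M] {m : Fin n → M} (hm : IsOrbitMap {π * ρ * σ} m)
    {w : Fin n → W} (hw : IsOrbitMap {π, ρ, σ} w) :
    ∃ G : W → ℕ, (∀ b, 2 * G b + orbitCount {π} w b + orbitCount {ρ} w b + orbitCount {σ} w b +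
      orbitCount {π * ρ * σ} w b = 2 * fiberCard w b + 2) ∧
    ∀ a b c, F.symMul n (F.symMul n (F.el hs a) (F.el ht b)) (F.el hu c) =
      F.el hm (F.pushLin (hm.lift w) (F.pullHom (hs.lift w) a * F.pullHom (ht.lift w) b *
        F.pullHom (hu.lift w) c * F.ePow G)) := by
  have hx := isOrbitMap_mk_zpowers (π * ρ)
  have hy := isOrbitMap_mk (rfl : Subgroup.closure {π, ρ} = _)
  have hz := isOrbitMap_mk (rfl : Subgroup.closure {π * ρ, σ} = _)
  set x := Orb.mk (Subgroup.zpowers (π * ρ))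
  set y := Orb.mk (Subgroup.closure {π, ρ})
  set z := Orb.mk (Subgroup.closure {π * ρ, σ})
  obtain ⟨g₁, hg₁⟩ := exists_isDefect π ρ hy
  obtain ⟨g₂, hg₂⟩ := exists_isDefect (π * ρ) σ hz
  have wπ := hw.apply_perm π (by simp)
  have wρ := hw.apply_perm ρ (by simp)
  have wσ := hw.apply_perm σ (by simp)
  have yπ := hy.apply_perm π (by simp)
  have yρ := hy.apply_perm ρ (by simp)
  have zπρ := hz.apply_perm (π * ρ) (by simp)
  have zσ := hz.apply_perm σ (by simp)
  have hyw : ∀ τ ∈ ({π, ρ} : Set _), ∀ i, w (τ i) = w i := by simp [wπ, wρ]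
  have hzw : ∀ τ ∈ ({π * ρ, σ} : Set _), ∀ i, w (τ i) = w i := by simp [wπ, wρ, wσ]
  have hxy : ∀ τ ∈ ({π * ρ} : Set _), ∀ i, y (τ i) = y i := by simp [yπ, yρ]
  have hxz : ∀ τ ∈ ({π * ρ} : Set _), ∀ i, z (τ i) = z i := by simpa using zπρ
  have hsy : ∀ τ ∈ ({π} : Set _), ∀ i, y (τ i) = y i := by simpa using yπ
  have hty : ∀ τ ∈ ({ρ} : Set _), ∀ i, y (τ i) = y i := by simpa using yρ
  have huz : ∀ τ ∈ ({σ} : Set _), ∀ i, z (τ i) = z i := by simpa using zσ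
  have hmz : ∀ τ ∈ ({π * ρ * σ} : Set _), ∀ i, z (τ i) = z i := by
    intro τ hτ i
    rw [Set.mem_singleton_iff.1 hτ, Perm.mul_apply, zπρ, zσ]
  have hpush : IsSurjPushout (hx.lift y) (hx.lift z) (hy.lift w) (hz.lift w) := by
    refine hx.isSurjPushout hy hz hw (hx.lift_comp hxy) (hx.lift_comp hxz) (hy.lift_comp hyw)
      (hz.lift_comp hzw) fun R h1 h2 τ hτ => ?_
    rcases hτ with rfl | rfl | rfl
    exacts [h1 _ (by simp), h1 _ (by simp), h2 _ (by simp)]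
  -- The excess of the pushout square formed by the orbits of `πρ`, `⟨π, ρ⟩` and `⟨πρ, σ⟩`.
  choose ν hν using fun b => Nat.exists_eq_add_of_le (hpush.fiberCard_add_le b)
  refine ⟨(fun b => ∑ c with hy.lift w c = b, g₁ c) + ν + fun b => ∑ c with hz.lift w c = b, g₂ c,
    fun b => ?_, fun a b c => ?_⟩
  · have h1 := sum_defect hy hg₁ (hy.lift_comp hyw) b
    have h2 := sum_defect hz hg₂ (hz.lift_comp hzw) b
    have h3 := hν b
    rw [lift_comp_lift hx hy hyw hxy, fiberCard_eq_orbitCount hx (hx.lift_comp (f := w)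
      (by simp [wπ, wρ]))] at h3
    simp only [Pi.add_apply]
    omega
  · rw [F.el_mul hs ht hx hy (hs.lift_comp hsy) (ht.lift_comp hty) (hx.lift_comp hxy) hg₁,
      F.el_mul hx hu hm hz (hx.lift_comp hxz) (hu.lift_comp huz) (hm.lift_comp hmz) hg₂,
      F.base_change hpush ν (fun b => by rw [hν b]; ring), push_mul, push_mul, push_comp,
      lift_comp_lift hm hz hzw hmz, map_mul (F.pullHom (hy.lift w)),
      map_mul (F.pullHom (hy.lift w)), pullHom_comp, pullHom_comp, pullHom_comp,
      lift_comp_lift hs hy hyw hsy, lift_comp_lift ht hy hyw hty, lift_comp_lift hu hz hzw huz,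
      pullHom_ePow, pullHom_ePow, ePow_add, ePow_add]
    congr 2
    have hc : ∀ ν z, F.pullHom (hu.lift w) c * (F.ePow ν * z) =
        F.ePow ν * (F.pullHom (hu.lift w) c * z) := fun ν z => by
      rw [← _root_.mul_assoc, ← ePow_mul_comm, _root_.mul_assoc]
    simp only [_root_.mul_assoc, hc]

/-- The product `aπ · (bρ · cσ)`, computed on the orbits of `⟨π, ρ, σ⟩`. -/
lemma exists_symMul_symMul_right {π ρ σ : Perm (Fin n)} {s : Fin n → I} {t : Fin n → J}
    {u : Fin n → K} (hs : IsOrbitMap {π} s) (ht : IsOrbitMap {ρ} t) (hu : IsOrbitMap {σ} u)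
    {M : Type*} [Fintype M] [LinearOrder M] {m : Fin n → M} (hm : IsOrbitMap {π * (ρ * σ)} m)
    {w : Fin n → W} (hw : IsOrbitMap {π, ρ, σ} w) :
    ∃ G : W → ℕ, (∀ b, 2 * G b + orbitCount {π} w b + orbitCount {ρ} w b + orbitCount {σ} w b +
      orbitCount {π * (ρ * σ)} w b = 2 * fiberCard w b + 2) ∧
    ∀ a b c, F.symMul n (F.el hs a) (F.symMul n (F.el ht b) (F.el hu c)) =
      F.el hm (F.pushLin (hm.lift w) (F.pullHom (hs.lift w) a * F.pullHom (ht.lift w) b *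
        F.pullHom (hu.lift w) c * F.ePow G)) := by
  have hx := isOrbitMap_mk_zpowers (ρ * σ)
  have hy := isOrbitMap_mk (rfl : Subgroup.closure {ρ, σ} = _)
  have hz := isOrbitMap_mk (rfl : Subgroup.closure {π, ρ * σ} = _)
  set x := Orb.mk (Subgroup.zpowers (ρ * σ))
  set y := Orb.mk (Subgroup.closure {ρ, σ})
  set z := Orb.mk (Subgroup.closure {π, ρ * σ})
  obtain ⟨g₁, hg₁⟩ := exists_isDefect ρ σ hy
  obtain ⟨g₂, hg₂⟩ := exists_isDefect π (ρ * σ) hz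
  have wπ := hw.apply_perm π (by simp)
  have wρ := hw.apply_perm ρ (by simp)
  have wσ := hw.apply_perm σ (by simp)
  have yρ := hy.apply_perm ρ (by simp)
  have yσ := hy.apply_perm σ (by simp)
  have zπ := hz.apply_perm π (by simp)
  have zρσ := hz.apply_perm (ρ * σ) (by simp)
  have hyw : ∀ τ ∈ ({ρ, σ} : Set _), ∀ i, w (τ i) = w i := by simp [wρ, wσ]
  have hzw : ∀ τ ∈ ({π, ρ * σ} : Set _), ∀ i, w (τ i) = w i := by simp [wπ, wρ, wσ]
  have hxy : ∀ τ ∈ ({ρ * σ} : Set _), ∀ i, y (τ i) = y i := by simp [yρ, yσ]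
  have hxz : ∀ τ ∈ ({ρ * σ} : Set _), ∀ i, z (τ i) = z i := by simpa using zρσ
  have hsz : ∀ τ ∈ ({π} : Set _), ∀ i, z (τ i) = z i := by simpa using zπ
  have hty : ∀ τ ∈ ({ρ} : Set _), ∀ i, y (τ i) = y i := by simpa using yρ
  have huy : ∀ τ ∈ ({σ} : Set _), ∀ i, y (τ i) = y i := by simpa using yσ
  have hmz : ∀ τ ∈ ({π * (ρ * σ)} : Set _), ∀ i, z (τ i) = z i := by
    intro τ hτ i
    rw [Set.mem_singleton_iff.1 hτ, Perm.mul_apply, zπ, zρσ]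
  have hpush : IsSurjPushout (hx.lift y) (hx.lift z) (hy.lift w) (hz.lift w) := by
    refine hx.isSurjPushout hy hz hw (hx.lift_comp hxy) (hx.lift_comp hxz) (hy.lift_comp hyw)
      (hz.lift_comp hzw) fun R h1 h2 τ hτ => ?_
    rcases hτ with rfl | rfl | rfl
    exacts [h2 _ (by simp), h1 _ (by simp), h1 _ (by simp)]
  -- The excess of the pushout square formed by the orbits of `ρσ`, `⟨ρ, σ⟩` and `⟨π, ρσ⟩`.
  choose ν hν using fun b => Nat.exists_eq_add_of_le (hpush.fiberCard_add_le b)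
  refine ⟨(fun b => ∑ c with hy.lift w c = b, g₁ c) + ν + fun b => ∑ c with hz.lift w c = b, g₂ c,
    fun b => ?_, fun a b c => ?_⟩
  · have h1 := sum_defect hy hg₁ (hy.lift_comp hyw) b
    have h2 := sum_defect hz hg₂ (hz.lift_comp hzw) b
    have h3 := hν b
    rw [lift_comp_lift hx hy hyw hxy, fiberCard_eq_orbitCount hx (hx.lift_comp (f := w)
      (by simp [wρ, wσ]))] at h3
    simp only [Pi.add_apply]
    omega
  · rw [F.el_mul ht hu hx hy (ht.lift_comp hty) (hu.lift_comp huy) (hx.lift_comp hxy) hg₁,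
      F.el_mul hs hx hm hz (hs.lift_comp hsz) (hx.lift_comp hxz) (hm.lift_comp hmz) hg₂,
      F.base_change hpush ν (fun b => by rw [hν b]; ring), mul_push, push_mul, push_comp,
      lift_comp_lift hm hz hzw hmz, map_mul (F.pullHom (hy.lift w)),
      map_mul (F.pullHom (hy.lift w)), pullHom_comp, pullHom_comp, pullHom_comp,
      lift_comp_lift hs hz hzw hsz, lift_comp_lift ht hy hyw hty, lift_comp_lift hu hy hyw huy,
      pullHom_ePow, pullHom_ePow, ePow_add, ePow_add]
    congr 2
    simp only [_root_.mul_assoc]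

theorem symMul_assoc (x y z : SymTensor A n) :
    F.symMul n (F.symMul n x y) z = F.symMul n x (F.symMul n y z) := by
  induction x using F.sym_induction with
  | zero => simp
  | add x x' h h' => simp only [map_add, LinearMap.add_apply, h, h']
  | single π a =>
    induction y using F.sym_induction with
    | zero => simp
    | add x x' h h' => simp only [map_add, LinearMap.add_apply, h, h']
    | single ρ b =>
      induction z using F.sym_induction with
      | zero => simp
      | add x x' h h' => simp only [map_add, h, h']
      | single σ c =>
        rw [← F.el_mk, ← F.el_mk, ← F.el_mk]
        have hs := isOrbitMap_mk_zpowers π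
        have ht := isOrbitMap_mk_zpowers ρ
        have hu := isOrbitMap_mk_zpowers σ
        have hm := isOrbitMap_mk_zpowers (π * ρ * σ)
        have hm' : IsOrbitMap {π * (ρ * σ)} (Orb.mk (Subgroup.zpowers (π * ρ * σ))) := by
          rwa [← _root_.mul_assoc]
        have hw := isOrbitMap_mk (rfl : Subgroup.closure {π, ρ, σ} = _)
        obtain ⟨G, hG, h⟩ := F.exists_symMul_symMul_left hs ht hu hm hw
        obtain ⟨G', hG', h'⟩ := F.exists_symMul_symMul_right hs ht hu hm' hw
        have : G = G' := by
          funext b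
          have h1 := hG b
          have h2 := hG' b
          rw [← _root_.mul_assoc] at h2
          omega
        subst this
        rw [h, h']
        exact F.el_congr_id (_root_.mul_assoc _ _ _) _ _ _

end GradedFrobeniusAlgebra

namespace GradedFrobeniusAlgebra

variable {A : Type*} [AddCommGroup A] [Module ℚ A] {d : ℕ} (F : GradedFrobeniusAlgebra A d)
variable {n : ℕ}
variable {I J K W : Type*} [Fintype I] [LinearOrder I] [Fintype J] [LinearOrder J]
  [Fintype K] [LinearOrder K] [Fintype W] [LinearOrder W]

variable [Fact (Even d)]

/-! ### The action of `S_n` -/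

lemma symAct_symMul (σ : Perm (Fin n)) (x y : SymTensor A n) :
    F.symAct n σ (F.symMul n x y) = F.symMul n (F.symAct n σ x) (F.symAct n σ y) := by
  induction x using F.sym_induction with
  | zero => simp
  | add x x' h h' => simp only [map_add, LinearMap.add_apply, h, h']
  | single π a =>
    induction y using F.sym_induction with
    | zero => simp
    | add x x' h h' => simp only [map_add, h, h']
    | single ρ b =>
      rw [← F.el_mk, ← F.el_mk]
      have hs := isOrbitMap_mk_zpowers π
      have ht := isOrbitMap_mk_zpowers ρ
      have hu := isOrbitMap_mk_zpowers (π * ρ)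
      have hv := isOrbitMap_mk (rfl : Subgroup.closure {π, ρ} = _)
      have vπ := hv.apply_perm π (by simp)
      have vρ := hv.apply_perm ρ (by simp)
      have hp := hs.lift_comp (f := Orb.mk (Subgroup.closure {π, ρ})) (by simpa using vπ)
      have hq := ht.lift_comp (f := Orb.mk (Subgroup.closure {π, ρ})) (by simpa using vρ)
      have hf := hu.lift_comp (f := Orb.mk (Subgroup.closure {π, ρ})) (by simp [vπ, vρ])
      obtain ⟨g, hg⟩ := exists_isDefect π ρ hv
      have hmul : σ * (π * ρ) * σ⁻¹ = σ * π * σ⁻¹ * (σ * ρ * σ⁻¹) := by group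
      have hu' := hu.conj_singleton σ
      rw [hmul] at hu'
      have hg' : IsDefect (σ * π * σ⁻¹) (σ * ρ * σ⁻¹)
          (Orb.mk (Subgroup.closure {π, ρ}) ∘ ⇑σ⁻¹) g := by
        intro w
        rw [← hmul, orbitCount_conj _ _ _ vπ, orbitCount_conj _ _ _ vρ,
          orbitCount_conj _ _ _ (by simp [vπ, vρ]), fiberCard_comp_of_bijective σ⁻¹.bijective]
        exact hg w
      rw [F.el_mul hs ht hu hv hp hq hf hg, el_act, el_act, el_act,
        F.el_mul (hs.conj_singleton σ) (ht.conj_singleton σ) hu' (hv.conj_pair σ)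
          (by rw [← Function.comp_assoc, hp]) (by rw [← Function.comp_assoc, hq])
          (by rw [← Function.comp_assoc, hf]) hg']
      exact F.el_congr_id hmul _ _ _

lemma symAct_symAct (σ τ : Perm (Fin n)) (x : SymTensor A n) :
    F.symAct n σ (F.symAct n τ x) = F.symAct n (σ * τ) x := by
  induction x using F.sym_induction with
  | zero => simp
  | add x x' h h' => simp only [map_add, h, h']
  | single π a =>
    rw [← F.el_mk, el_act, el_act, el_act,
      F.el_congr (by group) _ ((isOrbitMap_mk_zpowers π).conj_singleton (σ * τ)) (φ := id)
        (by rw [mul_inv_rev]; rfl), pullHom_id]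

lemma symIntegral_el {π : Perm (Fin n)} {s : Fin n → I} (hs : IsOrbitMap {π} s) (a : F.Pow I) :
    F.symIntegral n (F.el hs a) = if π = 1 then F.int I a else 0 := by
  rw [el_apply, symIntegral_single]
  exact if_congr Iff.rfl
    (F.int_pullHom_of_bijective (hs.lift_bijective (isOrbitMap_mk_zpowers π)) a) rfl

lemma symIntegral_symAct (σ : Perm (Fin n)) (x : SymTensor A n) :
    F.symIntegral n (F.symAct n σ x) = F.symIntegral n x := by
  induction x using F.sym_induction with
  | zero => simp
  | add x x' h h' => simp only [map_add, h, h']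
  | single π a =>
    rw [← F.el_mk, el_act, symIntegral_el, symIntegral_el]
    simp only [conj_eq_one_iff]

lemma symForm_apply (x y : SymTensor A n) :
    F.symForm n x y = F.symIntegral n (F.symMul n x y) := rfl

lemma symForm_symAct (σ : Perm (Fin n)) (x y : SymTensor A n) :
    F.symForm n (F.symAct n σ x) (F.symAct n σ y) = F.symForm n x y := by
  rw [symForm_apply, symForm_apply, ← symAct_symMul, symIntegral_symAct]

lemma mem_symInvariants {x : SymTensor A n} :
    x ∈ F.symInvariants n ↔ ∀ σ, F.symAct n σ x = x := by
  simp [symInvariants, Submodule.mem_iInf]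

lemma symMul_mem_symInvariants {x y : SymTensor A n} (hx : x ∈ F.symInvariants n)
    (hy : y ∈ F.symInvariants n) : F.symMul n x y ∈ F.symInvariants n := by
  rw [mem_symInvariants] at *
  intro σ
  rw [symAct_symMul, hx, hy]

/-! ### The unit of `A{S_n}` -/

variable (n) in
/-- The unit `(1 ⊗ ⋯ ⊗ 1) · id` of `A{S_n}`. -/
def symOne : SymTensor A n := F.el (IsOrbitMap.id_one (n := n)) 1

lemma push_id (x : F.Pow I) : F.pushLin id x = x := by
  conv_lhs => rw [← F.pullHom_id x]
  exact F.push_pullHom_of_bijective Function.bijective_id x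

lemma symOne_symMul (x : SymTensor A n) : F.symMul n (F.symOne n) x = x := by
  induction x using F.sym_induction with
  | zero => simp
  | add x x' h h' => simp only [map_add, h, h']
  | single π a =>
    have hs := isOrbitMap_mk_zpowers π
    have hs' : IsOrbitMap {1 * π} (Orb.mk (Subgroup.zpowers π)) := by rwa [_root_.one_mul]
    have hv : IsOrbitMap {1, π} (Orb.mk (Subgroup.zpowers π)) :=
      hs.congr fun R => by simp
    have hg : IsDefect 1 π (Orb.mk (Subgroup.zpowers π)) 0 := fun w => by
      rw [_root_.one_mul, orbitCount_one, orbitCount_self hs]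
      simp [add_assoc]
    rw [← F.el_mk, symOne, F.el_mul IsOrbitMap.id_one hs hs' hv (p := Orb.mk _) (q := id)
      (f := id) rfl rfl rfl hg, map_one, _root_.one_mul (F.pullHom _ _),
      pullHom_id, ePow_zero, _root_.mul_one a, push_id]
    exact F.el_congr_id (_root_.one_mul _) _ _ _

lemma symMul_symOne (x : SymTensor A n) : F.symMul n x (F.symOne n) = x := by
  induction x using F.sym_induction with
  | zero => simp
  | add x x' h h' => simp only [map_add, LinearMap.add_apply, h, h']
  | single π a =>
    have hs := isOrbitMap_mk_zpowers π
    have hs' : IsOrbitMap {π * 1} (Orb.mk (Subgroup.zpowers π)) := by rwa [_root_.mul_one]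
    have hv : IsOrbitMap {π, 1} (Orb.mk (Subgroup.zpowers π)) :=
      hs.congr fun R => by simp
    have hg : IsDefect π 1 (Orb.mk (Subgroup.zpowers π)) 0 := fun w => by
      rw [_root_.mul_one, orbitCount_one, orbitCount_self hs]
      simp only [Pi.zero_apply]
      ring
    rw [← F.el_mk, symOne, F.el_mul hs IsOrbitMap.id_one hs' hv (p := id) (q := Orb.mk _)
      (f := id) rfl rfl rfl hg, map_one, _root_.mul_one (F.pullHom _ _),
      pullHom_id, ePow_zero, _root_.mul_one a, push_id]
    exact F.el_congr_id (_root_.mul_one _) _ _ _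

lemma symOne_mem_symInvariants : F.symOne n ∈ F.symInvariants n := by
  rw [mem_symInvariants]
  intro σ
  rw [symOne, el_act, F.el_congr (by group) _ IsOrbitMap.id_one (φ := σ) (by ext; simp), map_one]

/-! ### Commutativity up to the action -/

/-- The products `aπ · bρ` and `(π̃(bρ)) · aπ` lie over the same permutation `πρ = (πρπ⁻¹)π` and are
computed over the same orbits. -/
lemma el_mul_comm {π ρ : Perm (Fin n)} {s : Fin n → I} {t : Fin n → J} (hs : IsOrbitMap {π} s)
    (ht : IsOrbitMap {ρ} t) {k l : ℤ} {a : F.Pow I} {b : F.Pow J} (ha : a ∈ F.deg I k)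
    (hb : b ∈ F.deg J l) : F.symMul n (F.el hs a) (F.el ht b) =
      sgn (k * l) • F.symMul n (F.symAct n π (F.el ht b)) (F.el hs a) := by
  have hu := isOrbitMap_mk_zpowers (π * ρ)
  have hv := isOrbitMap_mk (rfl : Subgroup.closure {π, ρ} = _)
  set u := Orb.mk (Subgroup.zpowers (π * ρ))
  set v := Orb.mk (Subgroup.closure {π, ρ})
  have vπ := hv.apply_perm π (by simp)
  have vρ := hv.apply_perm ρ (by simp)
  have vπ' : v ∘ ⇑π⁻¹ = v := funext fun i => by
    rw [Function.comp_apply, ← vπ, ← Perm.mul_apply, mul_inv_cancel, Perm.one_apply]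
  have hp := hs.lift_comp (f := v) (by simpa using vπ)
  have hq := ht.lift_comp (f := v) (by simpa using vρ)
  have hf := hu.lift_comp (f := v) (by simp [vπ, vρ])
  obtain ⟨g, hg⟩ := exists_isDefect π ρ hv
  have hmul : π * ρ = π * ρ * π⁻¹ * π := by group
  have hu' : IsOrbitMap {π * ρ * π⁻¹ * π} u := by rwa [← hmul]
  have hv' : IsOrbitMap {π * ρ * π⁻¹, π} v := by
    have := hv.conj_pair π
    rwa [vπ', mul_inv_cancel_right, Set.pair_comm (α := Perm (Fin n)) π (π * ρ * π⁻¹)] at this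
  have hg' : IsDefect (π * ρ * π⁻¹) π v g := by
    intro w
    have h1 := orbitCount_conj ρ π v vρ w
    have h2 := hg w
    rw [vπ'] at h1
    rw [h1, ← hmul]
    omega
  rw [el_act, F.el_mul hs ht hu hv hp hq hf hg, F.el_mul (ht.conj_singleton π) hs hu' hv'
    (by rw [← Function.comp_assoc, hq, vπ']) hp hf hg', ← map_smul, ← map_smul,
    ← smul_mul_assoc, F.mul_comm_of_mem_deg (F.pullHom_mem_deg _ ha) (F.pullHom_mem_deg _ hb)]
  have : sgn ((k + d * (Fintype.card I - Fintype.card (Orb (Subgroup.closure {π, ρ})))) *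
      (l + d * (Fintype.card J - Fintype.card (Orb (Subgroup.closure {π, ρ}))))) = sgn (k * l) := by
    refine sgn_congr ?_
    rw [show (k + d * (Fintype.card I - Fintype.card (Orb (Subgroup.closure {π, ρ})) : ℤ)) *
        (l + d * (Fintype.card J - Fintype.card (Orb (Subgroup.closure {π, ρ})) : ℤ)) - k * l =
      d * (k * (Fintype.card J - Fintype.card (Orb (Subgroup.closure {π, ρ})) : ℤ) +
        (Fintype.card I - Fintype.card (Orb (Subgroup.closure {π, ρ})) : ℤ) * (l + d *
        (Fintype.card J - Fintype.card (Orb (Subgroup.closure {π, ρ})) : ℤ))) by ring]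
    exact even_degree_mul _
  rw [this]
  exact F.el_congr_id hmul _ _ _

/-! ### The pairing of `A{S_n}` -/

/-- On the summands of `π` and `π⁻¹` the pairing is that of `A^{⊗ ⟨π⟩\[n]}`, since
`∫ f_* (x) = ∫ x`. -/
lemma symForm_el_inv {π ρ : Perm (Fin n)} {s : Fin n → I} (hs : IsOrbitMap {π} s)
    (ht : IsOrbitMap {ρ} s) (h : π * ρ = 1) (a b : F.Pow I) :
    F.symForm n (F.el hs a) (F.el ht b) = F.int I (a * b) := by
  have hu : IsOrbitMap {π * ρ} (id : Fin n → Fin n) := h ▸ IsOrbitMap.id_one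
  have hv : IsOrbitMap {π, ρ} s := hs.congr fun R => by
    refine ⟨fun hR τ hτ i => ?_, fun hR τ hτ => hR τ (by simp_all)⟩
    rcases hτ with rfl | rfl
    · exact hR _ rfl i
    · have := hR π rfl (τ i)
      rw [← Perm.mul_apply, h] at this
      exact R.symm this
  have hg : IsDefect π ρ s 0 := fun w => by
    rw [h, orbitCount_one, orbitCount_self hs, orbitCount_self ht]
    simp only [Pi.zero_apply]
    ring
  rw [symForm_apply, F.el_mul hs ht hu hv (p := id) (q := id) (f := s) rfl rfl rfl hg,
    symIntegral_el, if_pos h, int_push, ePow_zero, _root_.mul_one, pullHom_id, pullHom_id]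

end GradedFrobeniusAlgebra

/-! ### Decompositions by projections -/

/-- A family of submodules is a direct sum decomposition if there are projections onto its members
that annihilate the other members and add up to the identity. -/
lemma isInternal_of_projections {M : Type*} [AddCommGroup M] [Module ℚ M] {V : ℤ → Submodule ℚ M}
    (P : ℤ → M → M) (s : Finset ℤ) (hmem : ∀ k x, P k x ∈ V k)
    (hadd : ∀ k x y, P k (x + y) = P k x + P k y)
    (hof : ∀ j k x, x ∈ V j → P k x = if k = j then x else 0)
    (hsum : ∀ x, ∑ k ∈ s, P k x = x) : DirectSum.IsInternal V := by
  have hcoe : ∀ (x : ⨁ k, V k) k, P k (DirectSum.coeAddMonoidHom V x) = x k := by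
    intro x k
    induction x using DirectSum.induction_on with
    | zero => simpa using hof k k 0 (zero_mem _)
    | of j y =>
      rw [DirectSum.coeAddMonoidHom_of, hof j k y y.2, DirectSum.of_apply]
      split_ifs with h h' h'
      · subst h; rfl
      · exact absurd h.symm h'
      · exact absurd h'.symm h
      · rfl
    | add x y hx hy => rw [map_add, hadd, hx, hy]; rfl
  refine ⟨fun x y hxy => DFinsupp.ext fun k => Subtype.ext ?_, fun x => ?_⟩
  · rw [← hcoe, ← hcoe]
    exact congrArg _ hxy
  · refine ⟨∑ k ∈ s, DirectSum.of (fun k => V k) k ⟨P k x, hmem k x⟩, ?_⟩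
    rw [map_sum]
    simpa only [DirectSum.coeAddMonoidHom_of] using hsum x

/-- Projections that preserve a subspace decompose it. -/
lemma isInternal_comap_of_projections {M : Type*} [AddCommGroup M] [Module ℚ M]
    {V : ℤ → Submodule ℚ M} (N : Submodule ℚ M) (P : ℤ → M →ₗ[ℚ] M) (s : Finset ℤ)
    (hN : ∀ k, ∀ x ∈ N, P k x ∈ N) (hmem : ∀ k x, P k x ∈ V k)
    (hof : ∀ j k x, x ∈ V j → P k x = if k = j then x else 0)
    (hsum : ∀ x, ∑ k ∈ s, P k x = x) : DirectSum.IsInternal fun k => (V k).comap N.subtype := by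
  refine isInternal_of_projections (fun k x => ⟨P k x, hN k x x.2⟩) s (fun k x => hmem k x)
    (fun k x y => Subtype.ext (map_add (P k) _ _)) (fun j k x hx => Subtype.ext ?_)
    fun x => Subtype.ext ?_
  · refine (hof j k x hx).trans ?_
    split_ifs <;> rfl
  · rw [AddSubmonoidClass.coe_finsetSum]
    exact hsum _

namespace GradedFrobeniusAlgebra

variable {A : Type*} [AddCommGroup A] [Module ℚ A] {d : ℕ} (F : GradedFrobeniusAlgebra A d)
variable {n : ℕ}
variable {I J K W : Type*} [Fintype I] [LinearOrder I] [Fintype J] [LinearOrder J]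
  [Fintype K] [LinearOrder K] [Fintype W] [LinearOrder W]

/-! ### The coefficients of an element of `A{S_n}` -/

/-- The coefficient at `π` of an element of `A{S_n}`. -/
def coeff (π : Perm (Fin n)) : SymTensor A n →ₗ[ℚ] F.Pow (Orb (Subgroup.zpowers π)) :=
  DirectSum.component ℚ (Perm (Fin n)) (fun π => TensorPow A (Orb (Subgroup.zpowers π))) π

lemma coeff_single_self (π : Perm (Fin n)) (a : F.Pow (Orb (Subgroup.zpowers π))) :
    F.coeff π (F.single π a) = a :=
  DirectSum.of_eq_same (β := fun π => TensorPow A (Orb (Subgroup.zpowers π))) π a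

lemma coeff_single_of_ne {π ρ : Perm (Fin n)} (h : π ≠ ρ) (a : F.Pow (Orb (Subgroup.zpowers π))) :
    F.coeff ρ (F.single π a) = 0 :=
  DirectSum.of_eq_of_ne (β := fun π => TensorPow A (Orb (Subgroup.zpowers π))) π ρ a h.symm

lemma sum_single_coeff (x : SymTensor A n) : ∑ π, F.single π (F.coeff π x) = x :=
  DirectSum.sum_univ_of x

lemma finiteDimensional_symTensor (F : GradedFrobeniusAlgebra A d) (n : ℕ) :
    FiniteDimensional ℚ (SymTensor A n) := by
  have := F.finiteDimensional
  have h : ∀ π : Perm (Fin n), Module.Finite ℚ (TensorPow A (Orb (Subgroup.zpowers π))) :=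
    fun π => Module.Finite.of_basis
      (Basis.piTensorProduct fun _ : Orb (Subgroup.zpowers π) => Module.finBasis ℚ A)
  infer_instance

variable [Fact (Even d)]

lemma mem_symGrading {k : ℤ} {x : SymTensor A n} :
    x ∈ F.symGrading n k ↔ ∀ π, F.coeff π x ∈ F.deg (Orb (Subgroup.zpowers π)) k := by
  rw [symGrading, Submodule.mem_iInf]
  rfl

lemma single_mem_symGrading {k : ℤ} {π : Perm (Fin n)} {a : F.Pow (Orb (Subgroup.zpowers π))}
    (ha : a ∈ F.deg _ k) : F.single π a ∈ F.symGrading n k := by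
  rw [mem_symGrading]
  intro ρ
  by_cases h : π = ρ
  · subst h
    rwa [coeff_single_self]
  · rw [F.coeff_single_of_ne h]
    exact zero_mem _

/-! ### The pairing of `A{S_n}` is non-degenerate -/

lemma symForm_el_of_ne {π ρ : Perm (Fin n)} (h : π * ρ ≠ 1)
    (a : F.Pow (Orb (Subgroup.zpowers π))) (b : F.Pow (Orb (Subgroup.zpowers ρ))) :
    F.symForm n (F.single π a) (F.single ρ b) = 0 := by
  rw [symForm_apply, symMul_single]
  exact (F.symIntegral_single _ _).trans (if_neg h)

lemma isOrbitMap_inv (π : Perm (Fin n)) : IsOrbitMap {π⁻¹} (Orb.mk (Subgroup.zpowers π)) :=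
  isOrbitMap_mk (by rw [← Subgroup.zpowers_inv, Subgroup.zpowers_eq_closure])

/-- On `A{S_n}` the summands of `π` and `π⁻¹` are dual to each other. -/
theorem symForm_nondegenerate : (F.symForm n).Nondegenerate := by
  refine ⟨fun x hx => ?_, fun y hy => ?_⟩
  · rw [← F.sum_single_coeff x]
    refine Finset.sum_eq_zero fun π _ => ?_
    suffices F.coeff π x = 0 by rw [this, map_zero]
    refine F.eq_of_int_mul_eq fun b => ?_
    have h := hx (F.el (isOrbitMap_inv π) b)
    rw [← F.sum_single_coeff x, map_sum, LinearMap.sum_apply, Finset.sum_eq_single π,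
      ← F.el_mk, F.symForm_el_inv _ _ (mul_inv_cancel π)] at h
    · rw [h, zero_mul, map_zero]
    · intro ρ _ hρ
      rw [el_apply, F.symForm_el_of_ne]
      simpa [mul_inv_eq_one] using hρ
    · simp
  · rw [← F.sum_single_coeff y]
    refine Finset.sum_eq_zero fun π _ => ?_
    suffices F.coeff π y = 0 by rw [this, map_zero]
    refine (F.tensorForm_nondegenerate _).2 (F.coeff π y) fun (b : F.Pow _) => ?_
    have h := hy (F.el (isOrbitMap_inv π) b)
    rw [← F.sum_single_coeff y, map_sum, Finset.sum_eq_single π,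
      ← F.el_mk, F.symForm_el_inv _ _ (inv_mul_cancel π)] at h
    · exact h
    · intro ρ _ hρ
      rw [el_apply, F.symForm_el_of_ne]
      rw [Ne, inv_mul_eq_one]
      exact hρ.symm
    · simp

/-! ### The grading of `A{S_n}` -/

lemma degProj_eq_zero {k : ℤ} (hk : k < -(d * Fintype.card I) ∨ d * Fintype.card I < k)
    (x : F.Pow I) : F.degProj I k x = 0 := by
  rw [← F.sum_degProj (F.degProj I k x)]
  refine Finset.sum_eq_zero fun j hj => ?_
  rw [F.degProj_of_mem (F.degProj_mem k x), if_neg]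
  rintro rfl
  rw [Finset.mem_Icc] at hj
  omega

lemma card_orb_le (H : Subgroup (Perm (Fin n))) : Fintype.card (Orb H) ≤ n := by
  simpa using Fintype.card_le_of_surjective _ (Orb.mk_surjective H)

lemma card_orb_zpowers_one : Fintype.card (Orb (Subgroup.zpowers (1 : Perm (Fin n)))) = n := by
  rw [← Fintype.card_of_bijective
    (IsOrbitMap.id_one.lift_bijective (isOrbitMap_mk_zpowers (1 : Perm (Fin n)))), Fintype.card_fin]

/-- Relabelling of tensors preserves degrees. -/
lemma degProj_pullHom_of_bijective {φ : I → J} (h : Function.Bijective φ) (k : ℤ) (x : F.Pow I) :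
    F.degProj J k (F.pullHom φ x) = F.pullHom φ (F.degProj I k x) := by
  induction x using F.pow_induction (I := I) with
  | zero => simp
  | add x x' h h' => simp only [map_add, h, h']
  | smul c x h => simp only [map_smul, h]
  | pure p a ha =>
    have h1 := F.pullHom_mem_deg φ (F.pure_mem_deg ha)
    rw [Fintype.card_of_bijective h, sub_self, mul_zero, add_zero] at h1
    rw [F.degProj_of_mem h1, F.degProj_of_mem (F.pure_mem_deg ha), apply_ite (F.pullHom φ),
      map_zero]

variable (n) in
/-- The projection of `A{S_n}` onto its degree `k` part. -/
def symProj (k : ℤ) : SymTensor A n →ₗ[ℚ] SymTensor A n :=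
  ∑ π, F.single π ∘ₗ F.degProj _ k ∘ₗ F.coeff π

lemma symProj_single (k : ℤ) (π : Perm (Fin n)) (a : F.Pow (Orb (Subgroup.zpowers π))) :
    F.symProj n k (F.single π a) = F.single π (F.degProj _ k a) := by
  rw [symProj, LinearMap.sum_apply, Finset.sum_eq_single π]
  · simp only [LinearMap.comp_apply, coeff_single_self]
  · intro ρ _ hρ
    simp only [LinearMap.comp_apply, F.coeff_single_of_ne hρ.symm, map_zero]
  · simp

lemma symProj_mem (k : ℤ) (x : SymTensor A n) : F.symProj n k x ∈ F.symGrading n k := by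
  rw [symProj, LinearMap.sum_apply]
  exact sum_mem fun π _ => F.single_mem_symGrading (F.degProj_mem _ _)

lemma symProj_of_mem {j : ℤ} {x : SymTensor A n} (hx : x ∈ F.symGrading n j) (k : ℤ) :
    F.symProj n k x = if k = j then x else 0 := by
  rw [symProj, LinearMap.sum_apply]
  rw [mem_symGrading] at hx
  simp only [LinearMap.comp_apply, F.degProj_of_mem (hx _)]
  split_ifs
  · exact F.sum_single_coeff x
  · simp

lemma symProj_eq_zero {k : ℤ} (hk : k < -((n * d : ℕ) : ℤ) ∨ ((n * d : ℕ) : ℤ) < k)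
    (x : SymTensor A n) : F.symProj n k x = 0 := by
  rw [symProj, LinearMap.sum_apply]
  refine Finset.sum_eq_zero fun π _ => ?_
  have h : d * Fintype.card (Orb (Subgroup.zpowers π)) ≤ n * d := by
    rw [_root_.mul_comm n]
    exact Nat.mul_le_mul_left d (card_orb_le _)
  rw [LinearMap.comp_apply, LinearMap.comp_apply, F.degProj_eq_zero, map_zero]
  zify at h
  push_cast at hk
  omega

lemma sum_symProj (x : SymTensor A n) :
    ∑ k ∈ Finset.Icc (-((n * d : ℕ) : ℤ)) (n * d : ℕ), F.symProj n k x = x := by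
  induction x using F.sym_induction with
  | zero => simp
  | add x x' h h' => simp only [map_add, Finset.sum_add_distrib, h, h']
  | single π a =>
    have h : d * Fintype.card (Orb (Subgroup.zpowers π)) ≤ n * d := by
      rw [_root_.mul_comm n]
      exact Nat.mul_le_mul_left d (card_orb_le _)
    simp only [symProj_single]
    rw [← map_sum]
    congr 1
    conv_rhs => rw [← F.sum_degProj a]
    symm
    zify at h
    refine Finset.sum_subset (Finset.Icc_subset_Icc ?_ ?_) fun k _ hk => F.degProj_eq_zero ?_ a
    · push_cast; omega
    · push_cast; omega
    · rw [Finset.mem_Icc] at hk; omega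

lemma symProj_symAct (k : ℤ) (σ : Perm (Fin n)) (x : SymTensor A n) :
    F.symProj n k (F.symAct n σ x) = F.symAct n σ (F.symProj n k x) := by
  induction x using F.sym_induction with
  | zero => simp
  | add x x' h h' => simp only [map_add, h, h']
  | single π a =>
    rw [symProj_single, ← F.el_mk π a, ← F.el_mk, el_act, el_act, el_apply, el_apply,
      symProj_single, F.degProj_pullHom_of_bijective (IsOrbitMap.lift_bijective _
        (isOrbitMap_mk_zpowers _))]

/-- The shift of degrees by `nd` results from summing the graph defects over all orbits of
`⟨π, ρ⟩`. -/
lemma symMul_mem_symGrading {k l : ℤ} {x y : SymTensor A n} (hx : x ∈ F.symGrading n k)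
    (hy : y ∈ F.symGrading n l) :
    F.symMul n x y ∈ F.symGrading n (k + l + (n * d : ℕ)) := by
  rw [← F.sum_single_coeff x, ← F.sum_single_coeff y]
  simp only [map_sum, LinearMap.sum_apply]
  refine sum_mem fun ρ _ => sum_mem fun π _ => ?_
  rw [mem_symGrading] at hx hy
  have hs := isOrbitMap_mk_zpowers π
  have ht := isOrbitMap_mk_zpowers ρ
  have hu := isOrbitMap_mk_zpowers (π * ρ)
  have hv := isOrbitMap_mk (rfl : Subgroup.closure {π, ρ} = _)
  have vπ := hv.apply_perm π (by simp)
  have vρ := hv.apply_perm ρ (by simp)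
  have hp := hs.lift_comp (f := Orb.mk (Subgroup.closure {π, ρ})) (by simpa using vπ)
  have hq := ht.lift_comp (f := Orb.mk (Subgroup.closure {π, ρ})) (by simpa using vρ)
  have hf := hu.lift_comp (f := Orb.mk (Subgroup.closure {π, ρ})) (by simp [vπ, vρ])
  obtain ⟨g, hg⟩ := exists_isDefect π ρ hv
  have hcard := Finset.sum_congr (rfl : Finset.univ = _) fun w _ => hg w
  simp only [Finset.sum_add_distrib, ← Finset.mul_sum, ← fiberCard_eq_orbitCount hs hp,
    ← fiberCard_eq_orbitCount ht hq, ← fiberCard_eq_orbitCount hu hf, fiberCard,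
    ← Finset.card_eq_sum_card_fiberwise (fun _ _ => Finset.mem_coe.2 (Finset.mem_univ _)),
    Finset.card_univ, Finset.sum_const, Fintype.card_fin, smul_eq_mul] at hcard
  rw [← F.el_mk ρ, ← F.el_mk π, F.el_mul hs ht hu hv hp hq hf hg, F.el_mk]
  refine F.single_mem_symGrading ?_
  have := F.push_mem_deg (hu.lift (Orb.mk (Subgroup.closure {π, ρ})))
    (F.mul_mem_deg (F.mul_mem_deg (F.pullHom_mem_deg (hs.lift (Orb.mk _)) (hx π))
      (F.pullHom_mem_deg (ht.lift (Orb.mk _)) (hy ρ))) (F.ePow_mem_deg g))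
  convert this using 2
  zify at hcard
  push_cast
  linear_combination (-(d : ℤ)) * hcard

lemma symOne_mem_symGrading : F.symOne n ∈ F.symGrading n (-((n * d : ℕ) : ℤ)) := by
  rw [symOne, el_apply, map_one]
  refine F.single_mem_symGrading ?_
  have := F.one_mem_deg (I := Orb (Subgroup.zpowers (1 : Perm (Fin n))))
  rw [card_orb_zpowers_one] at this
  rwa [_root_.mul_comm n, Nat.cast_mul]

lemma symIntegral_eq_zero {k : ℤ} {x : SymTensor A n} (hx : x ∈ F.symGrading n k)
    (hk : k ≠ (n * d : ℕ)) : F.symIntegral n x = 0 := by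
  rw [← F.sum_single_coeff x, map_sum]
  refine Finset.sum_eq_zero fun π _ => ?_
  rw [symIntegral_single]
  split_ifs with h
  · subst h
    refine F.int_eq_zero ((F.mem_symGrading.1 hx) 1) ?_
    rwa [card_orb_zpowers_one, _root_.mul_comm, ← Nat.cast_mul]
  · rfl

/-- Graded commutativity, up to the action of `S_n` on the second factor, holds in `A{S_n}`, hence
it holds without restriction for an invariant second factor. -/
lemma symMul_comm {k l : ℤ} {x y : SymTensor A n} (hx : x ∈ F.symGrading n k)
    (hy : y ∈ F.symGrading n l) (hy' : y ∈ F.symInvariants n) :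
    F.symMul n x y = sgn (k * l) • F.symMul n y x := by
  rw [← F.sum_single_coeff x]
  simp only [map_sum, LinearMap.sum_apply, Finset.smul_sum]
  refine Finset.sum_congr rfl fun π _ => ?_
  conv_rhs => rw [← F.mem_symInvariants.1 hy' π]
  rw [← F.sum_single_coeff y]
  simp only [map_sum, LinearMap.sum_apply, Finset.smul_sum]
  refine Finset.sum_congr rfl fun ρ _ => ?_
  rw [← F.el_mk, ← F.el_mk]
  exact F.el_mul_comm _ _ (F.mem_symGrading.1 hx π) (F.mem_symGrading.1 hy ρ)

end GradedFrobeniusAlgebra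

lemma coe_negOnePow_smul {M : Type*} [AddCommGroup M] [Module ℚ M] (N : Submodule ℚ M) (k : ℤ)
    (x : N) : ((k.negOnePow • x : N) : M) = sgn k • (x : M) := by
  rw [negOnePow_smul_eq, Submodule.coe_smul]

namespace GradedFrobeniusAlgebra

variable {A : Type*} [AddCommGroup A] [Module ℚ A] {d : ℕ}

/-! ### The Frobenius algebra of invariants -/

section Invariants

variable (F : GradedFrobeniusAlgebra A d) (n : ℕ) [Fact (Even d)]

lemma sum_symAct_mem_symInvariants (z : SymTensor A n) :
    ∑ σ, F.symAct n σ z ∈ F.symInvariants n := by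
  rw [mem_symInvariants]
  intro τ
  simp only [map_sum, symAct_symAct]
  exact Fintype.sum_equiv (Equiv.mulLeft τ) _ _ fun σ => rfl

lemma symForm_sum_symAct_right {x : SymTensor A n} (hx : x ∈ F.symInvariants n)
    (z : SymTensor A n) :
    F.symForm n x (∑ σ, F.symAct n σ z) = Fintype.card (Perm (Fin n)) * F.symForm n x z := by
  rw [map_sum, Finset.sum_congr rfl fun σ _ => show F.symForm n x (F.symAct n σ z) =
    F.symForm n x z by rw [← F.symForm_symAct σ x z, F.mem_symInvariants.1 hx]]
  simp

lemma symForm_sum_symAct_left {x : SymTensor A n} (hx : x ∈ F.symInvariants n)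
    (z : SymTensor A n) :
    F.symForm n (∑ σ, F.symAct n σ z) x = Fintype.card (Perm (Fin n)) * F.symForm n z x := by
  rw [map_sum, LinearMap.sum_apply, Finset.sum_congr rfl fun σ _ =>
    show F.symForm n (F.symAct n σ z) x = F.symForm n z x by
      rw [← F.symForm_symAct σ z x, F.mem_symInvariants.1 hx]]
  simp

/-- The product of the subspace of invariants. -/
def invMul : F.symInvariants n →ₗ[ℚ] F.symInvariants n →ₗ[ℚ] F.symInvariants n :=
  LinearMap.mk₂ ℚ (fun x y => ⟨F.symMul n x y, F.symMul_mem_symInvariants x.2 y.2⟩)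
    (fun x y z => Subtype.ext (by simp)) (fun c x y => Subtype.ext (by simp))
    (fun x y z => Subtype.ext (by simp)) (fun c x y => Subtype.ext (by simp))

/-- Averaging over `S_n` reduces the non-degeneracy of the form on the invariants to that of the
form on `A{S_n}`. -/
lemma invForm_nondegenerate :
    ((F.invMul n).compr₂ (F.symIntegral n ∘ₗ (F.symInvariants n).subtype)).Nondegenerate := by
  have hcard : (Fintype.card (Perm (Fin n)) : ℚ) ≠ 0 := Nat.cast_ne_zero.2 Fintype.card_ne_zero
  refine ⟨fun x hx => Subtype.ext (F.symForm_nondegenerate.1 (x : SymTensor A n) fun z => ?_),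
    fun x hx => Subtype.ext (F.symForm_nondegenerate.2 (x : SymTensor A n) fun z => ?_)⟩
  · have h : F.symForm n x (∑ σ, F.symAct n σ z) = 0 :=
      hx ⟨_, F.sum_symAct_mem_symInvariants n z⟩
    rw [F.symForm_sum_symAct_right n x.2] at h
    exact (mul_eq_zero.1 h).resolve_left hcard
  · have h : F.symForm n (∑ σ, F.symAct n σ z) x = 0 :=
      hx ⟨_, F.sum_symAct_mem_symInvariants n z⟩
    rw [F.symForm_sum_symAct_left n x.2] at h
    exact (mul_eq_zero.1 h).resolve_left hcard

lemma symProj_mem_symInvariants (k : ℤ) {x : SymTensor A n} (hx : x ∈ F.symInvariants n) :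
    F.symProj n k x ∈ F.symInvariants n := by
  rw [mem_symInvariants] at *
  intro σ
  rw [← symProj_symAct, hx]

lemma isInternal_invariants :
    DirectSum.IsInternal fun k => (F.symGrading n k).comap (F.symInvariants n).subtype :=
  isInternal_comap_of_projections (F.symInvariants n) (F.symProj n)
    (Finset.Icc (-((n * d : ℕ) : ℤ)) (n * d : ℕ))
    (fun k _ hx => F.symProj_mem_symInvariants n k hx) F.symProj_mem
    (fun _ k _ hx => F.symProj_of_mem hx k) F.sum_symProj

/-- The graded Frobenius algebra `A^{[n]}`, for `d` even. -/
def invariantsAlgebra : GradedFrobeniusAlgebra (F.symInvariants n) (n * d) where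
  grading k := (F.symGrading n k).comap (F.symInvariants n).subtype
  mul := F.invMul n
  one := ⟨F.symOne n, F.symOne_mem_symInvariants⟩
  integral := F.symIntegral n ∘ₗ (F.symInvariants n).subtype
  finiteDimensional := by
    have := F.finiteDimensional_symTensor n
    infer_instance
  isInternal := F.isInternal_invariants n
  grading_eq_bot k hk := by
    rw [eq_bot_iff]
    intro x hx
    have h := F.symProj_of_mem hx k
    rw [if_pos rfl, F.symProj_eq_zero hk] at h
    exact Subtype.ext h.symm
  mul_mem _ _ _ _ ha hb := F.symMul_mem_symGrading ha hb
  mul_assoc _ _ _ := Subtype.ext (F.symMul_assoc _ _ _)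
  one_mul _ := Subtype.ext (F.symOne_symMul _)
  mul_one _ := Subtype.ext (F.symMul_symOne _)
  one_mem := F.symOne_mem_symGrading
  mul_comm _ _ _ y hx hy := by
    refine Subtype.ext (Eq.trans ?_ (coe_negOnePow_smul _ _ _).symm)
    exact F.symMul_comm hx hy y.2
  integral_eq_zero _ _ ha hk := F.symIntegral_eq_zero ha hk
  nondegenerate := F.invForm_nondegenerate n

end Invariants

/-! ### Odd degree -/

/-- The unit of a graded Frobenius algebra of odd degree is of odd degree, so that its square `1` is
equal to `-1`. -/
lemma subsingleton_of_odd (F : GradedFrobeniusAlgebra A d) (hd : Odd d) : Subsingleton A := by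
  have h := F.mul_comm _ _ _ _ F.one_mem F.one_mem
  rw [F.one_mul, neg_mul_neg, negOnePow_smul_eq, sgn_odd (by exact_mod_cast hd.mul hd),
    neg_one_smul, eq_neg_iff_add_eq_zero, ← two_smul ℚ, smul_eq_zero_iff_right two_ne_zero] at h
  refine subsingleton_of_forall_eq 0 fun a => ?_
  rw [← F.one_mul a, h, map_zero, LinearMap.zero_apply]

/-- The zero algebra is a graded Frobenius algebra of any degree. -/
def ofSubsingleton (M : Type*) [AddCommGroup M] [Module ℚ M] [Subsingleton M] (d : ℕ) :
    GradedFrobeniusAlgebra M d where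
  grading _ := ⊤
  mul := 0
  one := 0
  integral := 0
  finiteDimensional := inferInstance
  isInternal := isInternal_of_projections (fun _ _ => 0) ∅ (fun _ _ => zero_mem _)
    (fun _ _ _ => Subsingleton.elim _ _) (fun _ _ _ _ => Subsingleton.elim _ _)
    (fun _ => Subsingleton.elim _ _)
  grading_eq_bot _ _ := Subsingleton.elim _ _
  mul_mem _ _ _ _ _ _ := trivial
  mul_assoc _ _ _ := Subsingleton.elim _ _
  one_mul _ := Subsingleton.elim _ _
  mul_one _ := Subsingleton.elim _ _
  one_mem := trivial
  mul_comm _ _ _ _ _ _ := Subsingleton.elim _ _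
  integral_eq_zero _ _ _ _ := rfl
  nondegenerate := ⟨fun _ _ => Subsingleton.elim _ _, fun _ _ => Subsingleton.elim _ _⟩

section Subsingleton

variable [Subsingleton A] {d' : ℕ} (F : GradedFrobeniusAlgebra A d)
  (F' : GradedFrobeniusAlgebra A d') {I J : Type*} [Fintype I] [LinearOrder I] [Fintype J]
  [LinearOrder J] (n : ℕ)

lemma subsingleton_tensorPow [Nonempty I] : Subsingleton (TensorPow A I) := by
  refine subsingleton_of_forall_eq 0 fun x => ?_
  induction x using PiTensorProduct.induction_on with
  | smul_tprod r a =>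
    obtain ⟨i⟩ := ‹Nonempty I›
    rw [(PiTensorProduct.tprod ℚ).map_coord_zero i (Subsingleton.elim _ _), smul_zero]
  | add x y hx hy => rw [hx, hy, add_zero]

variable (I) in
lemma tensorMul_congr : F.tensorMul I = F'.tensorMul I := by
  cases isEmpty_or_nonempty I
  · have h : ∀ p q : I → ℤ, (PiTensorProduct.map₂ fun i : I => F.mul.compl₁₂ (F.component (p i))
        (F.component (q i))) = PiTensorProduct.map₂ fun i : I => F'.mul.compl₁₂
        (F'.component (p i)) (F'.component (q i)) :=
      fun p q => congrArg _ (Subsingleton.elim _ _)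
    have h' : multidegrees d I = multidegrees d' I := by ext p; simp [multidegrees]
    simp only [tensorMul, h, h']
  · have := subsingleton_tensorPow (A := A) (I := I)
    exact Subsingleton.elim _ _

variable (I) in
lemma tensorForm_congr : F.tensorForm I = F'.tensorForm I := by
  have h : F.integral = F'.integral := Subsingleton.elim _ _
  rw [tensorForm, tensorForm, F.tensorMul_congr F', tensorIntegral, tensorIntegral, h]

lemma pull_congr (φ : I → J) : F.pull φ = F'.pull φ := by
  cases isEmpty_or_nonempty I
  · have h : ∀ p : I → ℤ, (F.fiberProd φ).compLinearMap (fun i => F.component (p i)) =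
        (F'.fiberProd φ).compLinearMap fun i => F'.component (p i) := fun p =>
      MultilinearMap.ext fun a => congrArg (PiTensorProduct.tprod ℚ) (Subsingleton.elim _ _)
    have h' : multidegrees d I = multidegrees d' I := by ext p; simp [multidegrees]
    simp only [pull, h, h']
  · have := subsingleton_tensorPow (A := A) (I := I)
    exact LinearMap.ext fun x => by rw [Subsingleton.elim x 0, map_zero, map_zero]

lemma push_congr (φ : I → J) : F.push φ = F'.push φ := by
  refine LinearMap.ext fun x => sub_eq_zero.1 ((F.tensorForm_nondegenerate I).1 _ fun y => ?_)
  rw [map_sub, LinearMap.sub_apply, tensorForm_push, F.tensorForm_congr F' I, tensorForm_push,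
    F.tensorForm_congr F' J, F.pull_congr F', sub_self]

lemma symMul_congr : F.symMul n = F'.symMul n := by
  have h : ∀ π ρ : Perm (Fin n), F.symMulAux π ρ = F'.symMulAux π ρ := fun π ρ => by
    have he : (F.eulerPow fun B : Orb (Subgroup.closure {π, ρ}) => ⌊graphDefect π ρ B⌋₊) =
      F'.eulerPow fun B => ⌊graphDefect π ρ B⌋₊ :=
        congrArg (PiTensorProduct.tprod ℚ) (Subsingleton.elim _ _)
    simp only [symMulAux, F.tensorMul_congr F', F.pull_congr F', F.push_congr F', he]
  simp only [symMul, h]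

lemma symAct_congr : F.symAct n = F'.symAct n := by
  funext σ
  simp only [symAct, F.pull_congr F']

lemma symIntegral_congr : F.symIntegral n = F'.symIntegral n := by
  have h : F.integral = F'.integral := Subsingleton.elim _ _
  simp only [symIntegral, tensorIntegral, h]

lemma symForm_congr : F.symForm n = F'.symForm n := by
  rw [symForm, symForm, F.symMul_congr F', F.symIntegral_congr F']

lemma symGrading_congr : F.symGrading n = F'.symGrading n := by
  have h : F.grading = F'.grading := funext fun i => Subsingleton.elim _ _
  funext k
  simp only [symGrading, tensorGrading, h]

lemma symInvariants_congr : F.symInvariants n = F'.symInvariants n := by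
  rw [symInvariants, symInvariants, F.symAct_congr F']

lemma subsingleton_symTensor (hn : n ≠ 0) : Subsingleton (SymTensor A n) := by
  have h : ∀ π : Perm (Fin n), Subsingleton (TensorPow A (Orb (Subgroup.zpowers π))) := fun π =>
    have : Nonempty (Orb (Subgroup.zpowers π)) := ⟨Orb.mk _ ⟨0, Nat.pos_of_ne_zero hn⟩⟩
    subsingleton_tensorPow
  infer_instance

end Subsingleton

end GradedFrobeniusAlgebra

theorem mainTheorem4 {A : Type*} [AddCommGroup A] [Module ℚ A] {d : ℕ}
    (F : GradedFrobeniusAlgebra A d) (n : ℕ) :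
    (F.symForm n).Nondegenerate ∧
    (∀ (σ : Equiv.Perm (Fin n)) (x y : SymTensor A n),
      F.symForm n (F.symAct n σ x) (F.symAct n σ y) = F.symForm n x y) ∧
    ∃ G : GradedFrobeniusAlgebra (F.symInvariants n) (n * d),
      (∀ k : ℤ, G.grading k = (F.symGrading n k).comap (F.symInvariants n).subtype) ∧
      (∀ x y : F.symInvariants n, (G.mul x y : SymTensor A n) = F.symMul n x y) ∧
      (∀ x : F.symInvariants n, G.integral x = F.symIntegral n x) := by
  rcases Nat.even_or_odd d with hd | hd
  · have : Fact (Even d) := ⟨hd⟩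
    exact ⟨F.symForm_nondegenerate, fun σ x y => F.symForm_symAct σ x y,
      F.invariantsAlgebra n, fun _ => rfl, fun _ _ => rfl, fun _ => rfl⟩
  · have := F.subsingleton_of_odd hd
    rcases eq_or_ne n 0 with rfl | hn
    · -- All constructions agree with those for the zero algebra of degree `0`.
      let F' := GradedFrobeniusAlgebra.ofSubsingleton A 0
      have : Fact (Even 0) := ⟨Even.zero⟩
      rw [F.symForm_congr F', F.symAct_congr F', F.symGrading_congr F', F.symMul_congr F',
        F.symIntegral_congr F', F.symInvariants_congr F', Nat.zero_mul]
      exact ⟨F'.symForm_nondegenerate, fun σ x y => F'.symForm_symAct σ x y,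
        F'.invariantsAlgebra 0, fun _ => rfl, fun _ _ => rfl, fun _ => rfl⟩
    · have := GradedFrobeniusAlgebra.subsingleton_symTensor (A := A) n hn
      refine ⟨⟨fun _ _ => Subsingleton.elim _ _, fun _ _ => Subsingleton.elim _ _⟩,
        fun σ x y => by congr 2 <;> exact Subsingleton.elim _ _,
        .ofSubsingleton _ _, fun _ => Subsingleton.elim _ _, fun _ _ => Subsingleton.elim _ _,
        fun x => ?_⟩
      rw [Subsingleton.elim x 0, map_zero, Submodule.coe_zero, map_zero]

end
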